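/- Throughout, work over $\mathbb{Q}$ with homological grading (differentials of degree $-1$) and Koszul signs. Let $A_\infty$ be the non-unital non-symmetric dg operad with $A_\infty(n)=C_*(K(n),\mathbb{Q})$, $n\ge 2$, the cellular chains of the $n$-th associahedron: $A_\infty(n)$ is spanned by pairs $(T,\sigma)$, where $T$ is a planar rooted tree with $n$ leaves all of whose internal vertices have at least two inputs and $\sigma$ is an orientation of the vector space spanned by its internal edges, modulo $(T,-\sigma)=-(T,\sigma)$; a tree with $k$ internal edges has degree $n-2-k$. The differential is $\partial(U,\sigma)=\sum_{V/e=U}(V,e\wedge\sigma)$, and for $(U,\sigma)\in A_\infty(n_1)$, $(V,\tau)\in A_\infty(n_2)$ with $|V|=l$ and $1\le i\le n_1$ the composition is $(U,\sigma)\circ_i(V,\tau)=(-1)^{i(n_2+1)+n_1 l}(U\circ_i V,\sigma\wedge\tau\wedge e)$, where $V$ is grafted to the $i$-th leaf of $U$ and $e$ is the new edge. It is a cyclic operad: the generator $r$ of $\mathbb{Z}/(n+1)\mathbb{Z}$ acts on $A_\infty(n)$ by $r(T,\sigma)=(-1)^n(r(T),\sigma)$, where $r(T)$ is $T$ re-rooted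 so that leaf $j<n$ becomes leaf $j+1$, leaf $n$ becomes the root and the root becomes leaf $1$. Tensor products of operads are taken arity-wise, with $(U_1\otimes U_2)\circ_i(V_1\otimes V_2)=(-1)^{|U_2||V_1|}(U_1\circ_i V_1)\otimes(U_2\circ_i V_2)$, differential $\partial(U_1\otimes U_2)=\partial U_1\otimes U_2+(-1)^{|U_1|}U_1\otimes\partial U_2$, and cyclic action $r\otimes r$. Let $\mathcal{A}s$ be the non-unital associative operad, $\mathcal{A}s(n)=\mathbb{Q}\mu_n$ for $n\ge2$, and identify $H_*(A_\infty)\cong\mathcal{A}s$ by the operad isomorphism which sends the class of the corolla $c_2$ with two leaves to $\mu_2$. A *cyclic diagonal* is a morphism of dg operads $\Delta:A_\infty\to A_\infty\otimes A_\infty$ (degree-preserving chain maps compatible with all $\circ_i$) such that the map it induces on homology is the canonical diagonal $\mu_n\mapsto\mu_n\otimes\mu_n$ of $\mathcal{A}s$, and such that $\Delta\circ r=(r\otimes r)\circ\Delta$. Let $\Omega^*_{[0,1]}=\mathbb{Q}[t]\oplus\mathbb{Q}[t]\,dt$ be the commutative dg algebra of polynomial differential forms on $[0,1]$ with the de Rham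 differential, where $\mathbb{Q}[t]$ has degree $0$ and $\mathbb{Q}[t]\,dt$ has degree $-1$. For an operad $\mathcal{O}$, let $\mathcal{O}\otimes\Omega^*_{[0,1]}$ be the operad with $(\mathcal{O}\otimes\Omega^*_{[0,1]})(n)=\mathcal{O}(n)\otimes\Omega^*_{[0,1]}$, with the tensor product differential and Koszul signs as above, the multiplication of forms in the second factor, and the trivial cyclic action on that factor; for $s\in\{0,1\}$, a map $h$ into $\mathcal{O}\otimes\Omega^*_{[0,1]}$ gives $h(s)$ by $x\otimes(f+g\,dt)\mapsto f(s)x$. **Theorem.** Let $\Delta_1,\Delta_2:A_\infty\to A_\infty\otimes A_\infty$ be two cyclic diagonals. Then there exists a cyclic homotopy between them, that is, a morphism of dg operads $$h:A_\infty\longrightarrow A_\infty\otimes A_\infty\otimes\Omega^*_{[0,1]}$$ which commutes with the cyclic actions and satisfies $h(0)=\Delta_1$ and $h(1)=\Delta_2$. -/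

import Mathlib

open scoped TensorProduct Polynomial

namespace CyclicOperad

/-! ### Cyclic non-symmetric dg operads over `ℚ` and their morphisms -/

/-- The operations of a (non-unital) cyclic non-symmetric dg operad over `ℚ`, with homological
grading.  The axioms of a cyclic operad are not fields: the structure is only a common format
in which the concrete operads below are written down and their morphisms are defined. -/
structure OpData where
  /-- the space of operations of arity `n` -/
  carrier : ℕ → Type
  [addCommGroup : ∀ n, AddCommGroup (carrier n)]
  [module : ∀ n, Module ℚ (carrier n)]
  /-- the elements of degree `p` -/
  deg : ∀ n, ℤ → Submodule ℚ (carrier n)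
  /-- the operator `x ↦ (-1)^|x| x`, through which Koszul signs are written -/
  sgn : ∀ n, carrier n →ₗ[ℚ] carrier n
  /-- the differential -/
  d : ∀ n, carrier n →ₗ[ℚ] carrier n
  /-- `comp m n i x y` is the partial composition `x ∘ᵢ y`, meaningful for `1 ≤ i ≤ m` -/
  comp : ∀ m n : ℕ, ℕ → carrier m →ₗ[ℚ] carrier n →ₗ[ℚ] carrier (m + n - 1)
  /-- the action of the generator `r` of `ℤ/(n+1)` -/
  rot : ∀ n, carrier n →ₗ[ℚ] carrier n
  iSup_deg : ∀ n, ⨆ p, deg n p = ⊤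
  sgn_of_mem : ∀ n p, ∀ x ∈ deg n p, sgn n x = (-1 : ℚ) ^ p • x

attribute [instance] OpData.addCommGroup OpData.module

/-- Morphisms of dg operads: chain maps of degree zero, compatible with the compositions. -/
structure Hom (O P : OpData) where
  toFun : ∀ n, O.carrier n →ₗ[ℚ] P.carrier n
  map_deg : ∀ n p, ∀ x ∈ O.deg n p, toFun n x ∈ P.deg n p
  map_d : ∀ n x, toFun n (O.d n x) = P.d n (toFun n x)
  map_comp : ∀ m n i, 1 ≤ i → i ≤ m → ∀ x y,
    toFun (m + n - 1) (O.comp m n i x y) = P.comp m n i (toFun m x) (toFun n y)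

/-- A morphism is cyclic if it commutes with the cyclic group actions. -/
def Hom.IsCyclic {O P : OpData} (f : Hom O P) : Prop :=
  ∀ n x, f.toFun n (O.rot n x) = P.rot n (f.toFun n x)

/-- Two cycles are homologous, i.e. define the same homology class, if they differ by a
boundary. -/
def OpData.Homologous (O : OpData) {n : ℕ} (x y : O.carrier n) : Prop :=
  x - y ∈ LinearMap.range (O.d n)

/-! ### Tensor products -/

/-- `(x ⊗ x') ∘ᵢ (y ⊗ y') = (-1)^(|x'||y|) (x ∘ᵢ y) ⊗ (x' ∘ᵢ y')`.  The sign is written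
bilinearly: `(-1)^(ab) = (1 + (-1)^a + (-1)^b - (-1)^a (-1)^b) / 2`. -/
noncomputable def tensorComp (O P : OpData) (m n i : ℕ) :
    O.carrier m ⊗[ℚ] P.carrier m →ₗ[ℚ] O.carrier n ⊗[ℚ] P.carrier n →ₗ[ℚ]
      O.carrier (m + n - 1) ⊗[ℚ] P.carrier (m + n - 1) :=
  (1 / 2 : ℚ) •
    (TensorProduct.map₂ (O.comp m n i) (P.comp m n i)
      + TensorProduct.map₂ (O.comp m n i) (P.comp m n i ∘ₗ P.sgn m)
      + TensorProduct.map₂ ((O.comp m n i).compl₂ (O.sgn n)) (P.comp m n i)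
      - TensorProduct.map₂ ((O.comp m n i).compl₂ (O.sgn n)) (P.comp m n i ∘ₗ P.sgn m))

theorem tensorComp_tmul (O P : OpData) (m n i : ℕ) (p q : ℤ)
    (x : O.carrier m) (x' : P.carrier m) (y : O.carrier n) (y' : P.carrier n)
    (hx' : x' ∈ P.deg m p) (hy : y ∈ O.deg n q) :
    tensorComp O P m n i (x ⊗ₜ x') (y ⊗ₜ y')
      = (-1 : ℚ) ^ (p * q) • (O.comp m n i x y ⊗ₜ[ℚ] P.comp m n i x' y') := by
  simp only [tensorComp, LinearMap.smul_apply, LinearMap.add_apply, LinearMap.sub_apply,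
    TensorProduct.map₂_apply_tmul, TensorProduct.map_tmul, LinearMap.comp_apply,
    LinearMap.compl₂_apply, P.sgn_of_mem m p x' hx', O.sgn_of_mem n q y hy, map_smul]
  rcases Int.even_or_odd p with hp | hp <;> rcases Int.even_or_odd q with hq | hq
  · rw [hp.neg_one_zpow, hq.neg_one_zpow, (hp.mul_right q).neg_one_zpow]
    simp only [one_smul]; module
  · rw [hp.neg_one_zpow, hq.neg_one_zpow, (hp.mul_right q).neg_one_zpow]
    simp only [one_smul, neg_smul, TensorProduct.neg_tmul]; module
  · rw [hp.neg_one_zpow, hq.neg_one_zpow, (hq.mul_left p).neg_one_zpow]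
    simp only [one_smul, neg_smul, TensorProduct.tmul_neg]; module
  · rw [hp.neg_one_zpow, hq.neg_one_zpow, (hp.mul hq).neg_one_zpow]
    simp only [one_smul, neg_smul, TensorProduct.tmul_neg,
      TensorProduct.neg_tmul, neg_neg]; module

/-- The tensor product of cyclic dg operads: arity-wise tensor product, with differential
`d(x ⊗ y) = dx ⊗ y + (-1)^|x| x ⊗ dy` and the diagonal cyclic action. -/
noncomputable def tensor (O P : OpData) : OpData where
  carrier n := O.carrier n ⊗[ℚ] P.carrier n
  deg n p := ⨆ q : ℤ,
    Submodule.map₂ (TensorProduct.mk ℚ (O.carrier n) (P.carrier n)) (O.deg n q) (P.deg n (p - q))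
  sgn n := TensorProduct.map (O.sgn n) (P.sgn n)
  d n := TensorProduct.map (O.d n) LinearMap.id + TensorProduct.map (O.sgn n) (P.d n)
  comp m n i := tensorComp O P m n i
  rot n := TensorProduct.map (O.rot n) (P.rot n)
  iSup_deg n := by
    rw [eq_top_iff, ← TensorProduct.map₂_mk_top_top_eq_top, ← O.iSup_deg n, ← P.iSup_deg n,
      Submodule.map₂_iSup_left]
    refine iSup_le fun a => ?_
    rw [Submodule.map₂_iSup_right]
    refine iSup_le fun b => ?_
    refine le_trans ?_ (le_iSup _ (a + b))
    refine le_trans ?_ (le_iSup _ a)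
    rw [add_sub_cancel_left]
  sgn_of_mem n p := by
    intro x hx
    suffices h : (⨆ q : ℤ, Submodule.map₂ (TensorProduct.mk ℚ (O.carrier n) (P.carrier n))
        (O.deg n q) (P.deg n (p - q))) ≤ LinearMap.ker
          (TensorProduct.map (O.sgn n) (P.sgn n) - (-1 : ℚ) ^ p • LinearMap.id) by
      have := h hx
      rwa [LinearMap.mem_ker, LinearMap.sub_apply, LinearMap.smul_apply, LinearMap.id_apply,
        sub_eq_zero] at this
    refine iSup_le fun q => Submodule.map₂_le.2 fun a ha b hb => ?_
    rw [LinearMap.mem_ker, LinearMap.sub_apply, LinearMap.smul_apply, LinearMap.id_apply,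
      TensorProduct.mk_apply, TensorProduct.map_tmul, O.sgn_of_mem n q a ha,
      P.sgn_of_mem n (p - q) b hb, ← TensorProduct.smul_tmul', TensorProduct.tmul_smul, smul_smul,
      ← zpow_add₀ (by norm_num : (-1 : ℚ) ≠ 0), add_sub_cancel, sub_self]

/-! ### Planar trees and the `A∞` operad -/

/-- An internal edge of a planar rooted tree with leaves `1, …, n` is recorded by the set of
leaves above it, an interval `{a, …, b}`, written as the pair `(a, b)`.  The lexicographic order
is used only to fix a reference orientation of each tree. -/
abbrev Edge : Type := ℕ ×ₗ ℕ

/-- The edge whose leaves are `a, …, b`. -/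
abbrev edge (a b : ℕ) : Edge := toLex (a, b)

/-- the first leaf above an edge -/
abbrev fstLeaf (e : Edge) : ℕ := (ofLex e).1

/-- the last leaf above an edge -/
abbrev lstLeaf (e : Edge) : ℕ := (ofLex e).2

/-- Two edges can occur in the same tree: their sets of leaves are nested or disjoint. -/
def Compatible (e f : Edge) : Prop :=
  lstLeaf e < fstLeaf f ∨ lstLeaf f < fstLeaf e ∨
    (fstLeaf e ≤ fstLeaf f ∧ lstLeaf f ≤ lstLeaf e) ∨
    (fstLeaf f ≤ fstLeaf e ∧ lstLeaf e ≤ lstLeaf f)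

instance (e f : Edge) : Decidable (Compatible e f) := by
  unfold Compatible; infer_instance

/-- `S` is the set of internal edges of a planar rooted tree with `n ≥ 2` leaves all of whose
internal vertices have at least two inputs.  Such a tree is determined by this set, and the sets
which arise are the sets of pairwise compatible intervals with at least two and fewer than `n`
leaves. -/
def IsTree (n : ℕ) (S : Finset Edge) : Prop :=
  2 ≤ n ∧
    (∀ e ∈ S, 1 ≤ fstLeaf e ∧ fstLeaf e < lstLeaf e ∧ lstLeaf e ≤ n ∧ e ≠ edge 1 n) ∧
    ∀ e ∈ S, ∀ f ∈ S, Compatible e f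

instance (n : ℕ) (S : Finset Edge) : Decidable (IsTree n S) := by
  unfold IsTree; infer_instance

/-- Planar rooted trees with `n` leaves, i.e. cells of the associahedron `K(n)`. -/
abbrev Tree (n : ℕ) : Type := {S : Finset Edge // IsTree n S}

/-- The dimension of the cell of `K(n)` corresponding to a tree. -/
def Tree.degree {n : ℕ} (T : Tree n) : ℤ := n - 2 - T.1.card

/-- The internal edges of a tree in increasing order; they give its reference orientation. -/
def Tree.edges {n : ℕ} (T : Tree n) : List Edge := T.1.sort (· ≤ ·)

/-- The number of inversions of a list of edges. -/
def inversions : List Edge → ℕ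
  | [] => 0
  | e :: l => (l.filter (· < e)).length + inversions l

/-- The space with basis the trees with `n` leaves; the basis element of a tree `T` stands for
`(T, e₁ ∧ ⋯ ∧ e_k)` with `e₁ < ⋯ < e_k` the internal edges of `T`. -/
abbrev TreeSpace (n : ℕ) : Type := Tree n →₀ ℚ

/-- For pairwise distinct `e₁, …, e_k` which are the internal edges of a tree `T` with `n` leaves,
`oriented n [e₁, …, e_k]` is `(T, e₁ ∧ ⋯ ∧ e_k)`, where `(T, -ω) = -(T, ω)`.  For all other lists
it is zero. -/
noncomputable def oriented (n : ℕ) (l : List Edge) : TreeSpace n :=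
  if h : l.Nodup ∧ IsTree n l.toFinset then
    Finsupp.single ⟨l.toFinset, h.2⟩ ((-1) ^ inversions l)
  else 0

/-- `∂(U, σ) = ∑ (V, e ∧ σ)` over all trees `V` with an internal edge `e` such that `V / e = U`. -/
noncomputable def treeD (n : ℕ) : TreeSpace n →ₗ[ℚ] TreeSpace n :=
  Finsupp.linearCombination ℚ fun U : Tree n =>
    ∑ a ∈ Finset.Icc 1 n, ∑ b ∈ Finset.Icc 1 n, oriented n (edge a b :: U.edges)

/-- The edge of `U ∘ᵢ V` coming from an edge of `U`, where `V` has `n₂` leaves: the leaf `i` of `U`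
is replaced by the leaves `i, …, i + n₂ - 1`. -/
def outerEdge (n₂ i : ℕ) (e : Edge) : Edge :=
  edge (if fstLeaf e ≤ i then fstLeaf e else fstLeaf e + n₂ - 1)
    (if lstLeaf e < i then lstLeaf e else lstLeaf e + n₂ - 1)

/-- The edge of `U ∘ᵢ V` coming from an edge of `V`. -/
def innerEdge (i : ℕ) (e : Edge) : Edge :=
  edge (fstLeaf e + i - 1) (lstLeaf e + i - 1)

/-- `(U, σ) ∘ᵢ (V, τ) = (-1)^(i (n₂ + 1) + n₁ |V|) (U ∘ᵢ V, σ ∧ τ ∧ e)`, where `U`, `V` have `n₁`,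
`n₂` leaves, the root of `V` is grafted to the `i`-th leaf of `U`, and `e` is the new edge. -/
noncomputable def treeComp (n₁ n₂ i : ℕ) :
    TreeSpace n₁ →ₗ[ℚ] TreeSpace n₂ →ₗ[ℚ] TreeSpace (n₁ + n₂ - 1) :=
  Finsupp.linearCombination ℚ fun U : Tree n₁ =>
    Finsupp.linearCombination ℚ fun V : Tree n₂ =>
      (-1 : ℚ) ^ ((i : ℤ) * (n₂ + 1) + n₁ * V.degree) •
        oriented (n₁ + n₂ - 1)
          (U.edges.map (outerEdge n₂ i) ++ V.edges.map (innerEdge i) ++ [edge i (i + n₂ - 1)])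

/-- The effect on edges of the counterclockwise rotation, by which the leaf `j < n` becomes the
leaf `j + 1`, the leaf `n` becomes the root and the root becomes the leaf `1`.  The edge of
`{a, …, n}` separates these leaves from the root and from `1, …, a - 1`, so that after the rotation
the leaves above it are `1, …, a`. -/
def rotEdge (n : ℕ) (e : Edge) : Edge :=
  if lstLeaf e < n then edge (fstLeaf e + 1) (lstLeaf e + 1) else edge 1 (fstLeaf e)

/-- `r(T, σ) = (-1)^n (r(T), σ)`: on corollas `r(c_n) = (-1)^n c_n`. -/
noncomputable def treeRot (n : ℕ) : TreeSpace n →ₗ[ℚ] TreeSpace n :=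
  Finsupp.linearCombination ℚ fun T : Tree n =>
    (-1 : ℚ) ^ n • oriented n (T.edges.map (rotEdge n))

/-- The cyclic dg operad `A∞`: in arity `n ≥ 2` the cellular chains of the associahedron `K(n)`,
and zero in arities `0` and `1`. -/
noncomputable def AInf : OpData where
  carrier n := TreeSpace n
  deg n p := Finsupp.supported ℚ ℚ {T : Tree n | T.degree = p}
  sgn n := Finsupp.linearCombination ℚ fun T : Tree n =>
    (-1 : ℚ) ^ T.degree • Finsupp.single T (1 : ℚ)
  d := treeD
  comp := treeComp
  rot := treeRot
  iSup_deg n := by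
    rw [eq_top_iff, ← Finsupp.supported_univ, Finsupp.supported_eq_span_single, Submodule.span_le]
    rintro _ ⟨T, -, rfl⟩
    exact Submodule.mem_iSup_of_mem T.degree (Finsupp.single_mem_supported ℚ _ rfl)
  sgn_of_mem n p x hx := by
    rw [Finsupp.linearCombination_apply]
    conv_rhs => rw [← Finsupp.sum_single x]
    rw [Finsupp.smul_sum]
    refine Finsupp.sum_congr fun T hT => ?_
    rw [(Finsupp.mem_supported ℚ x).1 hx hT, smul_comm, Finsupp.smul_single, smul_eq_mul, mul_one]

/-- The corolla `c_n`, the tree without internal edges. -/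
noncomputable def corolla (n : ℕ) : AInf.carrier n := oriented n []

/-! ### Cyclic diagonals -/

/-- `IsProduct n z`: the element `z` of `A∞(n)` is obtained by composing copies of `c₂`.  These are
the cycles which represent the generator `μ_n` of `As(n) = ℚ μ_n` under the canonical isomorphism
`H_*(A∞) ≅ As` of operads, the one that sends the class of `c₂` to `μ₂`. -/
inductive IsProduct : ∀ n : ℕ, AInf.carrier n → Prop
  | base : IsProduct 2 (corolla 2)
  | comp (m n i : ℕ) (x : AInf.carrier m) (y : AInf.carrier n) (hi : 1 ≤ i) (him : i ≤ m)
      (hx : IsProduct m x) (hy : IsProduct n y) : IsProduct (m + n - 1) (AInf.comp m n i x y)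

/-- A morphism `Δ : A∞ → A∞ ⊗ A∞` is a diagonal if the map induced on homology is the canonical
diagonal `μ_n ↦ μ_n ⊗ μ_n` of `As`, under `H_*(A∞) ≅ As` and the Künneth isomorphism. -/
def IsDiagonal (Δ : Hom AInf (tensor AInf AInf)) : Prop :=
  ∀ (n : ℕ) (z : AInf.carrier n), IsProduct n z →
    (tensor AInf AInf).Homologous (n := n) (Δ.toFun n z) (z ⊗ₜ[ℚ] z)

/-- A cyclic diagonal is a diagonal with `Δ ∘ r = (r ⊗ r) ∘ Δ`. -/
def IsCyclicDiagonal (Δ : Hom AInf (tensor AInf AInf)) : Prop :=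
  IsDiagonal Δ ∧ Δ.IsCyclic

/-! ### Polynomial forms on the interval and homotopies -/

/-- Polynomial differential forms on `[0,1]`; the pair `(f, g)` stands for `f(t) + g(t) dt`. -/
abbrev Forms : Type := ℚ[X] × ℚ[X]

/-- The product of forms, `(f + g dt)(f' + g' dt) = f f' + (f g' + g f') dt`. -/
noncomputable def formsMul : Forms →ₗ[ℚ] Forms →ₗ[ℚ] Forms :=
  LinearMap.mk₂ ℚ (fun ω η => (ω.1 * η.1, ω.1 * η.2 + ω.2 * η.1))
    (fun _ _ _ => Prod.ext (by simp [add_mul]) (by simp [add_mul]; ring))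
    (fun _ _ _ => Prod.ext (by simp) (by simp))
    (fun _ _ _ => Prod.ext (by simp [mul_add]) (by simp [mul_add]; ring))
    (fun _ _ _ => Prod.ext (by simp) (by simp))

/-- The commutative dg algebra of polynomial forms on `[0,1]`, placed in every arity, with
multiplication as composition and with the trivial cyclic action; functions have degree `0`,
one-forms have degree `-1`, and `d(f + g dt) = f' dt`.  For an operad `O`, the operad `O ⊗ Ω` is
`tensor O FormsOp`. -/
noncomputable def FormsOp : OpData where
  carrier _ := Forms
  deg _ p := if p = 0 then LinearMap.ker (LinearMap.snd ℚ ℚ[X] ℚ[X])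
    else if p = -1 then LinearMap.ker (LinearMap.fst ℚ ℚ[X] ℚ[X]) else ⊥
  sgn _ := LinearMap.prodMap LinearMap.id (-LinearMap.id)
  d _ := LinearMap.inr ℚ ℚ[X] ℚ[X] ∘ₗ Polynomial.derivative ∘ₗ LinearMap.fst ℚ ℚ[X] ℚ[X]
  comp _ _ _ := formsMul
  rot _ := LinearMap.id
  iSup_deg _ := by
    rw [eq_top_iff]
    rintro ⟨f, g⟩ -
    have h : ((f, g) : Forms) = (f, 0) + (0, g) := by simp
    rw [h]
    refine Submodule.add_mem _ (Submodule.mem_iSup_of_mem 0 ?_) (Submodule.mem_iSup_of_mem (-1) ?_)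
      <;> simp
  sgn_of_mem _ p := by
    rintro ⟨f, g⟩ hx
    split_ifs at hx with h0 h1
    · subst h0
      have : g = 0 := by simpa using hx
      simp [this]
    · subst h1
      have : f = 0 := by simpa using hx
      simp [this]
    · have : f = 0 ∧ g = 0 := by simpa using hx
      simp [this]

/-- Evaluation of forms at the point `s`: `f(t) + g(t) dt ↦ f(s)`. -/
noncomputable def formsEval (s : ℚ) : Forms →ₗ[ℚ] ℚ :=
  Polynomial.leval s ∘ₗ LinearMap.fst ℚ ℚ[X] ℚ[X]

/-- `O(n) ⊗ Ω → O(n)`, `x ⊗ ω ↦ ω(s) x`. -/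
noncomputable def evalAt (O : OpData) (s : ℚ) (n : ℕ) :
    (tensor O FormsOp).carrier n →ₗ[ℚ] O.carrier n :=
  (TensorProduct.rid ℚ (O.carrier n)).toLinearMap ∘ₗ (formsEval s).lTensor (O.carrier n)

/-- `h : O → P ⊗ Ω` is an (elementary) homotopy from `f` to `g`: `h(0) = f` and `h(1) = g`. -/
def IsHomotopy {O P : OpData} (f g : Hom O P) (h : Hom O (tensor P FormsOp)) : Prop :=
  (∀ n x, evalAt P 0 n (h.toFun n x) = f.toFun n x) ∧
    ∀ n x, evalAt P 1 n (h.toFun n x) = g.toFun n x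

/-- A cyclic homotopy: one that commutes with the cyclic actions, that on `Ω` being trivial. -/
def IsCyclicHomotopy {O P : OpData} (f g : Hom O P) (h : Hom O (tensor P FormsOp)) : Prop :=
  IsHomotopy f g h ∧ h.IsCyclic

end CyclicOperad

/-!
The operad `A∞` is free on its corollas as a graded operad: every tree which is not a corolla is a
composite of smaller trees along any of its edges.  Hence the homotopy can be constructed arity by
arity, and in each arity only its value on the corolla `c` has to be chosen.

* Suppose that the homotopy `h` is known in arities below `n`.  Its values on trees of arity `n`
  with at least one edge are forced by multiplicativity.  They are well defined: one edge of each
  tree, its pivot, is distinguished, the tree is decomposed along it, and the associativity laws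
  compare the other decompositions with this one (`exists_multiplicative_extension`).  By the laws of
  cyclic operads (`tensor_laws`, `formsOp_laws` and `AInf_laws`) and because evaluation at an end
  point is multiplicative (`evalAt_comp`), all conditions on `h` hold on these trees.

* The boundary `dc` is a sum of decomposable trees, so a cycle `y = h(dc)` in `P ⊗ Ω` is prescribed,
  where `P = A∞ ⊗ A∞`, and `h(c)` has to be a chain `x` with `dx = y` and with values `Δ₁(c)` and
  `Δ₂(c)` at the end points.  Subtracting the boundary of the linear path from `Δ₁(c)` to `Δ₂(c)`
  leaves a cycle which vanishes at the end points.  By integration over the interval it has such a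
  filling if its integral, a cycle of degree `n - 2` in `P(n)`, is a boundary
  (`exists_rel_filling`).  For `n > 2` this holds because `P(n)` has no homology outside degree
  zero: the associahedra are contractible (`AInfContraction`), and so is a tensor product of
  contractible complexes (`exists_d_eq_of_contraction`).  For `n = 2` there is no boundary in
  `P(2)`, so that `Δ₁` and `Δ₂` agree on `c` because both induce the canonical diagonal on homology
  (`IsDiagonal.apply_two`).

* The corolla is an eigenvector of the rotation.  Averaging `x` over the cyclic group of order
  `n + 1` therefore makes `h` equivariant without changing `dx` and the end points
  (`exists_corolla_value`).

The associahedra are contracted by a combinatorial vector field: adding and removing one edge, which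
depends only on the path from the root to the last leaf, matches all trees except the right comb.
-/

namespace CyclicOperad

/-! ### The laws of a cyclic dg operad -/

/-- The partial composition `x ∘ᵢ y`, with values in a prescribed arity `N`; it is zero unless
`N = m + n - 1`.  Iterated compositions can be compared with it without transport along equalities
of arities. -/
def OpData.compTo (O : OpData) (m n i N : ℕ) :
    O.carrier m →ₗ[ℚ] O.carrier n →ₗ[ℚ] O.carrier N :=
  if h : m + n - 1 = N then h ▸ O.comp m n i else 0

theorem OpData.compTo_self (O : OpData) (m n i : ℕ) :
    O.compTo m n i (m + n - 1) = O.comp m n i := by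
  simp [OpData.compTo]

/-- The axioms of a non-unital cyclic non-symmetric dg operad, on homogeneous elements and with
Koszul signs.  The laws `seq` and `par` are the sequential and the parallel associativity;
`rot_comp` and `rot_comp_last` describe the rotation of `x ∘ᵢ y` for `i < m` and for `i = m`. -/
structure OpData.Laws (O : OpData) : Prop where
  d_mem : ∀ {n p x}, x ∈ O.deg n p → O.d n x ∈ O.deg n (p - 1)
  rot_mem : ∀ {n p x}, x ∈ O.deg n p → O.rot n x ∈ O.deg n p
  comp_mem : ∀ {m n i N p q x y}, 1 ≤ i → i ≤ m → m + n = N + 1 → x ∈ O.deg m p →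
    y ∈ O.deg n q → O.compTo m n i N x y ∈ O.deg N (p + q)
  d_d : ∀ n x, O.d n (O.d n x) = 0
  d_rot : ∀ n x, O.d n (O.rot n x) = O.rot n (O.d n x)
  rot_pow : ∀ n, O.rot n ^ (n + 1) = 1
  d_comp : ∀ {m n i N p q x y}, 1 ≤ i → i ≤ m → m + n = N + 1 → x ∈ O.deg m p →
    y ∈ O.deg n q → O.d N (O.compTo m n i N x y)
      = O.compTo m n i N (O.d m x) y + (-1 : ℚ) ^ p • O.compTo m n i N x (O.d n y)
  seq : ∀ {m n k i j M M' N p q r x y z}, 1 ≤ i → i ≤ m → 1 ≤ j → j ≤ n → m + n = M + 1 →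
    n + k = M' + 1 → M + k = N + 1 → x ∈ O.deg m p → y ∈ O.deg n q → z ∈ O.deg k r →
    O.compTo M k (i + j - 1) N (O.compTo m n i M x y) z
      = O.compTo m M' i N x (O.compTo n k j M' y z)
  par : ∀ {m k l i j M M' N p q r x w v}, 1 ≤ i → i < j → j ≤ m → m + k = M + 1 →
    m + l = M' + 1 → M + l = N + 1 → x ∈ O.deg m p → w ∈ O.deg k q → v ∈ O.deg l r →
    O.compTo M l i N (O.compTo m k j M x w) v
      = (-1 : ℚ) ^ (q * r) • O.compTo M' k (j + l - 1) N (O.compTo m l i M' x v) w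
  rot_comp : ∀ {m n i N p q x y}, 1 ≤ i → i < m → m + n = N + 1 → x ∈ O.deg m p →
    y ∈ O.deg n q → O.rot N (O.compTo m n i N x y) = O.compTo m n (i + 1) N (O.rot m x) y
  rot_comp_last : ∀ {m n N p q x y}, 1 ≤ m → m + n = N + 1 → x ∈ O.deg m p →
    y ∈ O.deg n q → O.rot N (O.compTo m n m N x y)
      = (-1 : ℚ) ^ (p * q) • O.compTo n m 1 N (O.rot n y) (O.rot m x)

/-- Linear maps which agree on homogeneous elements are equal. -/
theorem OpData.hom_ext (O : OpData) {n : ℕ} {M : Type*} [AddCommGroup M] [Module ℚ M]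
    {f g : O.carrier n →ₗ[ℚ] M} (h : ∀ p, ∀ x ∈ O.deg n p, f x = g x) : f = g := by
  ext x
  have hx : x ∈ ⨆ p, O.deg n p := by rw [O.iSup_deg]; trivial
  refine Submodule.iSup_induction _ (motive := fun x => f x = g x) hx h (by simp) ?_
  intro x y hx hy
  rw [map_add, map_add, hx, hy]

theorem OpData.Laws.d_sgn {O : OpData} (hO : O.Laws) (n : ℕ) (x : O.carrier n) :
    O.d n (O.sgn n x) = - O.sgn n (O.d n x) := by
  have : O.d n ∘ₗ O.sgn n = - (O.sgn n ∘ₗ O.d n) := by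
    refine O.hom_ext fun p x hx => ?_
    simp only [LinearMap.comp_apply, LinearMap.neg_apply]
    rw [O.sgn_of_mem n p x hx, O.sgn_of_mem n _ _ (hO.d_mem hx), map_smul,
      zpow_sub_one₀ (by norm_num)]
    simp
  exact LinearMap.congr_fun this x

theorem OpData.Laws.rot_sgn {O : OpData} (hO : O.Laws) (n : ℕ) (x : O.carrier n) :
    O.rot n (O.sgn n x) = O.sgn n (O.rot n x) := by
  have : O.rot n ∘ₗ O.sgn n = O.sgn n ∘ₗ O.rot n := by
    refine O.hom_ext fun p x hx => ?_
    simp only [LinearMap.comp_apply]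
    rw [O.sgn_of_mem n p x hx, O.sgn_of_mem n _ _ (hO.rot_mem hx), map_smul]
  exact LinearMap.congr_fun this x

theorem OpData.sgn_sgn (O : OpData) (n : ℕ) (x : O.carrier n) : O.sgn n (O.sgn n x) = x := by
  have : O.sgn n ∘ₗ O.sgn n = LinearMap.id := by
    refine O.hom_ext fun p x hx => ?_
    simp only [LinearMap.comp_apply, LinearMap.id_apply]
    rw [O.sgn_of_mem n p x hx, map_smul, O.sgn_of_mem n p x hx, smul_smul, ← mul_zpow]
    simp
  exact LinearMap.congr_fun this x

theorem OpData.sgn_mem (O : OpData) {n : ℕ} {p : ℤ} {x : O.carrier n} (hx : x ∈ O.deg n p) :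
    O.sgn n x ∈ O.deg n p := by
  rw [O.sgn_of_mem n p x hx]
  exact Submodule.smul_mem _ _ hx

/-- Signs depend only on the parity of the exponent. -/
theorem neg_one_zpow_congr {a b : ℤ} (h : Even (a - b)) : (-1 : ℚ) ^ a = (-1 : ℚ) ^ b := by
  have : a = b + (a - b) := by ring
  rw [this, zpow_add₀ (by norm_num), h.neg_one_zpow, mul_one]

theorem neg_one_zpow_mul (a b : ℤ) : (-1 : ℚ) ^ a * (-1 : ℚ) ^ b = (-1 : ℚ) ^ (a + b) :=
  (zpow_add₀ (by norm_num) a b).symm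

/-! ### Tensor products of operads -/

section Tensor

variable {O P : OpData}

/-- The pure tensor `a ⊗ b` as an operation of the operad `O ⊗ P`. -/
noncomputable def tm {n : ℕ} : O.carrier n →ₗ[ℚ] P.carrier n →ₗ[ℚ] (tensor O P).carrier n :=
  TensorProduct.mk ℚ (O.carrier n) (P.carrier n)

theorem tm_mem {n : ℕ} {p q r : ℤ} {a : O.carrier n} {b : P.carrier n} (ha : a ∈ O.deg n p)
    (hb : b ∈ P.deg n q) (h : p + q = r) : tm a b ∈ (tensor O P).deg n r := by
  subst h
  have hb' : b ∈ P.deg n (p + q - p) := by rwa [add_sub_cancel_left]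
  exact Submodule.mem_iSup_of_mem (p := fun q' => Submodule.map₂
    (TensorProduct.mk ℚ (O.carrier n) (P.carrier n)) (O.deg n q') (P.deg n (p + q - q'))) p
    (Submodule.apply_mem_map₂ _ ha hb')

/-- The homogeneous elements of a tensor product are the sums of tensors of homogeneous elements. -/
theorem tensor_deg_induction {n : ℕ} {p : ℤ} {C : (tensor O P).carrier n → Prop}
    (h0 : C 0) (hadd : ∀ x y, C x → C y → C (x + y))
    (ht : ∀ q r a b, q + r = p → a ∈ O.deg n q → b ∈ P.deg n r → C (tm a b))
    {x : (tensor O P).carrier n} (hx : x ∈ (tensor O P).deg n p) : C x := by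
  refine Submodule.iSup_induction _ (motive := C) hx (fun q y hy => ?_) h0 hadd
  refine Submodule.iSup_induction _ (motive := C) hy (fun a z hz => ?_) h0 hadd
  obtain ⟨b, hb, rfl⟩ := hz
  exact ht q (p - q) a b (by ring) a.2 hb

theorem d_tm {n : ℕ} {p : ℤ} {a : O.carrier n} (ha : a ∈ O.deg n p) (b : P.carrier n) :
    (tensor O P).d n (tm a b) = tm (O.d n a) b + (-1 : ℚ) ^ p • tm a (P.d n b) := by
  have : (tensor O P).d n (tm a b) = tm (O.d n a) b + tm (O.sgn n a) (P.d n b) := rfl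
  rw [this, O.sgn_of_mem n p a ha, map_smul, LinearMap.smul_apply]

theorem d_tm' {n : ℕ} (a : O.carrier n) (b : P.carrier n) :
    (tensor O P).d n (tm a b) = tm (O.d n a) b + tm (O.sgn n a) (P.d n b) := rfl

theorem rot_tm {n : ℕ} (a : O.carrier n) (b : P.carrier n) :
    (tensor O P).rot n (tm a b) = tm (O.rot n a) (P.rot n b) := rfl

theorem compTo_tm {m n i N : ℕ} {p q : ℤ} {x : O.carrier m} {x' : P.carrier m}
    {y : O.carrier n} {y' : P.carrier n} (hx' : x' ∈ P.deg m p) (hy : y ∈ O.deg n q) :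
    (tensor O P).compTo m n i N (tm x x') (tm y y')
      = (-1 : ℚ) ^ (p * q) • tm (O.compTo m n i N x y) (P.compTo m n i N x' y') := by
  by_cases h : m + n - 1 = N
  · subst h
    simp only [OpData.compTo_self]
    exact tensorComp_tmul O P m n i p q x x' y y' hx' hy
  · simp [OpData.compTo, h]

theorem tensor_hom_ext {n : ℕ} {M : Type*} [AddCommGroup M] [Module ℚ M]
    {f g : (tensor O P).carrier n →ₗ[ℚ] M} (h : ∀ a b, f (tm a b) = g (tm a b)) : f = g :=
  TensorProduct.ext' h

/-- The tensor product of two cyclic dg operads is a cyclic dg operad; each law is checked on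
tensors of homogeneous elements, where it reduces to the laws of the factors and a parity of
exponents. -/
theorem tensor_laws (hO : O.Laws) (hP : P.Laws) : (tensor O P).Laws where
  d_mem {n p x} hx := by
    refine tensor_deg_induction (C := fun x => (tensor O P).d n x ∈ (tensor O P).deg n (p - 1))
      (by simp) (fun x y hx hy => by rw [map_add]; exact Submodule.add_mem _ hx hy) ?_ hx
    intro q r a b h ha hb
    rw [d_tm ha]
    refine Submodule.add_mem _ (tm_mem (hO.d_mem ha) hb (by omega)) (Submodule.smul_mem _ _ ?_)
    exact tm_mem ha (hP.d_mem hb) (by omega)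
  rot_mem {n p x} hx := by
    refine tensor_deg_induction (C := fun x => (tensor O P).rot n x ∈ (tensor O P).deg n p)
      (by simp) (fun x y hx hy => by rw [map_add]; exact Submodule.add_mem _ hx hy) ?_ hx
    intro q r a b h ha hb
    rw [rot_tm]
    exact tm_mem (hO.rot_mem ha) (hP.rot_mem hb) h
  comp_mem {m n i N p q x y} hi him hN hx hy := by
    refine tensor_deg_induction
      (C := fun x => (tensor O P).compTo m n i N x y ∈ (tensor O P).deg N (p + q)) (by simp)
      (fun x y hx hy => by
        rw [map_add, LinearMap.add_apply]; exact Submodule.add_mem _ hx hy) ?_ hx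
    intro p₁ p₂ a a' hp ha ha'
    refine tensor_deg_induction
      (C := fun y => (tensor O P).compTo m n i N (tm a a') y ∈ (tensor O P).deg N (p + q))
      (by simp) (fun x y hx hy => by rw [map_add]; exact Submodule.add_mem _ hx hy) ?_ hy
    intro q₁ q₂ b b' hq hb hb'
    rw [compTo_tm ha' hb]
    refine Submodule.smul_mem _ _ (tm_mem (hO.comp_mem hi him hN ha hb)
      (hP.comp_mem hi him hN ha' hb') (by omega))
  d_d n x := by
    have : (tensor O P).d n ∘ₗ (tensor O P).d n = 0 := by
      refine tensor_hom_ext fun a b => ?_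
      simp only [LinearMap.comp_apply, d_tm', map_add, hO.d_d, hP.d_d, hO.d_sgn, map_zero,
        LinearMap.zero_apply, map_neg, LinearMap.neg_apply]
      module
    exact LinearMap.congr_fun this x
  d_rot n x := by
    have : (tensor O P).d n ∘ₗ (tensor O P).rot n = (tensor O P).rot n ∘ₗ (tensor O P).d n := by
      refine tensor_hom_ext fun a b => ?_
      simp only [LinearMap.comp_apply, d_tm', map_add, rot_tm, hO.d_rot, hP.d_rot, hO.rot_sgn]
    exact LinearMap.congr_fun this x
  rot_pow n := by
    have h : ∀ k, ∀ a b, ((tensor O P).rot n ^ k) (tm a b)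
        = tm ((O.rot n ^ k) a) ((P.rot n ^ k) b) := by
      intro k
      induction k with
      | zero => intro a b; simp
      | succ k ih => intro a b; simp only [pow_succ', Module.End.mul_apply, ih, rot_tm]
    refine tensor_hom_ext fun a b => ?_
    rw [h, hO.rot_pow, hP.rot_pow]
    rfl
  d_comp {m n i N p q x y} hi him hN hx hy := by
    refine tensor_deg_induction (C := fun x => (tensor O P).d N ((tensor O P).compTo m n i N x y)
      = (tensor O P).compTo m n i N ((tensor O P).d m x) y
        + (-1 : ℚ) ^ p • (tensor O P).compTo m n i N x ((tensor O P).d n y)) (by simp)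
      (fun x y hx hy => by
        simp only [map_add, LinearMap.add_apply, hx, hy]; module) ?_ hx
    intro p₁ p₂ a a' hp ha ha'
    refine tensor_deg_induction
      (C := fun y => (tensor O P).d N ((tensor O P).compTo m n i N (tm a a') y)
      = (tensor O P).compTo m n i N ((tensor O P).d m (tm a a')) y
        + (-1 : ℚ) ^ p • (tensor O P).compTo m n i N (tm a a') ((tensor O P).d n y))
      (by simp) (fun x y hx hy => by simp only [map_add, hx, hy]; module) ?_ hy
    intro q₁ q₂ b b' hq hb hb'
    rw [compTo_tm ha' hb, map_smul, d_tm (hO.comp_mem hi him hN ha hb), d_tm ha, d_tm hb,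
      hO.d_comp hi him hN ha hb, hP.d_comp hi him hN ha' hb']
    simp only [map_add, map_smul, LinearMap.add_apply, LinearMap.smul_apply]
    rw [compTo_tm ha' hb, compTo_tm (hP.d_mem ha') hb, compTo_tm ha' (hO.d_mem hb),
      compTo_tm ha' hb]
    simp only [smul_add, smul_smul, neg_one_zpow_mul]
    have e1 : (-1 : ℚ) ^ (p₂ * q₁ + (p₁ + q₁)) = (-1 : ℚ) ^ (p₁ + (p₂ - 1) * q₁) :=
      neg_one_zpow_congr ⟨q₁, by ring⟩
    have e2 : (-1 : ℚ) ^ (p₂ * q₁ + p₁) = (-1 : ℚ) ^ (p + p₂ * (q₁ - 1)) :=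
      neg_one_zpow_congr ⟨0, by rw [← hp]; ring⟩
    have e3 : (-1 : ℚ) ^ (p₂ * q₁ + (p₁ + q₁ + p₂)) = (-1 : ℚ) ^ (p + (q₁ + p₂ * q₁)) :=
      neg_one_zpow_congr ⟨0, by rw [← hp]; ring⟩
    rw [e1, e2, e3]
    module
  seq {m n k i j M M' N p q r x y z} hi him hj hjn hM hM' hN hx hy hz := by
    refine tensor_deg_induction (C := fun x => (tensor O P).compTo M k (i + j - 1) N
      ((tensor O P).compTo m n i M x y) z = (tensor O P).compTo m M' i N x
        ((tensor O P).compTo n k j M' y z)) (by simp)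
      (fun x y hx hy => by simp only [map_add, LinearMap.add_apply, hx, hy]) ?_ hx
    intro p₁ p₂ a a' hp ha ha'
    refine tensor_deg_induction (C := fun y => (tensor O P).compTo M k (i + j - 1) N
      ((tensor O P).compTo m n i M (tm a a') y) z = (tensor O P).compTo m M' i N (tm a a')
        ((tensor O P).compTo n k j M' y z)) (by simp)
      (fun x y hx hy => by simp only [map_add, LinearMap.add_apply, hx, hy]) ?_ hy
    intro q₁ q₂ b b' hq hb hb'
    refine tensor_deg_induction (C := fun z => (tensor O P).compTo M k (i + j - 1) N
      ((tensor O P).compTo m n i M (tm a a') (tm b b')) z = (tensor O P).compTo m M' i N (tm a a')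
        ((tensor O P).compTo n k j M' (tm b b') z)) (by simp)
      (fun x y hx hy => by simp only [map_add, hx, hy]) ?_ hz
    intro r₁ r₂ c c' hr hc hc'
    rw [compTo_tm ha' hb, compTo_tm hb' hc, map_smul, map_smul, LinearMap.smul_apply,
      compTo_tm (hP.comp_mem hi him hM ha' hb') hc,
      compTo_tm ha' (hO.comp_mem hj hjn hM' hb hc),
      hO.seq hi him hj hjn hM hM' hN ha hb hc, hP.seq hi him hj hjn hM hM' hN ha' hb' hc',
      smul_smul, smul_smul, neg_one_zpow_mul, neg_one_zpow_mul,
      neg_one_zpow_congr (a := p₂ * q₁ + (p₂ + q₂) * r₁) (b := q₂ * r₁ + p₂ * (q₁ + r₁))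
        ⟨0, by ring⟩]
  par {m k l i j M M' N p q r x w v} hi hij hj hM hM' hN hx hw hv := by
    refine tensor_deg_induction (C := fun x => (tensor O P).compTo M l i N
      ((tensor O P).compTo m k j M x w) v = (-1 : ℚ) ^ (q * r) •
        (tensor O P).compTo M' k (j + l - 1) N ((tensor O P).compTo m l i M' x v) w) (by simp)
      (fun x y hx hy => by simp only [map_add, LinearMap.add_apply, hx, hy, smul_add]) ?_ hx
    intro p₁ p₂ a a' hp ha ha'
    refine tensor_deg_induction (C := fun w => (tensor O P).compTo M l i N
      ((tensor O P).compTo m k j M (tm a a') w) v = (-1 : ℚ) ^ (q * r) •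
        (tensor O P).compTo M' k (j + l - 1) N ((tensor O P).compTo m l i M' (tm a a') v) w)
      (by simp)
      (fun x y hx hy => by simp only [map_add, LinearMap.add_apply, hx, hy, smul_add]) ?_ hw
    intro q₁ q₂ b b' hq hb hb'
    refine tensor_deg_induction (C := fun v => (tensor O P).compTo M l i N
      ((tensor O P).compTo m k j M (tm a a') (tm b b')) v = (-1 : ℚ) ^ (q * r) •
        (tensor O P).compTo M' k (j + l - 1) N ((tensor O P).compTo m l i M' (tm a a') v)
          (tm b b')) (by simp)
      (fun x y hx hy => by simp only [map_add, LinearMap.add_apply, hx, hy, smul_add]) ?_ hv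
    intro r₁ r₂ c c' hr hc hc'
    have hj1 : 1 ≤ j := by omega
    have him : i ≤ m := by omega
    rw [compTo_tm ha' hb, compTo_tm ha' hc, map_smul, map_smul, LinearMap.smul_apply,
      LinearMap.smul_apply, compTo_tm (hP.comp_mem hj1 hj hM ha' hb') hc,
      compTo_tm (hP.comp_mem hi him hM' ha' hc') hb,
      hO.par hi hij hj hM hM' hN ha hb hc, hP.par hi hij hj hM hM' hN ha' hb' hc']
    simp only [map_smul, LinearMap.smul_apply, smul_smul, neg_one_zpow_mul]
    rw [neg_one_zpow_congr]
    rw [← hq, ← hr]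
    exact ⟨-(q₁ * r₂), by ring⟩
  rot_comp {m n i N p q x y} hi him hN hx hy := by
    refine tensor_deg_induction (C := fun x => (tensor O P).rot N
      ((tensor O P).compTo m n i N x y)
        = (tensor O P).compTo m n (i + 1) N ((tensor O P).rot m x) y) (by simp)
      (fun x y hx hy => by simp only [map_add, LinearMap.add_apply, hx, hy]) ?_ hx
    intro p₁ p₂ a a' hp ha ha'
    refine tensor_deg_induction (C := fun y => (tensor O P).rot N
      ((tensor O P).compTo m n i N (tm a a') y)
        = (tensor O P).compTo m n (i + 1) N ((tensor O P).rot m (tm a a')) y) (by simp)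
      (fun x y hx hy => by simp only [map_add, hx, hy]) ?_ hy
    intro q₁ q₂ b b' hq hb hb'
    rw [compTo_tm ha' hb, map_smul, rot_tm, rot_tm, compTo_tm (hP.rot_mem ha') hb,
      hO.rot_comp hi him hN ha hb, hP.rot_comp hi him hN ha' hb']
  rot_comp_last {m n N p q x y} hm hN hx hy := by
    refine tensor_deg_induction (C := fun x => (tensor O P).rot N
      ((tensor O P).compTo m n m N x y) = (-1 : ℚ) ^ (p * q) •
        (tensor O P).compTo n m 1 N ((tensor O P).rot n y) ((tensor O P).rot m x)) (by simp)
      (fun x y hx hy => by simp only [map_add, LinearMap.add_apply, hx, hy, smul_add]) ?_ hx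
    intro p₁ p₂ a a' hp ha ha'
    refine tensor_deg_induction (C := fun y => (tensor O P).rot N
      ((tensor O P).compTo m n m N (tm a a') y) = (-1 : ℚ) ^ (p * q) •
        (tensor O P).compTo n m 1 N ((tensor O P).rot n y) ((tensor O P).rot m (tm a a')))
      (by simp)
      (fun x y hx hy => by simp only [map_add, LinearMap.add_apply, hx, hy, smul_add]) ?_ hy
    intro q₁ q₂ b b' hq hb hb'
    rw [compTo_tm ha' hb, map_smul, rot_tm, rot_tm, rot_tm,
      compTo_tm (hP.rot_mem hb') (hO.rot_mem ha),
      hO.rot_comp_last hm hN ha hb, hP.rot_comp_last hm hN ha' hb']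
    simp only [map_smul, LinearMap.smul_apply, smul_smul, neg_one_zpow_mul]
    rw [neg_one_zpow_congr]
    rw [← hp, ← hq]
    exact ⟨-(p₁ * q₂), by ring⟩

end Tensor

/-! ### Forms on the interval as an operad -/

/-- A form, regarded as an operation of arity `n` of the operad of forms. -/
noncomputable def form (n : ℕ) : Forms ≃ₗ[ℚ] FormsOp.carrier n := LinearEquiv.refl ℚ Forms

theorem exists_form {n : ℕ} (x : FormsOp.carrier n) : ∃ f g : ℚ[X], x = form n (f, g) :=
  ⟨(x : Forms).1, (x : Forms).2, rfl⟩

/-- Every composition in the operad of forms is the multiplication of forms. -/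
theorem formsOp_compTo {m n i N : ℕ} (h : m + n = N + 1) (f g f' g' : ℚ[X]) :
    FormsOp.compTo m n i N (form m (f, g)) (form n (f', g'))
      = form N (f * f', f * g' + g * f') := by
  obtain rfl : m + n - 1 = N := by omega
  rw [OpData.compTo_self]
  rfl

theorem formsOp_d (n : ℕ) (f g : ℚ[X]) :
    FormsOp.d n (form n (f, g)) = form n (0, Polynomial.derivative f) := rfl

theorem formsOp_rot (n : ℕ) (x : FormsOp.carrier n) : FormsOp.rot n x = x := rfl

theorem function_mem (n : ℕ) (f : ℚ[X]) : form n (f, 0) ∈ FormsOp.deg n 0 := by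
  change (f, 0) ∈ LinearMap.ker (LinearMap.snd ℚ ℚ[X] ℚ[X])
  simp

theorem oneForm_mem (n : ℕ) (g : ℚ[X]) : form n (0, g) ∈ FormsOp.deg n (-1) := by
  change (0, g) ∈ LinearMap.ker (LinearMap.fst ℚ ℚ[X] ℚ[X])
  simp

theorem form_zero_mem (n : ℕ) (p : ℤ) : form n (0, 0) ∈ FormsOp.deg n p := by
  rw [← Prod.zero_eq_mk, map_zero]
  exact Submodule.zero_mem _

/-- The homogeneous forms are the functions, in degree `0`, and the one-forms, in
degree `-1`. -/
theorem forms_cases {n : ℕ} {p : ℤ} {x : FormsOp.carrier n} (hx : x ∈ FormsOp.deg n p) :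
    (p = 0 ∧ ∃ f : ℚ[X], x = form n (f, 0)) ∨ (p = -1 ∧ ∃ g : ℚ[X], x = form n (0, g)) ∨
      x = form n (0, 0) := by
  obtain ⟨f, g⟩ := x
  change (f, g) ∈ (if p = 0 then LinearMap.ker (LinearMap.snd ℚ ℚ[X] ℚ[X])
    else if p = -1 then LinearMap.ker (LinearMap.fst ℚ ℚ[X] ℚ[X]) else ⊥) at hx
  split_ifs at hx with h0 h1
  · obtain rfl : g = 0 := by simpa using hx
    exact Or.inl ⟨h0, f, rfl⟩
  · obtain rfl : f = 0 := by simpa using hx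
    exact Or.inr (Or.inl ⟨h1, g, rfl⟩)
  · obtain ⟨rfl, rfl⟩ : f = 0 ∧ g = 0 := by simpa using hx
    exact Or.inr (Or.inr rfl)

/-- The multiplication of forms is graded commutative. -/
theorem formsOp_comm {m n i j N : ℕ} (h : m + n = N + 1) {p q : ℤ} {x : FormsOp.carrier m}
    {y : FormsOp.carrier n} (hx : x ∈ FormsOp.deg m p) (hy : y ∈ FormsOp.deg n q) :
    FormsOp.compTo m n i N x y = (-1 : ℚ) ^ (p * q) • FormsOp.compTo n m j N y x := by
  rcases forms_cases hx with ⟨rfl, f, rfl⟩ | ⟨rfl, f, rfl⟩ | rfl <;>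
  rcases forms_cases hy with ⟨rfl, g, rfl⟩ | ⟨rfl, g, rfl⟩ | rfl <;>
  rw [formsOp_compTo h, formsOp_compTo (by omega), ← map_smul] <;>
  simp [mul_comm, ← Prod.zero_eq_mk]

theorem formsOp_assoc {m n k i j i' j' M M' N : ℕ} (hM : m + n = M + 1) (hM' : n + k = M' + 1)
    (hN : M + k = N + 1) (x : FormsOp.carrier m) (y : FormsOp.carrier n)
    (z : FormsOp.carrier k) :
    FormsOp.compTo M k i' N (FormsOp.compTo m n i M x y) z
      = FormsOp.compTo m M' j' N x (FormsOp.compTo n k j M' y z) := by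
  obtain ⟨f, g, rfl⟩ := exists_form x
  obtain ⟨f', g', rfl⟩ := exists_form y
  obtain ⟨f'', g'', rfl⟩ := exists_form z
  rw [formsOp_compTo hM, formsOp_compTo hM', formsOp_compTo hN, formsOp_compTo (by omega)]
  congr 1
  exact Prod.ext (by ring) (by ring)

theorem formsOp_laws : FormsOp.Laws where
  d_mem {n p x} hx := by
    rcases forms_cases hx with ⟨rfl, f, rfl⟩ | ⟨rfl, f, rfl⟩ | rfl <;> rw [formsOp_d]
    · exact oneForm_mem n _
    · simpa using form_zero_mem n _
    · simpa using form_zero_mem n _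
  rot_mem hx := hx
  comp_mem {m n i N p q x y} hi him hN hx hy := by
    rcases forms_cases hx with ⟨rfl, f, rfl⟩ | ⟨rfl, f, rfl⟩ | rfl <;>
    rcases forms_cases hy with ⟨rfl, g, rfl⟩ | ⟨rfl, g, rfl⟩ | rfl <;>
    rw [formsOp_compTo hN] <;>
    simp only [mul_zero, zero_mul, add_zero, zero_add, form_zero_mem, function_mem, oneForm_mem]
  d_d n x := by
    obtain ⟨f, g, rfl⟩ := exists_form x
    rw [formsOp_d, formsOp_d, map_zero, ← Prod.zero_eq_mk, map_zero]
  d_rot n x := rfl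
  rot_pow n := one_pow (n + 1)
  d_comp {m n i N p q x y} hi him hN hx hy := by
    obtain ⟨f', g', rfl⟩ := exists_form y
    rcases forms_cases hx with ⟨rfl, f, rfl⟩ | ⟨rfl, f, rfl⟩ | rfl <;>
    rw [formsOp_compTo hN, formsOp_d, formsOp_d, formsOp_d, formsOp_compTo hN,
      formsOp_compTo hN, ← map_smul, ← map_add] <;>
    simp [add_comm]
  seq {m n k i j M M' N p q r x y z} _ _ _ _ hM hM' hN _ _ _ :=
    formsOp_assoc hM hM' hN x y z
  par {m k l i j M M' N p q r x w v} hi hij hj hM hM' hN hx hw hv := by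
    obtain ⟨f, g, rfl⟩ := exists_form x
    rcases forms_cases hw with ⟨rfl, f', rfl⟩ | ⟨rfl, f', rfl⟩ | rfl <;>
    rcases forms_cases hv with ⟨rfl, g', rfl⟩ | ⟨rfl, g', rfl⟩ | rfl <;>
    rw [formsOp_compTo hM, formsOp_compTo hM', formsOp_compTo hN, formsOp_compTo (by omega),
      ← map_smul] <;>
    simp [← Prod.zero_eq_mk, mul_right_comm]
  rot_comp {m n i N p q x y} hi him hN hx hy := by
    obtain ⟨f, g, rfl⟩ := exists_form x
    obtain ⟨f', g', rfl⟩ := exists_form y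
    rw [formsOp_rot, formsOp_rot, formsOp_compTo hN, formsOp_compTo hN]
  rot_comp_last {m n N p q x y} hm hN hx hy := formsOp_comm hN hx hy

/-! ### Orientations -/

/-- The conditions for an interval of leaves to be an internal edge of a tree with `n` leaves: it
has at least two elements and is not the whole set. -/
def ValidEdge (n : ℕ) (e : Edge) : Prop :=
  1 ≤ fstLeaf e ∧ fstLeaf e < lstLeaf e ∧ lstLeaf e ≤ n ∧ (fstLeaf e ≠ 1 ∨ lstLeaf e ≠ n)

/-- Two different edges which can occur in the same tree, that is, which are disjoint or nested. -/
def Indep (e f : Edge) : Prop :=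
  (fstLeaf e ≠ fstLeaf f ∨ lstLeaf e ≠ lstLeaf f) ∧
  (lstLeaf e < fstLeaf f ∨ lstLeaf f < fstLeaf e ∨
    (fstLeaf e ≤ fstLeaf f ∧ lstLeaf f ≤ lstLeaf e) ∨
    (fstLeaf f ≤ fstLeaf e ∧ lstLeaf e ≤ lstLeaf f))

/-- The list consists of the edges of a tree with `n` leaves, without repetitions. -/
def TreeList (n : ℕ) (l : List Edge) : Prop :=
  2 ≤ n ∧ (∀ e ∈ l, ValidEdge n e) ∧ l.Pairwise Indep

theorem edge_ext {e f : Edge} (h1 : fstLeaf e = fstLeaf f) (h2 : lstLeaf e = lstLeaf f) :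
    e = f :=
  congrArg toLex (Prod.ext h1 h2)

theorem edge_ne_iff {e f : Edge} : e ≠ f ↔ fstLeaf e ≠ fstLeaf f ∨ lstLeaf e ≠ lstLeaf f := by
  rw [← not_iff_not]
  push Not
  exact ⟨fun h => by subst h; exact ⟨rfl, rfl⟩, fun h => edge_ext h.1 h.2⟩

theorem indep_iff {e f : Edge} : Indep e f ↔ e ≠ f ∧ Compatible e f := by
  rw [edge_ne_iff]; rfl

theorem Indep.symm {e f : Edge} (h : Indep e f) : Indep f e := by
  unfold Indep at *; omega

theorem validEdge_iff {n : ℕ} {e : Edge} : ValidEdge n e ↔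
    1 ≤ fstLeaf e ∧ fstLeaf e < lstLeaf e ∧ lstLeaf e ≤ n ∧ e ≠ edge 1 n := by
  rw [edge_ne_iff]; rfl

theorem treeList_iff {n : ℕ} {l : List Edge} :
    TreeList n l ↔ l.Nodup ∧ IsTree n l.toFinset := by
  have key : (∀ e ∈ l, ∀ f ∈ l, Compatible e f) ↔ l.Pairwise Compatible := by
    rw [List.pairwise_iff_forall_sublist]
    constructor
    · intro h a b hab
      exact h a (hab.subset (by simp)) b (hab.subset (by simp))
    · intro h' e he f hf
      by_cases hef : e = f
      · subst hef; unfold Compatible; omega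
      · have h := List.pairwise_iff_forall_sublist.2 h'
        have : Std.Symm Compatible := ⟨fun x y h => by unfold Compatible at *; omega⟩
        exact h.forall he hf hef
  unfold TreeList IsTree
  have : l.Pairwise Indep ↔ l.Nodup ∧ l.Pairwise Compatible := by
    rw [List.nodup_iff_pairwise_ne, ← List.pairwise_and_iff]
    exact ⟨fun h => h.imp fun h => indep_iff.1 h, fun h => h.imp fun h => indep_iff.2 h⟩
  rw [this]
  simp only [List.mem_toFinset, validEdge_iff]
  constructor
  · rintro ⟨h1, h2, h3, h4⟩
    exact ⟨h3, h1, h2, key.2 h4⟩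
  · rintro ⟨h3, h1, h2, h4⟩
    exact ⟨h1, h2, h3, key.1 h4⟩

theorem TreeList.tail {n : ℕ} {e : Edge} {l : List Edge} (h : TreeList n (e :: l)) :
    TreeList n l :=
  ⟨h.1, fun f hf => h.2.1 f (List.mem_cons_of_mem _ hf), (List.pairwise_cons.1 h.2.2).2⟩

theorem TreeList.perm {n : ℕ} {l l' : List Edge} (h : TreeList n l) (hl : l.Perm l') :
    TreeList n l' :=
  ⟨h.1, fun f hf => h.2.1 f (hl.mem_iff.2 hf), (hl.pairwise_iff (fun h => h.symm)).1 h.2.2⟩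

theorem TreeList.nodup {n : ℕ} {l : List Edge} (h : TreeList n l) : l.Nodup :=
  (treeList_iff.1 h).1

theorem TreeList.indep {n : ℕ} {l : List Edge} (hl : TreeList n l) {e f : Edge} (he : e ∈ l)
    (hf : f ∈ l) (hef : e ≠ f) : Indep e f := by
  have : Std.Symm Indep := ⟨fun x y h => h.symm⟩
  exact hl.2.2.forall he hf hef

theorem Tree.treeList {n : ℕ} (T : Tree n) : TreeList n T.edges := by
  rw [treeList_iff]
  refine ⟨Finset.sort_nodup _ _, ?_⟩
  unfold Tree.edges
  rw [Finset.sort_toFinset]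
  exact T.2

/-- Exchanging two neighbours changes the parity of the number of inversions. -/
theorem inversions_swap (A B : List Edge) {x y : Edge} (h : x ≠ y) :
    (-1 : ℚ) ^ inversions (A ++ x :: y :: B) = - (-1) ^ inversions (A ++ y :: x :: B) := by
  induction A with
  | nil =>
    simp only [List.nil_append, inversions, List.filter_cons]
    rcases lt_or_gt_of_ne h with h | h
    · simp only [h, not_lt_of_gt h, decide_true, decide_false, if_true, List.length_cons,
        Bool.false_eq_true, if_false]
      ring
    · simp only [h, not_lt_of_gt h, decide_true, decide_false, if_true, List.length_cons,
        Bool.false_eq_true, if_false]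
      ring
  | cons a A ih =>
    simp only [List.cons_append, inversions, pow_add, ih]
    have : ((A ++ x :: y :: B).filter (· < a)).length
        = ((A ++ y :: x :: B).filter (· < a)).length :=
      (((List.Perm.swap y x B).append_left A).filter _).length_eq
    rw [this]
    ring

theorem inversions_of_pairwise {l : List Edge} (h : l.Pairwise (· ≤ ·)) : inversions l = 0 := by
  induction l with
  | nil => rfl
  | cons a l ih =>
    rw [List.pairwise_cons] at h
    rw [inversions, ih h.2, List.filter_eq_nil_iff.2]
    · rfl
    · intro b hb
      simpa using h.1 b hb

theorem oriented_of_treeList {n : ℕ} {l : List Edge} (h : TreeList n l) :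
    oriented n l = Finsupp.single ⟨l.toFinset, (treeList_iff.1 h).2⟩ ((-1) ^ inversions l) :=
  dif_pos (treeList_iff.1 h)

theorem oriented_of_not_treeList {n : ℕ} {l : List Edge} (h : ¬ TreeList n l) :
    oriented n l = 0 :=
  dif_neg (fun h' => h (treeList_iff.2 h'))

theorem oriented_edges {n : ℕ} (T : Tree n) : oriented n T.edges = Finsupp.single T 1 := by
  rw [oriented_of_treeList T.treeList,
    inversions_of_pairwise (l := T.edges) (Finset.pairwise_sort _ _), pow_zero]
  congr 1
  exact Subtype.ext (Finset.sort_toFinset _ _)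

theorem oriented_swap (n : ℕ) (A : List Edge) (x y : Edge) (B : List Edge) :
    oriented n (A ++ x :: y :: B) = - oriented n (A ++ y :: x :: B) := by
  have hp : (A ++ x :: y :: B).Perm (A ++ y :: x :: B) := (List.Perm.swap y x B).append_left A
  by_cases h : TreeList n (A ++ x :: y :: B)
  · have h' := h.perm hp
    have hxy : x ≠ y := by
      rintro rfl
      have := h.nodup
      rw [List.nodup_append] at this
      simp at this
    rw [oriented_of_treeList h, oriented_of_treeList h', inversions_swap A B hxy,
      Finsupp.single_neg]
    congr 3
    exact List.toFinset_eq_of_perm _ _ hp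
  · have h' : ¬ TreeList n (A ++ y :: x :: B) := fun h' => h (h'.perm hp.symm)
    rw [oriented_of_not_treeList h, oriented_of_not_treeList h', neg_zero]

/-- A function of lists which changes sign under transpositions of neighbours changes under a
permutation by the parity of the number of inversions. -/
theorem perm_of_swap {M : Type*} [AddCommGroup M] [Module ℚ M]
    (φ : List Edge → M) (hφ : ∀ A x y B, φ (A ++ x :: y :: B) = - φ (A ++ y :: x :: B))
    {l l' : List Edge} (h : l.Perm l') (hn : l.Nodup) (A : List Edge) :
    (-1 : ℚ) ^ inversions l • φ (A ++ l) = (-1 : ℚ) ^ inversions l' • φ (A ++ l') := by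
  induction h generalizing A with
  | nil => rfl
  | @cons a l l' h ih =>
    have h1 := ih (List.nodup_cons.1 hn).2 (A ++ [a])
    rw [List.append_assoc, List.append_assoc] at h1
    simp only [inversions, pow_add, mul_smul]
    rw [(h.filter _).length_eq]
    congr 1
  | swap x y l =>
    have hxy : y ≠ x := by rintro rfl; simp at hn
    have := inversions_swap [] l hxy
    simp only [List.nil_append] at this
    rw [this, hφ]
    simp
  | trans h1 h2 ih1 ih2 => rw [ih1 hn A, ih2 (h1.nodup_iff.1 hn) A]

/-- A function of lists of edges which changes sign under transpositions of neighbours extends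
linearly to oriented trees. -/
theorem linearCombination_oriented {n : ℕ} {M : Type*} [AddCommGroup M] [Module ℚ M]
    (φ : List Edge → M) (hφ : ∀ A x y B, φ (A ++ x :: y :: B) = - φ (A ++ y :: x :: B))
    {l : List Edge} (hl : TreeList n l) :
    Finsupp.linearCombination ℚ (fun U : Tree n => φ U.edges) (oriented n l) = φ l := by
  have hp : Finset.sort l.toFinset (· ≤ ·) |>.Perm l :=
    (Finset.sort_perm_toList _ _).trans (List.toFinset_toList hl.nodup)
  have := perm_of_swap φ hφ hp (Finset.sort_nodup _ _) []
  rw [inversions_of_pairwise (Finset.pairwise_sort _ _), pow_zero, one_smul, List.nil_append,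
    List.nil_append] at this
  rw [oriented_of_treeList hl, Finsupp.linearCombination_single]
  unfold Tree.edges
  simp only
  rw [this, smul_smul, ← mul_pow]
  simp

/-! ### Oriented trees and their composition -/

instance (n : ℕ) (e : Edge) : Decidable (ValidEdge n e) := by
  unfold ValidEdge; infer_instance

/-- The intervals which can occur as internal edges of trees with `n` leaves. -/
def validEdges (n : ℕ) : Finset Edge :=
  ((Finset.Icc 1 n ×ˢ Finset.Icc 1 n).map toLex.toEmbedding).filter (ValidEdge n)

theorem mem_validEdges {n : ℕ} {e : Edge} : e ∈ validEdges n ↔ ValidEdge n e := by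
  unfold validEdges
  rw [Finset.mem_filter, and_iff_right_iff_imp]
  intro h
  rw [Finset.mem_map]
  unfold ValidEdge at h
  refine ⟨ofLex e, ?_, rfl⟩
  rw [Finset.mem_product, Finset.mem_Icc, Finset.mem_Icc]
  change (1 ≤ fstLeaf e ∧ fstLeaf e ≤ n) ∧ (1 ≤ lstLeaf e ∧ lstLeaf e ≤ n)
  omega

/-- The oriented tree `(T, e₁ ∧ ⋯ ∧ e_k)` as an operation of `A∞`, zero unless `e₁, …, e_k` are the
edges of a tree. -/
noncomputable def tree (n : ℕ) (l : List Edge) : AInf.carrier n := oriented n l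

theorem tree_of_not {n : ℕ} {l : List Edge} (h : ¬ TreeList n l) : tree n l = 0 :=
  oriented_of_not_treeList h

theorem tree_swap (n : ℕ) (A : List Edge) (x y : Edge) (B : List Edge) :
    tree n (A ++ x :: y :: B) = - tree n (A ++ y :: x :: B) := oriented_swap n A x y B

/-- Moving an edge past a block of edges. -/
theorem tree_move (n : ℕ) (A B C : List Edge) (x : Edge) :
    tree n (A ++ x :: (B ++ C)) = (-1 : ℚ) ^ (B.length : ℤ) • tree n (A ++ B ++ x :: C) := by
  induction B generalizing A with
  | nil => simp
  | cons b B ih =>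
    have := ih (A ++ [b])
    rw [List.cons_append, tree_swap]
    simp only [List.append_assoc, List.cons_append, List.nil_append] at this ⊢
    rw [this]
    push_cast [List.length_cons]
    rw [zpow_add_one₀ (by norm_num)]
    module

/-- Exchanging two neighbouring blocks of edges. -/
theorem tree_move_block (n : ℕ) (A B C D : List Edge) :
    tree n (A ++ B ++ C ++ D)
      = (-1 : ℚ) ^ ((B.length : ℤ) * C.length) • tree n (A ++ C ++ B ++ D) := by
  induction C generalizing A with
  | nil => simp
  | cons c C ih =>
    have h1 := tree_move n A B (C ++ D) c
    have h2 := ih (A ++ [c])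
    simp only [List.append_assoc, List.cons_append, List.nil_append] at h1 h2 ⊢
    rw [h2] at h1
    push_cast [List.length_cons]
    have : (-1 : ℚ) ^ (B.length : ℤ) * (-1 : ℚ) ^ (B.length : ℤ) = 1 := by
      rw [neg_one_zpow_mul]; exact Even.neg_one_zpow ⟨_, rfl⟩
    calc tree n (A ++ (B ++ c :: (C ++ D)))
        = ((-1 : ℚ) ^ (B.length : ℤ) * (-1 : ℚ) ^ (B.length : ℤ)) •
          tree n (A ++ (B ++ c :: (C ++ D))) := by rw [this, one_smul]
      _ = _ := by
        rw [mul_smul, ← h1, smul_smul, neg_one_zpow_mul]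
        congr 2
        ring

theorem tree_mem (n : ℕ) (l : List Edge) : tree n l ∈ AInf.deg n (n - 2 - l.length) := by
  by_cases h : TreeList n l
  · change oriented n l ∈ Finsupp.supported ℚ ℚ _
    rw [oriented_of_treeList h]
    refine Finsupp.single_mem_supported ℚ _ ?_
    simp [Tree.degree, List.toFinset_card_of_nodup h.nodup]
  · rw [tree_of_not h]; exact Submodule.zero_mem _

/-- The homogeneous elements of `A∞(n)` are the linear combinations of trees with a fixed number of
edges. -/
theorem AInf_deg_induction {n : ℕ} {p : ℤ} {C : AInf.carrier n → Prop}
    (h0 : C 0) (hadd : ∀ x y, C x → C y → C (x + y)) (hsmul : ∀ (a : ℚ) x, C x → C (a • x))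
    (ht : ∀ l, TreeList n l → (n : ℤ) - 2 - l.length = p → C (tree n l))
    {x : AInf.carrier n} (hx : x ∈ AInf.deg n p) : C x := by
  have hx' : x ∈ Submodule.span ℚ ((fun T => Finsupp.single T (1 : ℚ)) ''
    {T : Tree n | T.degree = p}) := by
    rw [← Finsupp.supported_eq_span_single]; exact hx
  refine Submodule.span_induction (p := fun x _ => C x) ?_ h0 (fun x y _ _ => hadd x y)
    (fun a x _ => hsmul a x) hx'
  rintro _ ⟨T, hT, rfl⟩
  have := ht T.edges T.treeList (by
    rw [← (show T.degree = p from hT), Tree.degree, Tree.edges, Finset.length_sort])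
  rw [tree, oriented_edges] at this
  exact this

theorem AInf_hom_ext {n : ℕ} {M : Type*} [AddCommGroup M] [Module ℚ M]
    {f g : AInf.carrier n →ₗ[ℚ] M} (h : ∀ l, TreeList n l → f (tree n l) = g (tree n l)) :
    f = g := by
  refine Finsupp.lhom_ext' fun T => LinearMap.ext_ring ?_
  have := h T.edges T.treeList
  rw [tree, oriented_edges] at this
  exact this

/-- The differential adds an edge in all possible ways; impossible edges contribute zero. -/
theorem d_tree (n : ℕ) (l : List Edge) :
    AInf.d n (tree n l) = ∑ e ∈ validEdges n, tree n (e :: l) := by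
  have h1 : treeD n (oriented n l)
      = ∑ a ∈ Finset.Icc 1 n, ∑ b ∈ Finset.Icc 1 n, oriented n (edge a b :: l) := by
    by_cases h : TreeList n l
    · refine linearCombination_oriented
        (fun l => ∑ a ∈ Finset.Icc 1 n, ∑ b ∈ Finset.Icc 1 n, oriented n (edge a b :: l)) ?_ h
      intro A x y B
      simp only [← Finset.sum_neg_distrib]
      exact Finset.sum_congr rfl fun a _ => Finset.sum_congr rfl fun b _ =>
        oriented_swap n (edge a b :: A) x y B
    · rw [oriented_of_not_treeList h, map_zero, Finset.sum_eq_zero]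
      intro a _
      refine Finset.sum_eq_zero fun b _ => oriented_of_not_treeList fun h' => h h'.tail
  refine h1.trans ?_
  unfold validEdges
  rw [Finset.sum_filter_of_ne, Finset.sum_map, Finset.sum_product]
  · rfl
  · intro e _ he
    by_contra h
    exact he (tree_of_not fun h' => h (h'.2.1 e (by simp)))

theorem rot_tree {n : ℕ} {l : List Edge} (hl : TreeList n l) :
    AInf.rot n (tree n l) = (-1 : ℚ) ^ n • tree n (l.map (rotEdge n)) := by
  refine linearCombination_oriented (fun l => (-1 : ℚ) ^ n • oriented n (l.map (rotEdge n))) ?_ hl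
  intro A x y B
  simp only [List.map_append, List.map_cons]
  rw [oriented_swap, smul_neg]

/-- The edges of `U ∘ᵢ V`, in the order of its orientation: those of `U`, those of `V`, and the new
edge. -/
def graftList (k i : ℕ) (l l' : List Edge) : List Edge :=
  l.map (outerEdge k i) ++ l'.map (innerEdge i) ++ [edge i (i + k - 1)]

@[simp] theorem fstLeaf_outerEdge (k i : ℕ) (e : Edge) : fstLeaf (outerEdge k i e)
    = if fstLeaf e ≤ i then fstLeaf e else fstLeaf e + k - 1 := rfl
@[simp] theorem lstLeaf_outerEdge (k i : ℕ) (e : Edge) : lstLeaf (outerEdge k i e)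
    = if lstLeaf e < i then lstLeaf e else lstLeaf e + k - 1 := rfl
@[simp] theorem fstLeaf_innerEdge (i : ℕ) (e : Edge) :
    fstLeaf (innerEdge i e) = fstLeaf e + i - 1 := rfl
@[simp] theorem lstLeaf_innerEdge (i : ℕ) (e : Edge) :
    lstLeaf (innerEdge i e) = lstLeaf e + i - 1 := rfl
@[simp] theorem fstLeaf_edge (a b : ℕ) : fstLeaf (edge a b) = a := rfl
@[simp] theorem lstLeaf_edge (a b : ℕ) : lstLeaf (edge a b) = b := rfl
@[simp] theorem fstLeaf_rotEdge (n : ℕ) (e : Edge) : fstLeaf (rotEdge n e)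
    = if lstLeaf e < n then fstLeaf e + 1 else 1 := by unfold rotEdge; split_ifs <;> rfl
@[simp] theorem lstLeaf_rotEdge (n : ℕ) (e : Edge) : lstLeaf (rotEdge n e)
    = if lstLeaf e < n then lstLeaf e + 1 else fstLeaf e := by
  unfold rotEdge; split_ifs <;> rfl

section Graft

variable {m k i N : ℕ}

theorem indep_outerEdge (hk : 1 ≤ k) (e f : Edge) (he : fstLeaf e ≤ lstLeaf e)
    (hf : fstLeaf f ≤ lstLeaf f) :
    Indep (outerEdge k i e) (outerEdge k i f) ↔ Indep e f := by
  simp only [Indep, fstLeaf_outerEdge, lstLeaf_outerEdge]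
  split_ifs <;> omega

theorem indep_innerEdge (hi : 1 ≤ i) (e f : Edge) :
    Indep (innerEdge i e) (innerEdge i f) ↔ Indep e f := by
  simp only [Indep, fstLeaf_innerEdge, lstLeaf_innerEdge]
  omega

theorem validEdge_outerEdge (hi : 1 ≤ i) (him : i ≤ m) (hN : m + k = N + 1) (hk : 2 ≤ k)
    {e : Edge} (he : ValidEdge m e) :
    ValidEdge N (outerEdge k i e) ∧ Indep (outerEdge k i e) (edge i (i + k - 1)) := by
  simp only [Indep, ValidEdge, fstLeaf_outerEdge, lstLeaf_outerEdge, fstLeaf_edge,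
    lstLeaf_edge] at *
  split_ifs <;> omega

theorem validEdge_innerEdge (hi : 1 ≤ i) (him : i ≤ m) (hN : m + k = N + 1) (hm : 2 ≤ m)
    {e : Edge} (he : ValidEdge k e) :
    ValidEdge N (innerEdge i e) ∧ Indep (innerEdge i e) (edge i (i + k - 1)) := by
  simp only [Indep, ValidEdge, fstLeaf_innerEdge, lstLeaf_innerEdge, fstLeaf_edge,
    lstLeaf_edge] at *
  omega

theorem indep_outerEdge_innerEdge (hi : 1 ≤ i) {e f : Edge}
    (he : ValidEdge m e) (hf : ValidEdge k f) : Indep (outerEdge k i e) (innerEdge i f) := by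
  simp only [Indep, ValidEdge, fstLeaf_outerEdge, lstLeaf_outerEdge, fstLeaf_innerEdge,
    lstLeaf_innerEdge] at *
  split_ifs <;> omega

/-- The edges of a composite tree are the new edge and the edges of the two factors. -/
theorem validEdge_graft_cases (hi : 1 ≤ i) (him : i ≤ m) (hN : m + k = N + 1) {e : Edge}
    (he : ValidEdge N e) (h : Indep e (edge i (i + k - 1))) :
    (∃ f, ValidEdge m f ∧ outerEdge k i f = e) ∨ ∃ f, ValidEdge k f ∧ innerEdge i f = e := by
  by_cases hin : i ≤ fstLeaf e ∧ lstLeaf e ≤ i + k - 1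
  · right
    refine ⟨edge (fstLeaf e + 1 - i) (lstLeaf e + 1 - i), ?_, edge_ext ?_ ?_⟩ <;>
    simp only [Indep, ValidEdge, fstLeaf_innerEdge, lstLeaf_innerEdge, fstLeaf_edge,
      lstLeaf_edge] at * <;> omega
  · left
    refine ⟨edge (if fstLeaf e ≤ i then fstLeaf e else fstLeaf e + 1 - k)
      (if lstLeaf e < i then lstLeaf e else lstLeaf e + 1 - k), ?_, edge_ext ?_ ?_⟩ <;>
    simp only [Indep, ValidEdge, fstLeaf_outerEdge, lstLeaf_outerEdge, fstLeaf_edge,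
      lstLeaf_edge] at * <;> split_ifs <;> omega

theorem treeList_graftList (hi : 1 ≤ i) (him : i ≤ m) (hN : m + k = N + 1) (hm : 2 ≤ m)
    (hk : 2 ≤ k) {l l' : List Edge} (hl : ∀ e ∈ l, ValidEdge m e) (hl' : ∀ e ∈ l', ValidEdge k e) :
    TreeList N (graftList k i l l') ↔ TreeList m l ∧ TreeList k l' := by
  unfold TreeList graftList
  simp only [List.pairwise_append, List.pairwise_map, List.mem_append, List.mem_map,
    List.mem_singleton, List.pairwise_singleton]
  have h1 : l.Pairwise (fun a b => Indep (outerEdge k i a) (outerEdge k i b)) ↔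
      l.Pairwise Indep := List.Pairwise.iff_of_mem fun {a b} ha hb =>
    indep_outerEdge (by omega) a b (hl a ha).2.1.le (hl b hb).2.1.le
  have h2 : l'.Pairwise (fun a b => Indep (innerEdge i a) (innerEdge i b)) ↔
      l'.Pairwise Indep := List.Pairwise.iff_of_mem fun {a b} _ _ => indep_innerEdge hi a b
  rw [h1, h2]
  constructor
  · rintro ⟨-, -, ⟨⟨h3, h4, -⟩, -⟩⟩
    exact ⟨⟨hm, hl, h3⟩, hk, hl', h4⟩
  · rintro ⟨⟨-, -, h3⟩, -, -, h4⟩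
    refine ⟨by omega, ?_, ⟨⟨h3, h4, ?_⟩, trivial, ?_⟩⟩
    · rintro e ((⟨f, hf, rfl⟩ | ⟨f, hf, rfl⟩) | rfl)
      · exact (validEdge_outerEdge hi him hN hk (hl f hf)).1
      · exact (validEdge_innerEdge hi him hN hm (hl' f hf)).1
      · simp only [ValidEdge, fstLeaf_edge, lstLeaf_edge]; omega
    · rintro _ ⟨e, he, rfl⟩ _ ⟨f, hf, rfl⟩
      exact indep_outerEdge_innerEdge hi (hl e he) (hl' f hf)
    · rintro e (⟨f, hf, rfl⟩ | ⟨f, hf, rfl⟩) _ rfl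
      · exact (validEdge_outerEdge hi him hN hk (hl f hf)).2
      · exact (validEdge_innerEdge hi him hN hm (hl' f hf)).2

/-- The composition of oriented trees.  Only the validity of the edges is assumed, so that the
formula also applies to lists which represent zero. -/
theorem comp_tree (hi : 1 ≤ i) (him : i ≤ m) (hN : m + k = N + 1) (hm : 2 ≤ m)
    (hk : 2 ≤ k) {l l' : List Edge} (hl : ∀ e ∈ l, ValidEdge m e) (hl' : ∀ e ∈ l', ValidEdge k e) :
    AInf.compTo m k i N (tree m l) (tree k l')
      = (-1 : ℚ) ^ ((i : ℤ) * (k + 1) + m * (k - 2 - l'.length)) •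
        tree N (graftList k i l l') := by
  obtain rfl : m + k - 1 = N := by omega
  rw [OpData.compTo_self]
  by_cases h : TreeList m l ∧ TreeList k l'
  · change treeComp m k i (oriented m l) (oriented k l')
      = _ • oriented (m + k - 1) (graftList k i l l')
    have h1 : treeComp m k i (oriented m l) = Finsupp.linearCombination ℚ fun V : Tree k =>
      (-1 : ℚ) ^ ((i : ℤ) * (k + 1) + m * V.degree) •
        oriented (m + k - 1) (graftList k i l V.edges) := by
      refine linearCombination_oriented (fun l => Finsupp.linearCombination ℚ fun V : Tree k =>
        (-1 : ℚ) ^ ((i : ℤ) * (k + 1) + m * V.degree) •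
        oriented (m + k - 1) (graftList k i l V.edges)) ?_ h.1
      intro A x y B
      ext V
      simp only [LinearMap.comp_apply, Finsupp.lsingle_apply, LinearMap.neg_apply,
        Finsupp.linearCombination_single, one_smul, graftList, List.map_append, List.map_cons,
        List.append_assoc, List.cons_append]
      rw [oriented_swap, smul_neg]
    rw [h1]
    have h2 := linearCombination_oriented (n := k) (fun l' =>
      (-1 : ℚ) ^ ((i : ℤ) * (k + 1) + m * (k - 2 - l'.length)) •
        oriented (m + k - 1) (graftList k i l l')) (by
      intro A x y B
      simp only [graftList, List.map_append, List.map_cons, List.append_assoc, List.cons_append,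
        List.length_append, List.length_cons]
      rw [← List.append_assoc, oriented_swap, smul_neg, List.append_assoc]) h.2
    refine Eq.trans ?_ h2
    congr 2
    ext1 V
    rw [Tree.degree, Tree.edges, Finset.length_sort]
  · rw [tree_of_not (fun h' => h ((treeList_graftList hi him hN hm hk hl hl').1 h')), smul_zero]
    rw [not_and_or] at h
    rcases h with h | h
    · rw [tree_of_not h, map_zero, LinearMap.zero_apply]
    · rw [tree_of_not h, map_zero]

end Graft

/-! ### `A∞` is a cyclic dg operad -/

section Rotation

variable {m n k N : ℕ}

theorem validEdge_rotEdge {e : Edge} (he : ValidEdge n e) : ValidEdge n (rotEdge n e) := by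
  simp only [ValidEdge, fstLeaf_rotEdge, lstLeaf_rotEdge] at *
  split_ifs <;> omega

theorem indep_rotEdge {e f : Edge} (he : ValidEdge n e) (hf : ValidEdge n f) :
    Indep (rotEdge n e) (rotEdge n f) ↔ Indep e f := by
  simp only [Indep, ValidEdge, fstLeaf_rotEdge, lstLeaf_rotEdge] at *
  split_ifs <;> omega

theorem TreeList.rot {l : List Edge} (h : TreeList n l) : TreeList n (l.map (rotEdge n)) := by
  refine ⟨h.1, ?_, ?_⟩
  · intro e he
    obtain ⟨f, hf, rfl⟩ := List.mem_map.1 he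
    exact validEdge_rotEdge (h.2.1 f hf)
  · rw [List.pairwise_map]
    exact (List.Pairwise.iff_of_mem fun {a b} ha hb =>
      indep_rotEdge (h.2.1 a ha) (h.2.1 b hb)).2 h.2.2

/-- The formula for the rotation also holds for lists of edges which represent zero. -/
theorem rot_tree_of_valid {l : List Edge} (hl : ∀ e ∈ l, ValidEdge n e) :
    AInf.rot n (tree n l) = (-1 : ℚ) ^ n • tree n (l.map (rotEdge n)) := by
  by_cases h : TreeList n l
  · exact rot_tree h
  · rw [tree_of_not h, map_zero, tree_of_not, smul_zero]
    intro h'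
    refine h ⟨h'.1, hl, ?_⟩
    have := h'.2.2
    rw [List.pairwise_map] at this
    exact (List.Pairwise.iff_of_mem fun {a b} ha hb =>
      indep_rotEdge (hl a ha) (hl b hb)).1 this

/-- The rotation permutes the possible edges. -/
theorem sum_rotEdge {M : Type*} [AddCommMonoid M] (F : Edge → M) :
    ∑ e ∈ validEdges n, F (rotEdge n e) = ∑ e ∈ validEdges n, F e := by
  refine Finset.sum_nbij' (rotEdge n) (fun e => if fstLeaf e = 1 then edge (lstLeaf e) n
    else edge (fstLeaf e - 1) (lstLeaf e - 1)) ?_ ?_ ?_ ?_ (fun _ _ => rfl)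
  · intro e he
    rw [mem_validEdges] at *
    exact validEdge_rotEdge he
  · intro e he
    rw [mem_validEdges] at *
    unfold ValidEdge at *
    split_ifs <;> simp only [fstLeaf_edge, lstLeaf_edge] <;> omega
  · intro e he
    rw [mem_validEdges] at he
    unfold ValidEdge at he
    simp only [fstLeaf_rotEdge, lstLeaf_rotEdge]
    refine edge_ext ?_ ?_ <;> split_ifs <;> simp only [fstLeaf_edge, lstLeaf_edge] <;> omega
  · intro e he
    rw [mem_validEdges] at he
    unfold ValidEdge at he
    refine edge_ext ?_ ?_ <;> simp only [fstLeaf_rotEdge, lstLeaf_rotEdge] <;> split_ifs <;>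
      simp only [fstLeaf_edge, lstLeaf_edge] at * <;> omega

theorem rotEdge_iterate (j : ℕ) (e : Edge) (h : lstLeaf e + j ≤ n) :
    (rotEdge n)^[j] e = edge (fstLeaf e + j) (lstLeaf e + j) := by
  induction j with
  | zero => rfl
  | succ j ih =>
    rw [Function.iterate_succ_apply', ih (by omega)]
    refine edge_ext ?_ ?_ <;> simp only [fstLeaf_rotEdge, lstLeaf_rotEdge] <;> split_ifs <;>
      simp only [fstLeaf_edge, lstLeaf_edge] at * <;> omega

theorem rotEdge_of_last {e : Edge} (h : lstLeaf e = n) : rotEdge n e = edge 1 (fstLeaf e) := by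
  unfold rotEdge; rw [if_neg (by omega)]

/-- Each turn moves an interval to the right until it ends at the last leaf, where it is replaced by
its complement among the leaves and the root; this happens twice in `n + 1` steps. -/
theorem rotEdge_iterate_succ {e : Edge} (he : ValidEdge n e) : (rotEdge n)^[n + 1] e = e := by
  unfold ValidEdge at he
  have h : n + 1 = (fstLeaf e - 1) + (1 + ((lstLeaf e - fstLeaf e) + (1 + (n - lstLeaf e)))) := by
    omega
  have h1 : (rotEdge n)^[n - lstLeaf e] e = edge (fstLeaf e + n - lstLeaf e) n := by
    rw [rotEdge_iterate _ _ (by omega)]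
    refine edge_ext ?_ ?_ <;> simp only [fstLeaf_edge, lstLeaf_edge] <;> omega
  have h2 : (rotEdge n)^[lstLeaf e - fstLeaf e] (edge 1 (fstLeaf e + n - lstLeaf e))
      = edge (1 + lstLeaf e - fstLeaf e) n := by
    rw [rotEdge_iterate _ _ (by simp only [lstLeaf_edge]; omega)]
    refine edge_ext ?_ ?_ <;> simp only [fstLeaf_edge, lstLeaf_edge] <;> omega
  have h3 : (rotEdge n)^[fstLeaf e - 1] (edge 1 (1 + lstLeaf e - fstLeaf e)) = e := by
    rw [rotEdge_iterate _ _ (by simp only [lstLeaf_edge]; omega)]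
    refine edge_ext ?_ ?_ <;> simp only [fstLeaf_edge, lstLeaf_edge] <;> omega
  rw [h, Function.iterate_add_apply, Function.iterate_add_apply, Function.iterate_add_apply,
    Function.iterate_add_apply, h1, Function.iterate_one, rotEdge_of_last (lstLeaf_edge _ _),
    fstLeaf_edge, h2, rotEdge_of_last (lstLeaf_edge _ _), fstLeaf_edge, h3]

theorem rot_pow_tree (j : ℕ) {l : List Edge} (hl : TreeList n l) :
    (AInf.rot n ^ j) (tree n l)
      = (-1 : ℚ) ^ ((n : ℤ) * j) • tree n (l.map (rotEdge n)^[j]) ∧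
      TreeList n (l.map (rotEdge n)^[j]) := by
  induction j with
  | zero => simp [hl]
  | succ j ih =>
    have hm : l.map (rotEdge n)^[j + 1] = (l.map (rotEdge n)^[j]).map (rotEdge n) := by
      rw [List.map_map, Function.iterate_succ']
    rw [hm]
    refine ⟨?_, ih.2.rot⟩
    rw [pow_succ', Module.End.mul_apply, ih.1, map_smul, rot_tree ih.2, smul_smul,
      ← zpow_natCast, neg_one_zpow_mul]
    congr 2

end Rotation

theorem AInf_subsingleton {n : ℕ} (hn : n < 2) (x : AInf.carrier n) : x = 0 := by
  have : IsEmpty (Tree n) := ⟨fun T => by have := T.2.1; omega⟩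
  exact Subsingleton.elim (α := TreeSpace n) x 0

section Laws

variable {m n k i j N : ℕ}

/-- The edges which can be added to a composite tree are those which can be added to one of its two
factors. -/
theorem sum_validEdges_graft (hi : 1 ≤ i) (him : i ≤ m) (hN : m + k = N + 1) (hm : 2 ≤ m)
    (hk : 2 ≤ k) (l l' : List Edge) :
    ∑ e ∈ validEdges N, tree N (e :: graftList k i l l')
      = ∑ e ∈ validEdges m, tree N (outerEdge k i e :: graftList k i l l')
        + ∑ e ∈ validEdges k, tree N (innerEdge i e :: graftList k i l l') := by
  have hinj1 : Set.InjOn (outerEdge k i) (validEdges m) := by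
    intro e he f hf h
    rw [SetLike.mem_coe, mem_validEdges] at he hf
    by_contra hne
    have h' := congrArg fstLeaf h
    have h'' := congrArg lstLeaf h
    rw [← ne_eq, edge_ne_iff] at hne
    simp only [fstLeaf_outerEdge, lstLeaf_outerEdge] at h' h''
    split_ifs at h' h'' <;> omega
  have hinj2 : Set.InjOn (innerEdge i) (validEdges k) := by
    intro e he f hf h
    rw [SetLike.mem_coe, mem_validEdges] at he hf
    have h' := congrArg fstLeaf h
    have h'' := congrArg lstLeaf h
    simp only [fstLeaf_innerEdge, lstLeaf_innerEdge] at h' h''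
    refine edge_ext ?_ ?_ <;> omega
  have hdisj : Disjoint ((validEdges m).image (outerEdge k i))
      ((validEdges k).image (innerEdge i)) := by
    rw [Finset.disjoint_left]
    intro e he he'
    obtain ⟨f, hf, rfl⟩ := Finset.mem_image.1 he
    obtain ⟨g, hg, h⟩ := Finset.mem_image.1 he'
    rw [mem_validEdges] at *
    have := indep_outerEdge_innerEdge hi hf hg
    rw [h] at this
    exact (indep_iff.1 this).1 rfl
  rw [← Finset.sum_image (f := fun e => tree N (e :: graftList k i l l')) hinj1,
    ← Finset.sum_image (f := fun e => tree N (e :: graftList k i l l')) hinj2,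
    ← Finset.sum_union hdisj]
  symm
  refine Finset.sum_subset ?_ ?_
  · intro e he
    rw [mem_validEdges]
    rcases Finset.mem_union.1 he with he | he
    · obtain ⟨f, hf, rfl⟩ := Finset.mem_image.1 he
      exact (validEdge_outerEdge hi him hN hk (mem_validEdges.1 hf)).1
    · obtain ⟨f, hf, rfl⟩ := Finset.mem_image.1 he
      exact (validEdge_innerEdge hi him hN hm (mem_validEdges.1 hf)).1
  · intro e he hne
    refine tree_of_not fun h => hne ?_
    have hind : Indep e (edge i (i + k - 1)) :=
      (List.pairwise_cons.1 h.2.2).1 _ (by simp [graftList])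
    rw [Finset.mem_union, Finset.mem_image, Finset.mem_image]
    rcases validEdge_graft_cases hi him hN (mem_validEdges.1 he) hind with
      ⟨f, hf, rfl⟩ | ⟨f, hf, rfl⟩
    · exact Or.inl ⟨f, mem_validEdges.2 hf, rfl⟩
    · exact Or.inr ⟨f, mem_validEdges.2 hf, rfl⟩

theorem AInf_d_comp (hi : 1 ≤ i) (him : i ≤ m) (hN : m + k = N + 1) {l l' : List Edge}
    (hl : TreeList m l) (hl' : TreeList k l') :
    AInf.d N (AInf.compTo m k i N (tree m l) (tree k l'))
      = AInf.compTo m k i N (AInf.d m (tree m l)) (tree k l')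
        + (-1 : ℚ) ^ ((m : ℤ) - 2 - l.length) •
          AInf.compTo m k i N (tree m l) (AInf.d k (tree k l')) := by
  have hm := hl.1
  have hk := hl'.1
  rw [comp_tree hi him hN hm hk hl.2.1 hl'.2.1, map_smul, d_tree, d_tree, d_tree,
    sum_validEdges_graft hi him hN hm hk, map_sum, map_sum, LinearMap.sum_apply, smul_add,
    Finset.smul_sum, Finset.smul_sum, Finset.smul_sum]
  congr 1
  · refine Finset.sum_congr rfl fun e he => ?_
    rw [comp_tree hi him hN hm hk (List.forall_mem_cons.2 ⟨mem_validEdges.1 he, hl.2.1⟩) hl'.2.1]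
    rfl
  · refine Finset.sum_congr rfl fun e he => ?_
    rw [comp_tree hi him hN hm hk hl.2.1 (List.forall_mem_cons.2 ⟨mem_validEdges.1 he, hl'.2.1⟩)]
    have := tree_move N [] (l.map (outerEdge k i))
      (l'.map (innerEdge i) ++ [edge i (i + k - 1)]) (innerEdge i e)
    simp only [graftList, List.nil_append, List.map_cons, List.append_assoc, List.cons_append,
      List.length_map] at this ⊢
    rw [this, smul_smul, smul_smul, neg_one_zpow_mul, neg_one_zpow_mul]
    congr 1
    refine neg_one_zpow_congr ?_
    push_cast [List.length_cons]
    exact ⟨l.length + 1, by ring⟩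

/-- The iterated compositions `(U ∘ᵢ V) ∘ W` and `U ∘ᵢ (V ∘ⱼ W)` of trees have the same edges; the
new edge of `U ∘ᵢ V` occurs at different places in the two lists. -/
theorem graftList_seq {m n k i j M' : ℕ} (hi : 1 ≤ i) (hj : 1 ≤ j) (hjn : j ≤ n) (hk : 2 ≤ k)
    (hM' : n + k = M' + 1) {l l' l'' : List Edge} (hl : ∀ e ∈ l, ValidEdge m e)
    (hl' : ∀ e ∈ l', ValidEdge n e) (hl'' : ∀ e ∈ l'', ValidEdge k e) :
    graftList k (i + j - 1) (graftList n i l l') l''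
        = l.map (outerEdge M' i) ++ (l'.map (innerEdge i ∘ outerEdge k j)) ++
          edge i (i + M' - 1) ::
            ((l''.map (innerEdge i ∘ innerEdge j) ++ [innerEdge i (edge j (j + k - 1))]) ++ []) ∧
      graftList M' i l (graftList k j l' l'')
        = l.map (outerEdge M' i) ++ (l'.map (innerEdge i ∘ outerEdge k j)) ++
          ((l''.map (innerEdge i ∘ innerEdge j) ++ [innerEdge i (edge j (j + k - 1))]) ++
            [edge i (i + M' - 1)]) := by
  constructor
  · simp only [graftList, List.map_append, List.map_map, List.append_assoc, List.map_cons,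
      List.map_nil, List.cons_append, List.nil_append, List.append_nil]
    congr 1
    · refine List.map_congr_left fun e he => ?_
      have := hl e he
      simp only [ValidEdge, Function.comp_apply] at *
      refine edge_ext ?_ ?_ <;> simp only [fstLeaf_outerEdge, lstLeaf_outerEdge] <;> grind
    congr 1
    · refine List.map_congr_left fun e he => ?_
      have := hl' e he
      simp only [ValidEdge, Function.comp_apply] at *
      refine edge_ext ?_ ?_ <;> simp only [fstLeaf_outerEdge, lstLeaf_outerEdge,
        fstLeaf_innerEdge, lstLeaf_innerEdge] <;> grind
    congr 1
    · refine edge_ext ?_ ?_ <;> simp only [fstLeaf_outerEdge, lstLeaf_outerEdge,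
        fstLeaf_edge, lstLeaf_edge] <;> grind
    congr 1
    · refine List.map_congr_left fun e he => ?_
      have := hl'' e he
      simp only [ValidEdge, Function.comp_apply] at *
      refine edge_ext ?_ ?_ <;> simp only [fstLeaf_innerEdge, lstLeaf_innerEdge] <;> omega
    congr 1
    refine edge_ext ?_ ?_ <;> simp only [fstLeaf_innerEdge, lstLeaf_innerEdge,
        fstLeaf_edge, lstLeaf_edge] <;> omega
  · simp only [graftList, List.map_append, List.map_map, List.append_assoc, List.map_cons,
      List.map_nil, List.cons_append, List.nil_append]

theorem forall_graftList (hi : 1 ≤ i) (him : i ≤ m) (hN : m + k = N + 1) {l l' : List Edge}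
    (hl : TreeList m l) (hl' : TreeList k l') : ∀ e ∈ graftList k i l l', ValidEdge N e :=
  ((treeList_graftList hi him hN hl.1 hl'.1 hl.2.1 hl'.2.1).2 ⟨hl, hl'⟩).2.1

theorem length_graftList (l l' : List Edge) :
    (graftList k i l l').length = l.length + l'.length + 1 := by
  simp [graftList, add_assoc]

theorem AInf_seq {m n k i j M M' N : ℕ} (hi : 1 ≤ i) (him : i ≤ m) (hj : 1 ≤ j) (hjn : j ≤ n)
    (hM : m + n = M + 1) (hM' : n + k = M' + 1) (hN : M + k = N + 1) {l l' l'' : List Edge}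
    (hl : TreeList m l) (hl' : TreeList n l') (hl'' : TreeList k l'') :
    AInf.compTo M k (i + j - 1) N (AInf.compTo m n i M (tree m l) (tree n l')) (tree k l'')
      = AInf.compTo m M' i N (tree m l) (AInf.compTo n k j M' (tree n l') (tree k l'')) := by
  have hm := hl.1
  have hn := hl'.1
  have hk := hl''.1
  obtain ⟨h1, h2⟩ := graftList_seq hi hj hjn hk hM' hl.2.1 hl'.2.1 hl''.2.1
  rw [comp_tree hi him hM hm hn hl.2.1 hl'.2.1, comp_tree hj hjn hM' hn hk hl'.2.1 hl''.2.1,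
    map_smul, map_smul, LinearMap.smul_apply,
    comp_tree (by omega) (by omega) hN (by omega) hk (forall_graftList hi him hM hl hl') hl''.2.1,
    comp_tree hi him (by omega) hm (by omega) hl.2.1 (forall_graftList hj hjn hM' hl' hl''),
    h1, h2, tree_move, smul_smul, smul_smul, smul_smul, neg_one_zpow_mul, neg_one_zpow_mul,
    neg_one_zpow_mul, length_graftList]
  simp only [List.append_assoc]
  congr 1
  refine neg_one_zpow_congr ?_
  simp only [List.length_append, List.length_map, List.length_cons, List.length_nil]
  have e1 : (M : ℤ) = m + n - 1 := by omega
  have e2 : (M' : ℤ) = n + k - 1 := by omega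
  have e3 : ((i + j - 1 : ℕ) : ℤ) = i + j - 1 := by omega
  rw [e1, e2, e3]
  push_cast
  rw [Int.even_iff]
  ring_nf
  omega

/-- The iterated compositions `(X ∘ⱼ W) ∘ᵢ V` and `(X ∘ᵢ V) ∘ W` of trees, where `i < j`, differ by
an exchange of two blocks of edges. -/
theorem graftList_par {m k l i j : ℕ} (hi : 1 ≤ i) (hij : i < j)
    (hk : 2 ≤ k) (hl : 2 ≤ l) {lx lw lv : List Edge} (hlx : ∀ e ∈ lx, ValidEdge m e)
    (hlw : ∀ e ∈ lw, ValidEdge k e) (hlv : ∀ e ∈ lv, ValidEdge l e) :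
    graftList l i (graftList k j lx lw) lv
        = lx.map (outerEdge l i ∘ outerEdge k j) ++
          (lw.map (outerEdge l i ∘ innerEdge j) ++ [outerEdge l i (edge j (j + k - 1))]) ++
          (lv.map (innerEdge i) ++ [edge i (i + l - 1)]) ++ [] ∧
      graftList k (j + l - 1) (graftList l i lx lv) lw
        = lx.map (outerEdge l i ∘ outerEdge k j) ++
          (lv.map (innerEdge i) ++ [edge i (i + l - 1)]) ++
          (lw.map (outerEdge l i ∘ innerEdge j) ++ [outerEdge l i (edge j (j + k - 1))]) ++ [] := by
  constructor
  · simp only [graftList, List.map_append, List.map_map, List.append_assoc, List.map_cons,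
      List.map_nil, List.append_nil]
  · simp only [graftList, List.map_append, List.map_map, List.append_assoc, List.map_cons,
      List.map_nil, List.append_nil]
    congr 1
    · refine List.map_congr_left fun e he => ?_
      have := hlx e he
      simp only [ValidEdge, Function.comp_apply] at *
      refine edge_ext ?_ ?_ <;> simp only [fstLeaf_outerEdge, lstLeaf_outerEdge] <;> grind
    congr 1
    · refine List.map_congr_left fun e he => ?_
      have := hlv e he
      simp only [ValidEdge, Function.comp_apply] at *
      refine edge_ext ?_ ?_ <;> simp only [fstLeaf_outerEdge, lstLeaf_outerEdge,
        fstLeaf_innerEdge, lstLeaf_innerEdge] <;> grind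
    congr 1
    · congr 1
      refine edge_ext ?_ ?_ <;> simp only [fstLeaf_outerEdge, lstLeaf_outerEdge,
        fstLeaf_edge, lstLeaf_edge] <;> grind
    congr 1
    · refine List.map_congr_left fun e he => ?_
      have := hlw e he
      simp only [ValidEdge, Function.comp_apply] at *
      refine edge_ext ?_ ?_ <;> simp only [fstLeaf_outerEdge, lstLeaf_outerEdge,
        fstLeaf_innerEdge, lstLeaf_innerEdge] <;> grind
    congr 1
    refine edge_ext ?_ ?_ <;> simp only [fstLeaf_outerEdge, lstLeaf_outerEdge,
        fstLeaf_edge, lstLeaf_edge] <;> grind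

theorem AInf_par {m k l i j M M' N : ℕ} (hi : 1 ≤ i) (hij : i < j) (hj : j ≤ m)
    (hM : m + k = M + 1) (hM' : m + l = M' + 1) (hN : M + l = N + 1) {lx lw lv : List Edge}
    (hlx : TreeList m lx) (hlw : TreeList k lw) (hlv : TreeList l lv) :
    AInf.compTo M l i N (AInf.compTo m k j M (tree m lx) (tree k lw)) (tree l lv)
      = (-1 : ℚ) ^ (((k : ℤ) - 2 - lw.length) * (l - 2 - lv.length)) •
        AInf.compTo M' k (j + l - 1) N (AInf.compTo m l i M' (tree m lx) (tree l lv))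
          (tree k lw) := by
  have hm := hlx.1
  have hk := hlw.1
  have hl := hlv.1
  have hj1 : 1 ≤ j := by omega
  have him : i ≤ m := by omega
  obtain ⟨h1, h2⟩ := graftList_par hi hij hk hl hlx.2.1 hlw.2.1 hlv.2.1
  rw [comp_tree hj1 hj hM hm hk hlx.2.1 hlw.2.1, comp_tree hi him hM' hm hl hlx.2.1 hlv.2.1,
    map_smul, map_smul, LinearMap.smul_apply, LinearMap.smul_apply,
    comp_tree hi (by omega) hN (by omega) hl (forall_graftList hj1 hj hM hlx hlw) hlv.2.1,
    comp_tree (by omega) (by omega) (by omega) (by omega) hk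
      (forall_graftList hi him hM' hlx hlv) hlw.2.1,
    h1, h2, tree_move_block]
  simp only [smul_smul, neg_one_zpow_mul]
  congr 1
  refine neg_one_zpow_congr ?_
  simp only [List.length_append, List.length_map, List.length_cons, List.length_nil]
  have e1 : (M : ℤ) = m + k - 1 := by omega
  have e2 : (M' : ℤ) = m + l - 1 := by omega
  have e3 : ((j + l - 1 : ℕ) : ℤ) = j + l - 1 := by omega
  rw [e1, e2, e3]
  push_cast
  rw [Int.even_iff]
  ring_nf
  omega

theorem map_rot_graftList (hi : 1 ≤ i) (him : i < m) (hN : m + k = N + 1) (hk : 2 ≤ k)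
    {l l' : List Edge} (hl : ∀ e ∈ l, ValidEdge m e) (hl' : ∀ e ∈ l', ValidEdge k e) :
    (graftList k i l l').map (rotEdge N) = graftList k (i + 1) (l.map (rotEdge m)) l' := by
  simp only [graftList, List.map_append, List.map_map, List.append_assoc, List.map_cons,
      List.map_nil]
  congr 1
  · refine List.map_congr_left fun e he => ?_
    have := hl e he
    simp only [ValidEdge, Function.comp_apply] at *
    refine edge_ext ?_ ?_ <;> simp only [fstLeaf_outerEdge, lstLeaf_outerEdge,
      fstLeaf_rotEdge, lstLeaf_rotEdge] <;> grind
  congr 1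
  · refine List.map_congr_left fun e he => ?_
    have := hl' e he
    simp only [ValidEdge, Function.comp_apply] at *
    refine edge_ext ?_ ?_ <;> simp only [fstLeaf_innerEdge, lstLeaf_innerEdge,
      fstLeaf_rotEdge, lstLeaf_rotEdge] <;> grind
  congr 1
  refine edge_ext ?_ ?_ <;> simp only [fstLeaf_rotEdge, lstLeaf_rotEdge,
      fstLeaf_edge, lstLeaf_edge] <;> grind

/-- Rotating `U ∘ₘ V` exchanges the roles of `U` and `V`. -/
theorem map_rot_graftList_last (hm : 2 ≤ m) (hN : m + k = N + 1) (hk : 2 ≤ k)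
    {l l' : List Edge} (hl : ∀ e ∈ l, ValidEdge m e) (hl' : ∀ e ∈ l', ValidEdge k e) :
    (graftList k m l l').map (rotEdge N)
        = [] ++ (l.map (rotEdge m)).map (innerEdge 1) ++ (l'.map (rotEdge k)).map (outerEdge m 1)
          ++ [edge 1 (1 + m - 1)] := by
  simp only [graftList, List.map_append, List.map_map, List.append_assoc, List.map_cons,
      List.map_nil, List.nil_append]
  congr 1
  · refine List.map_congr_left fun e he => ?_
    have := hl e he
    simp only [ValidEdge, Function.comp_apply] at *
    refine edge_ext ?_ ?_ <;> simp only [fstLeaf_outerEdge, lstLeaf_outerEdge,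
      fstLeaf_rotEdge, lstLeaf_rotEdge, fstLeaf_innerEdge, lstLeaf_innerEdge] <;> grind
  congr 1
  · refine List.map_congr_left fun e he => ?_
    have := hl' e he
    simp only [ValidEdge, Function.comp_apply] at *
    refine edge_ext ?_ ?_ <;> simp only [fstLeaf_innerEdge, lstLeaf_innerEdge,
      fstLeaf_outerEdge, lstLeaf_outerEdge, fstLeaf_rotEdge, lstLeaf_rotEdge] <;> grind
  congr 1
  refine edge_ext ?_ ?_ <;> simp only [fstLeaf_rotEdge, lstLeaf_rotEdge,
      fstLeaf_edge, lstLeaf_edge] <;> grind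

theorem AInf_rot_comp (hi : 1 ≤ i) (him : i < m) (hN : m + k = N + 1) {l l' : List Edge}
    (hl : TreeList m l) (hl' : TreeList k l') :
    AInf.rot N (AInf.compTo m k i N (tree m l) (tree k l'))
      = AInf.compTo m k (i + 1) N (AInf.rot m (tree m l)) (tree k l') := by
  have hm := hl.1
  have hk := hl'.1
  rw [comp_tree hi him.le hN hm hk hl.2.1 hl'.2.1, map_smul,
    rot_tree_of_valid (forall_graftList hi him.le hN hl hl'), rot_tree hl, map_smul,
    LinearMap.smul_apply, comp_tree (by omega) him hN hm hk hl.rot.2.1 hl'.2.1,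
    map_rot_graftList hi him hN hk hl.2.1 hl'.2.1, ← zpow_natCast, ← zpow_natCast]
  simp only [smul_smul, neg_one_zpow_mul]
  congr 1
  refine neg_one_zpow_congr ?_
  have e1 : (N : ℤ) = m + k - 1 := by omega
  rw [e1]
  push_cast
  rw [Int.even_iff]
  ring_nf
  omega

theorem AInf_rot_comp_last (hN : m + k = N + 1) {l l' : List Edge}
    (hl : TreeList m l) (hl' : TreeList k l') :
    AInf.rot N (AInf.compTo m k m N (tree m l) (tree k l'))
      = (-1 : ℚ) ^ (((m : ℤ) - 2 - l.length) * (k - 2 - l'.length)) •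
        AInf.compTo k m 1 N (AInf.rot k (tree k l')) (AInf.rot m (tree m l)) := by
  have hm := hl.1
  have hk := hl'.1
  rw [comp_tree (by omega) le_rfl hN hm hk hl.2.1 hl'.2.1, map_smul,
    rot_tree_of_valid (forall_graftList (by omega) le_rfl hN hl hl'), rot_tree hl, rot_tree hl',
    map_smul, map_smul,
    LinearMap.smul_apply, comp_tree le_rfl (by omega) (by omega) hk hm hl'.rot.2.1 hl.rot.2.1,
    map_rot_graftList_last hm hN hk hl.2.1 hl'.2.1, tree_move_block, ← zpow_natCast,
    ← zpow_natCast, ← zpow_natCast]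
  simp only [smul_smul, neg_one_zpow_mul, graftList, List.nil_append]
  congr 1
  refine neg_one_zpow_congr ?_
  have e1 : (N : ℤ) = m + k - 1 := by omega
  rw [e1]
  simp only [List.length_map]
  push_cast
  rw [Int.even_iff]
  ring_nf
  omega

theorem AInf_d_d (x : AInf.carrier n) : AInf.d n (AInf.d n x) = 0 := by
  have : AInf.d n ∘ₗ AInf.d n = 0 := by
    refine AInf_hom_ext fun l _ => ?_
    rw [LinearMap.comp_apply, d_tree, map_sum, LinearMap.zero_apply]
    simp only [d_tree]
    have h : ∑ e ∈ validEdges n, ∑ f ∈ validEdges n, tree n (f :: e :: l)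
        = - ∑ e ∈ validEdges n, ∑ f ∈ validEdges n, tree n (f :: e :: l) := by
      conv_lhs => rw [Finset.sum_comm]
      simp only [← Finset.sum_neg_distrib]
      exact Finset.sum_congr rfl fun e _ => Finset.sum_congr rfl fun f _ => tree_swap n [] e f l
    have h2 : ∀ x : AInf.carrier n, x = -x → x = 0 := fun x hx => by
      have : x = (1 / 2 : ℚ) • (x - -x) := by module
      rw [this, ← hx, sub_self, smul_zero]
    exact h2 _ h
  exact LinearMap.congr_fun this x

theorem AInf_d_rot (x : AInf.carrier n) : AInf.d n (AInf.rot n x) = AInf.rot n (AInf.d n x) := by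
  have : AInf.d n ∘ₗ AInf.rot n = AInf.rot n ∘ₗ AInf.d n := by
    refine AInf_hom_ext fun l hl => ?_
    rw [LinearMap.comp_apply, LinearMap.comp_apply, rot_tree hl, map_smul, d_tree, d_tree, map_sum,
      ← sum_rotEdge, Finset.smul_sum]
    refine Finset.sum_congr rfl fun e he => ?_
    rw [rot_tree_of_valid (List.forall_mem_cons.2 ⟨mem_validEdges.1 he, hl.2.1⟩)]
    rfl
  exact LinearMap.congr_fun this x

/-- With the given signs `A∞` is a cyclic dg operad. -/
theorem AInf_laws : AInf.Laws where
  d_mem {n p x} hx := by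
    refine AInf_deg_induction (C := fun x => AInf.d n x ∈ AInf.deg n (p - 1)) (by simp)
      (fun x y hx hy => by rw [map_add]; exact Submodule.add_mem _ hx hy)
      (fun a x hx => by rw [map_smul]; exact Submodule.smul_mem _ _ hx) ?_ hx
    rintro l hl rfl
    rw [d_tree]
    refine Submodule.sum_mem _ fun e _ => ?_
    have := tree_mem n (e :: l)
    rwa [List.length_cons, Nat.cast_add_one, ← sub_sub] at this
  rot_mem {n p x} hx := by
    refine AInf_deg_induction (C := fun x => AInf.rot n x ∈ AInf.deg n p) (by simp)
      (fun x y hx hy => by rw [map_add]; exact Submodule.add_mem _ hx hy)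
      (fun a x hx => by rw [map_smul]; exact Submodule.smul_mem _ _ hx) ?_ hx
    rintro l hl rfl
    rw [rot_tree hl]
    have := tree_mem n (l.map (rotEdge n))
    rw [List.length_map] at this
    exact Submodule.smul_mem _ _ this
  comp_mem {m n i N p q x y} hi him hN hx hy := by
    refine AInf_deg_induction (C := fun x => AInf.compTo m n i N x y ∈ AInf.deg N (p + q)) (by simp)
      (fun x y hx hy => by
        rw [map_add, LinearMap.add_apply]; exact Submodule.add_mem _ hx hy)
      (fun a x hx => by
        rw [map_smul, LinearMap.smul_apply]; exact Submodule.smul_mem _ _ hx) ?_ hx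
    rintro l hl rfl
    refine AInf_deg_induction (C := fun y => AInf.compTo m n i N (tree m l) y ∈ AInf.deg N _)
      (by simp) (fun x y hx hy => by rw [map_add]; exact Submodule.add_mem _ hx hy)
      (fun a x hx => by rw [map_smul]; exact Submodule.smul_mem _ _ hx) ?_ hy
    rintro l' hl' rfl
    rw [comp_tree hi him hN hl.1 hl'.1 hl.2.1 hl'.2.1]
    have := tree_mem N (graftList n i l l')
    rw [length_graftList] at this
    refine Submodule.smul_mem _ _ ?_
    convert this using 2
    have e1 : (N : ℤ) = m + n - 1 := by omega
    rw [e1]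
    push_cast
    ring
  d_d n x := AInf_d_d x
  d_rot n x := AInf_d_rot x
  rot_pow n := by
    refine AInf_hom_ext fun l hl => ?_
    have hmap : l.map (rotEdge n)^[n + 1] = l := by
      conv_rhs => rw [← List.map_id l]
      exact List.map_congr_left fun e he => rotEdge_iterate_succ (hl.2.1 e he)
    rw [(rot_pow_tree (n + 1) hl).1, hmap, Even.neg_one_zpow, one_smul]
    · rfl
    · exact_mod_cast Nat.even_mul_succ_self n
  d_comp {m n i N p q x y} hi him hN hx hy := by
    refine AInf_deg_induction (C := fun x => AInf.d N (AInf.compTo m n i N x y)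
      = AInf.compTo m n i N (AInf.d m x) y
        + (-1 : ℚ) ^ p • AInf.compTo m n i N x (AInf.d n y)) (by simp)
      (fun x y hx hy => by simp only [map_add, LinearMap.add_apply, hx, hy]; module)
      (fun a x hx => by simp only [map_smul, LinearMap.smul_apply, hx]; module) ?_ hx
    rintro l hl rfl
    refine AInf_deg_induction (C := fun y => AInf.d N (AInf.compTo m n i N (tree m l) y)
      = AInf.compTo m n i N (AInf.d m (tree m l)) y
        + (-1 : ℚ) ^ _ • AInf.compTo m n i N (tree m l) (AInf.d n y)) (by simp)
      (fun x y hx hy => by simp only [map_add, hx, hy]; module)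
      (fun a x hx => by simp only [map_smul, hx]; module) ?_ hy
    rintro l' hl' rfl
    exact AInf_d_comp hi him hN hl hl'
  seq {m n k i j M M' N p q r x y z} hi him hj hjn hM hM' hN hx hy hz := by
    refine AInf_deg_induction (C := fun x => AInf.compTo M k (i + j - 1) N
      (AInf.compTo m n i M x y) z = AInf.compTo m M' i N x (AInf.compTo n k j M' y z)) (by simp)
      (fun x y hx hy => by simp only [map_add, LinearMap.add_apply, hx, hy])
      (fun a x hx => by simp only [map_smul, LinearMap.smul_apply, hx]) ?_ hx
    rintro l hl rfl
    refine AInf_deg_induction (C := fun y => AInf.compTo M k (i + j - 1) N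
      (AInf.compTo m n i M (tree m l) y) z
        = AInf.compTo m M' i N (tree m l) (AInf.compTo n k j M' y z)) (by simp)
      (fun x y hx hy => by simp only [map_add, LinearMap.add_apply, hx, hy])
      (fun a x hx => by simp only [map_smul, LinearMap.smul_apply, hx]) ?_ hy
    rintro l' hl' rfl
    refine AInf_deg_induction (C := fun z => AInf.compTo M k (i + j - 1) N
      (AInf.compTo m n i M (tree m l) (tree n l')) z
        = AInf.compTo m M' i N (tree m l) (AInf.compTo n k j M' (tree n l') z)) (by simp)
      (fun x y hx hy => by simp only [map_add, hx, hy])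
      (fun a x hx => by simp only [map_smul, hx]) ?_ hz
    rintro l'' hl'' rfl
    exact AInf_seq hi him hj hjn hM hM' hN hl hl' hl''
  par {m k l i j M M' N p q r x w v} hi hij hj hM hM' hN hx hw hv := by
    refine AInf_deg_induction (C := fun x => AInf.compTo M l i N (AInf.compTo m k j M x w) v
      = (-1 : ℚ) ^ (q * r) • AInf.compTo M' k (j + l - 1) N (AInf.compTo m l i M' x v) w) (by simp)
      (fun x y hx hy => by simp only [map_add, LinearMap.add_apply, hx, hy, smul_add])
      (fun a x hx => by simp only [map_smul, LinearMap.smul_apply, hx, smul_comm a]) ?_ hx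
    rintro lx hlx rfl
    refine AInf_deg_induction (C := fun w => AInf.compTo M l i N
      (AInf.compTo m k j M (tree m lx) w) v = (-1 : ℚ) ^ (q * r) •
        AInf.compTo M' k (j + l - 1) N (AInf.compTo m l i M' (tree m lx) v) w) (by simp)
      (fun x y hx hy => by simp only [map_add, LinearMap.add_apply, hx, hy, smul_add])
      (fun a x hx => by simp only [map_smul, LinearMap.smul_apply, hx, smul_comm a]) ?_ hw
    rintro lw hlw rfl
    refine AInf_deg_induction (C := fun v => AInf.compTo M l i N
      (AInf.compTo m k j M (tree m lx) (tree k lw)) v = (-1 : ℚ) ^ (_ * r) •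
        AInf.compTo M' k (j + l - 1) N (AInf.compTo m l i M' (tree m lx) v) (tree k lw)) (by simp)
      (fun x y hx hy => by simp only [map_add, LinearMap.add_apply, hx, hy, smul_add])
      (fun a x hx => by simp only [map_smul, LinearMap.smul_apply, hx, smul_comm a]) ?_ hv
    rintro lv hlv rfl
    exact AInf_par hi hij hj hM hM' hN hlx hlw hlv
  rot_comp {m n i N p q x y} hi him hN hx hy := by
    refine AInf_deg_induction (C := fun x => AInf.rot N (AInf.compTo m n i N x y)
        = AInf.compTo m n (i + 1) N (AInf.rot m x) y) (by simp)
      (fun x y hx hy => by simp only [map_add, LinearMap.add_apply, hx, hy])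
      (fun a x hx => by simp only [map_smul, LinearMap.smul_apply, hx]) ?_ hx
    rintro l hl rfl
    refine AInf_deg_induction (C := fun y => AInf.rot N (AInf.compTo m n i N (tree m l) y)
        = AInf.compTo m n (i + 1) N (AInf.rot m (tree m l)) y) (by simp)
      (fun x y hx hy => by simp only [map_add, hx, hy])
      (fun a x hx => by simp only [map_smul, hx]) ?_ hy
    rintro l' hl' rfl
    exact AInf_rot_comp hi him hN hl hl'
  rot_comp_last {m n N p q x y} hm hN hx hy := by
    refine AInf_deg_induction (C := fun x => AInf.rot N (AInf.compTo m n m N x y)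
        = (-1 : ℚ) ^ (p * q) • AInf.compTo n m 1 N (AInf.rot n y) (AInf.rot m x)) (by simp)
      (fun x y hx hy => by simp only [map_add, LinearMap.add_apply, hx, hy, smul_add])
      (fun a x hx => by simp only [map_smul, LinearMap.smul_apply, hx, smul_comm a]) ?_ hx
    rintro l hl rfl
    refine AInf_deg_induction (C := fun y => AInf.rot N (AInf.compTo m n m N (tree m l) y)
        = (-1 : ℚ) ^ (_ * q) • AInf.compTo n m 1 N (AInf.rot n y) (AInf.rot m (tree m l)))
      (by simp) (fun x y hx hy => by simp only [map_add, LinearMap.add_apply, hx, hy, smul_add])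
      (fun a x hx => by simp only [map_smul, LinearMap.smul_apply, hx, smul_comm a]) ?_ hy
    rintro l' hl' rfl
    exact AInf_rot_comp_last hN hl hl'

end Laws

/-! ### Contractibility of the associahedra -/

section Contraction

variable {n : ℕ}

/-- Lists of edges with the same elements represent the same oriented tree up to a sign, which does
not change when further edges are put in front. -/
theorem exists_sign_of_perm {l l' : List Edge} (h : l.Perm l') (hn : l.Nodup) :
    ∃ ε : ℚ, ∀ n A, tree n (A ++ l) = ε • tree n (A ++ l') := by
  refine ⟨(-1) ^ inversions l * (-1) ^ inversions l', fun n A => ?_⟩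
  rw [mul_smul, ← perm_of_swap (tree n) (tree_swap n) h hn A, smul_smul, ← mul_pow]
  simp

/-- `IsMatch n l e`: the vertices on the path from the root of the tree `l` to its last leaf `n` are
the edges `{a, …, n}`.  The edge `e = {j, …, b}` is the one which joins all inputs except the
last one of the first vertex on this path which is not of the form `(leaf, subtree)`.  Adding and
removing `e` is a perfect matching on all trees except the right comb. -/
def IsMatch (n : ℕ) (l : List Edge) (e : Edge) : Prop :=
  1 ≤ fstLeaf e ∧ fstLeaf e < lstLeaf e ∧ lstLeaf e < n ∧
  (∀ a, 2 ≤ a → a ≤ fstLeaf e → edge a n ∈ l) ∧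
  (∀ a, fstLeaf e < a → a ≤ lstLeaf e → edge a n ∉ l) ∧
  (lstLeaf e + 1 = n ∨ edge (lstLeaf e + 1) n ∈ l)

/-- The tree `l` is the right comb: every vertex has two inputs, the first of which is a leaf. -/
def IsComb (n : ℕ) (l : List Edge) : Prop := ∀ a, 2 ≤ a → a < n → edge a n ∈ l

theorem exists_isMatch {l : List Edge} (h : ¬ IsComb n l) : ∃ e, IsMatch n l e := by
  unfold IsComb at h
  push Not at h
  classical
  have hc := Nat.find_spec h
  have hmin := fun a => Nat.find_min h (m := a)
  set c := Nat.find h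
  have hx : ∃ x, c < x ∧ (x = n ∨ edge x n ∈ l) := ⟨n, hc.2.1, Or.inl rfl⟩
  have hb := Nat.find_spec hx
  have hbmin := fun a => Nat.find_min hx (m := a)
  have hbn : Nat.find hx ≤ n := Nat.find_min' hx ⟨hc.2.1, Or.inl rfl⟩
  set b := Nat.find hx
  refine ⟨edge (c - 1) (b - 1), ?_⟩
  simp only [IsMatch, fstLeaf_edge, lstLeaf_edge]
  refine ⟨by omega, by omega, by omega, fun a h2 ha => ?_, fun a h1 h2 => ?_, ?_⟩
  · by_contra hne
    exact hmin a (by omega) ⟨h2, by omega, hne⟩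
  · rcases (show a = c ∨ c < a by omega) with rfl | hca
    · exact hc.2.2
    · intro hmem
      exact hbmin a (by omega) ⟨hca, Or.inr hmem⟩
  · rw [Nat.sub_add_cancel (by omega)]
    exact hb.2

theorem IsMatch.unique {l : List Edge} {e f : Edge} (he : IsMatch n l e) (hf : IsMatch n l f) :
    e = f := by
  obtain ⟨h1, h2, h3, h4, h5, h6⟩ := he
  obtain ⟨g1, g2, g3, g4, g5, g6⟩ := hf
  have hj : fstLeaf e = fstLeaf f := by
    rcases lt_trichotomy (fstLeaf e) (fstLeaf f) with h | h | h
    · exact absurd (g4 (fstLeaf e + 1) (by omega) h) (h5 _ (by omega) (by omega))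
    · exact h
    · exact absurd (h4 (fstLeaf f + 1) (by omega) h) (g5 _ (by omega) (by omega))
  refine edge_ext hj ?_
  rcases lt_trichotomy (lstLeaf e) (lstLeaf f) with h | h | h
  · exact absurd (h6.resolve_left (by omega)) (g5 _ (by omega) (by omega))
  · exact h
  · exact absurd (g6.resolve_left (by omega)) (h5 _ (by omega) (by omega))

theorem IsMatch.congr {l l' : List Edge} {e : Edge} (he : IsMatch n l e)
    (h : ∀ a, edge a n ∈ l ↔ edge a n ∈ l') : IsMatch n l' e := by
  unfold IsMatch at *
  simpa only [h] using he

theorem IsMatch.not_isComb {l : List Edge} {e : Edge} (he : IsMatch n l e) : ¬ IsComb n l :=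
  fun h => he.2.2.2.2.1 (fstLeaf e + 1) (by omega) he.2.1
    (h _ (by have := he.1; omega) (by have := he.2.1; have := he.2.2.1; omega))

theorem IsMatch.valid {l : List Edge} {e : Edge} (he : IsMatch n l e) : ValidEdge n e := by
  obtain ⟨h1, h2, h3, -⟩ := he
  unfold ValidEdge; omega

theorem edge_mem_cons {a : ℕ} {e : Edge} {l : List Edge} (he : lstLeaf e ≠ n) :
    edge a n ∈ l ↔ edge a n ∈ e :: l := by
  rw [List.mem_cons]
  constructor
  · exact Or.inr
  · rintro (rfl | h)
    · exact absurd rfl he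
    · exact h

/-- The matched edge can always be added. -/
theorem IsMatch.treeList_cons {l : List Edge} {e : Edge} (he : IsMatch n l e)
    (hl : TreeList n l) (hel : e ∉ l) : TreeList n (e :: l) := by
  refine ⟨hl.1, List.forall_mem_cons.2 ⟨he.valid, hl.2.1⟩, List.pairwise_cons.2 ⟨?_, hl.2.2⟩⟩
  intro f hf
  have hfv := hl.2.1 f hf
  have hne : e ≠ f := by rintro rfl; exact hel hf
  have hall : ∀ g ∈ l, f ≠ g → Indep f g := fun g hg => hl.indep hf hg
  obtain ⟨h1, h2, h3, h4, h5, h6⟩ := he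
  rw [edge_ne_iff] at hne
  by_cases hfn : lstLeaf f = n
  · have hfe : f = edge (fstLeaf f) n := edge_ext rfl hfn
    have : fstLeaf f ≤ fstLeaf e ∨ lstLeaf e < fstLeaf f := by
      by_contra hcon
      rw [hfe] at hf
      exact h5 (fstLeaf f) (by omega) (by omega) hf
    unfold Indep ValidEdge at *
    omega
  · have e1 : fstLeaf e = 1 ∨ Indep f (edge (fstLeaf e) n) := by
      by_cases h : fstLeaf e = 1
      · exact Or.inl h
      · refine Or.inr (hall _ (h4 _ (by omega) le_rfl) ?_)
        rintro rfl
        exact hfn rfl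
    have e2 : lstLeaf e + 1 = n ∨ Indep f (edge (lstLeaf e + 1) n) := by
      rcases h6 with h | h
      · exact Or.inl h
      · refine Or.inr (hall _ h ?_)
        rintro rfl
        exact hfn rfl
    unfold Indep ValidEdge at *
    simp only [fstLeaf_edge, lstLeaf_edge] at *
    omega

/-- The right comb has no other edges than those which define it. -/
theorem IsComb.last {l : List Edge} (h : IsComb n l) (hl : TreeList n l) {f : Edge} (hf : f ∈ l) :
    lstLeaf f = n := by
  by_contra hne
  have hfv := hl.2.1 f hf
  have := hl.indep hf (h (lstLeaf f) (by unfold ValidEdge at hfv; omega)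
    (by unfold ValidEdge at hfv; omega)) (by rintro h'; rw [h'] at hne; exact hne rfl)
  unfold Indep ValidEdge at *
  simp only [fstLeaf_edge, lstLeaf_edge] at *
  omega

theorem IsComb.tree_mem {l : List Edge} (h : IsComb n l) (hl : TreeList n l) :
    tree n l ∈ AInf.deg n 0 := by
  have hs : l.toFinset = (Finset.Ico 2 n).image (fun a => edge a n) := by
    ext f
    rw [List.mem_toFinset, Finset.mem_image]
    constructor
    · intro hf
      have h1 := h.last hl hf
      have h2 := hl.2.1 f hf
      unfold ValidEdge at h2
      exact ⟨fstLeaf f, by rw [Finset.mem_Ico]; omega, edge_ext rfl h1.symm⟩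
    · rintro ⟨a, ha, rfl⟩
      rw [Finset.mem_Ico] at ha
      exact h a ha.1 ha.2
  have hc := congrArg Finset.card hs
  rw [List.toFinset_card_of_nodup hl.nodup, Finset.card_image_of_injective _ (fun a b hab => by
    simpa using congrArg fstLeaf hab), Nat.card_Ico] at hc
  have := CyclicOperad.tree_mem n l
  have h2 := hl.1
  have e : (n : ℤ) - 2 - l.length = 0 := by omega
  rwa [e] at this

theorem IsComb.d_tree {l : List Edge} (h : IsComb n l) :
    AInf.d n (tree n l) = 0 := by
  rw [CyclicOperad.d_tree]
  refine Finset.sum_eq_zero fun e _ => tree_of_not fun he => ?_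
  have h' : IsComb n (e :: l) := fun a h1 h2 => List.mem_cons_of_mem _ (h a h1 h2)
  have h1 := h'.last he (List.mem_cons_self)
  have h2 := he.2.1 e (List.mem_cons_self)
  have h3 : e ∈ l := by
    have : e = edge (fstLeaf e) n := edge_ext rfl h1
    rw [this]
    refine h _ ?_ ?_ <;> unfold ValidEdge at h2 <;> omega
  exact (List.nodup_cons.1 he.nodup).1 h3

open Classical in
/-- The operator which removes the matched edge of a tree, and vanishes on trees which do not
contain it. -/
noncomputable def unmatch (n : ℕ) : AInf.carrier n →ₗ[ℚ] AInf.carrier n :=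
  Finsupp.linearCombination ℚ fun T : Tree n =>
    if h : ∃ e ∈ T.edges, IsMatch n T.edges e then
      (-1 : ℚ) ^ inversions (h.choose :: T.edges.erase h.choose) •
        tree n (T.edges.erase h.choose)
    else 0

theorem exists_edges_perm {l : List Edge} (hl : TreeList n l) :
    ∃ T : Tree n, T.edges.Perm l :=
  ⟨⟨l.toFinset, (treeList_iff.1 hl).2⟩,
    (Finset.sort_perm_toList _ _).trans (List.toFinset_toList hl.nodup)⟩

theorem unmatch_single (T : Tree n) : unmatch n (tree n T.edges) =
    open Classical in
    if h : ∃ e ∈ T.edges, IsMatch n T.edges e then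
      (-1 : ℚ) ^ inversions (h.choose :: T.edges.erase h.choose) •
        tree n (T.edges.erase h.choose)
    else 0 := by
  have h : tree n T.edges = Finsupp.single T (1 : ℚ) := oriented_edges T
  rw [h]
  refine (Finsupp.linearCombination_single ℚ _ _).trans ?_
  rw [one_smul]

theorem unmatch_tree_cons {e : Edge} {l : List Edge} (hl : TreeList n (e :: l))
    (he : IsMatch n (e :: l) e) : unmatch n (tree n (e :: l)) = tree n l := by
  obtain ⟨T, hT⟩ := exists_edges_perm hl
  have heT : e ∈ T.edges := hT.mem_iff.2 (List.mem_cons_self)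
  have hmT : IsMatch n T.edges e := he.congr fun a => hT.mem_iff.symm
  have hex : ∃ e ∈ T.edges, IsMatch n T.edges e := ⟨e, heT, hmT⟩
  have hc : hex.choose = e := hex.choose_spec.2.unique hmT
  have hperm : l.Perm (T.edges.erase e) := by
    have := hT.symm.erase e
    rwa [List.erase_cons_head] at this
  obtain ⟨ε, hε⟩ := exists_sign_of_perm hperm (List.nodup_cons.1 hl.nodup).2
  have h1 := perm_of_swap (tree n) (tree_swap n) (List.perm_cons_erase heT)
    (hl.perm hT.symm).nodup []
  simp only [List.nil_append] at h1
  rw [inversions_of_pairwise (l := T.edges) (Finset.pairwise_sort _ _), pow_zero, one_smul] at h1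
  have h2 : tree n (e :: T.edges.erase e)
      = (-1 : ℚ) ^ inversions (e :: T.edges.erase e) • tree n T.edges := by
    rw [h1, smul_smul, ← mul_pow]; simp
  have h3 := unmatch_single T
  rw [dif_pos hex, hc] at h3
  have h4 := hε n [e]
  have h5 := hε n []
  simp only [List.nil_append, List.cons_append] at h4 h5
  rw [h4, h5, map_smul, h2, map_smul, h3, smul_smul ((-1) ^ _), ← mul_pow]
  simp

theorem unmatch_tree_of_not {l : List Edge} (hl : TreeList n l)
    (he : ∀ e ∈ l, ¬ IsMatch n l e) : unmatch n (tree n l) = 0 := by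
  obtain ⟨T, hT⟩ := exists_edges_perm hl
  obtain ⟨ε, hε⟩ := exists_sign_of_perm hT.symm hl.nodup
  have := hε n []
  simp only [List.nil_append] at this
  rw [this, map_smul, unmatch_single, dif_neg, smul_zero]
  rintro ⟨e, he', hm⟩
  exact he e (hT.mem_iff.1 he') (hm.congr fun a => hT.mem_iff)

/-- The span of the right comb and of the trees with at least `k` internal edges on the path from
the root to the last leaf. -/
noncomputable def spineFiltration (n k : ℕ) : Submodule ℚ (AInf.carrier n) :=
  Submodule.span ℚ {x | ∃ l, TreeList n l ∧
    (IsComb n l ∨ k ≤ l.countP (fun e => lstLeaf e = n)) ∧ x = tree n l}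

theorem tree_mem_spineFiltration {k : ℕ} {l : List Edge}
    (h : TreeList n l → IsComb n l ∨ k ≤ l.countP (fun e => lstLeaf e = n)) :
    tree n l ∈ spineFiltration n k := by
  by_cases hl : TreeList n l
  · exact Submodule.subset_span ⟨l, hl, h hl, rfl⟩
  · rw [tree_of_not hl]; exact Submodule.zero_mem _

theorem unmatch_mem {k : ℕ} {l : List Edge} (h : k ≤ l.countP (fun e => lstLeaf e = n)) :
    unmatch n (tree n l) ∈ spineFiltration n k := by
  by_cases hl : TreeList n l
  · by_cases hex : ∃ e ∈ l, IsMatch n l e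
    · obtain ⟨e, he, hm⟩ := hex
      have hp := List.perm_cons_erase he
      obtain ⟨ε, hε⟩ := exists_sign_of_perm hp hl.nodup
      have := hε n []
      simp only [List.nil_append] at this
      rw [this, map_smul, unmatch_tree_cons (hl.perm hp) (hm.congr fun a => hp.mem_iff)]
      refine Submodule.smul_mem _ _ (tree_mem_spineFiltration fun _ => Or.inr ?_)
      rw [hp.countP_eq, List.countP_cons_of_neg] at h
      · exact h
      · have := hm.2.2.1
        simp only [decide_eq_true_eq]
        omega
    · push Not at hex
      rw [unmatch_tree_of_not hl hex]; exact Submodule.zero_mem _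
  · rw [tree_of_not hl, map_zero]; exact Submodule.zero_mem _

/-- The chain map `1 - (ds + sd)`, where `s` is `unmatch`. -/
noncomputable def flow (n : ℕ) : Module.End ℚ (AInf.carrier n) :=
  1 - (AInf.d n ∘ₗ unmatch n + unmatch n ∘ₗ AInf.d n)

theorem flow_apply (x : AInf.carrier n) :
    flow n x = x - (AInf.d n (unmatch n x) + unmatch n (AInf.d n x)) := rfl

theorem flow_comb {l : List Edge} (h : IsComb n l) (hl : TreeList n l) :
    flow n (tree n l) = tree n l := by
  rw [flow_apply, h.d_tree, unmatch_tree_of_not hl (fun e _ he => he.not_isComb h), map_zero,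
    map_zero, add_zero, sub_zero]

/-- On a tree other than the right comb, the flow cancels the tree itself, because exactly one of
`ds` and `sd` returns it, by removing and adding the matched edge.  The remaining terms with the
same number of edges on the path to the last leaf cancel or vanish, since those edges determine the
matched edge. -/
theorem flow_tree_mem {l : List Edge} (hl : TreeList n l) (hc : ¬ IsComb n l) :
    flow n (tree n l) ∈ spineFiltration n (l.countP (fun e => lstLeaf e = n) + 1) := by
  obtain ⟨e, he⟩ := exists_isMatch hc
  have hev := mem_validEdges.2 he.valid
  have hen : lstLeaf e ≠ n := he.2.2.1.ne
  by_cases hel : e ∈ l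
  · have hp := List.perm_cons_erase hel
    obtain ⟨ε, hε⟩ := exists_sign_of_perm hp hl.nodup
    have hε' := hε n []
    simp only [List.nil_append] at hε'
    rw [hε', map_smul, hp.countP_eq]
    refine Submodule.smul_mem _ _ ?_
    have hl' := hl.perm hp
    have he' : IsMatch n (e :: l.erase e) e := he.congr fun a => hp.mem_iff
    generalize l.erase e = l₀ at hl' he'
    rw [flow_apply, unmatch_tree_cons hl' he', d_tree, d_tree, map_sum, ← Finset.sum_add_distrib,
      ← Finset.add_sum_erase _ _ hev]
    have h0 : tree n (e :: e :: l₀) = 0 := tree_of_not fun h => by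
      have := h.nodup; simp at this
    rw [h0, map_zero, add_zero, sub_add_cancel_left]
    refine Submodule.neg_mem _ (Submodule.sum_mem _ fun f hf => ?_)
    rw [Finset.mem_erase] at hf
    rw [List.countP_cons_of_neg (by simpa using hen)]
    by_cases hfn : lstLeaf f = n
    · refine Submodule.add_mem _ (tree_mem_spineFiltration fun _ => Or.inr ?_) (unmatch_mem ?_)
      · rw [List.countP_cons_of_pos (by simpa using hfn)]
      · rw [List.countP_cons_of_pos (by simpa using hfn),
          List.countP_cons_of_neg (by simpa using hen)]
    · have hsw : tree n (f :: e :: l₀) = - tree n (e :: f :: l₀) := tree_swap n [] f e l₀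
      have hm : IsMatch n (e :: f :: l₀) e := he'.congr fun a => by
        rw [← edge_mem_cons hen, ← edge_mem_cons hen, ← edge_mem_cons hfn]
      by_cases ht : TreeList n (e :: f :: l₀)
      · rw [hsw, map_neg, unmatch_tree_cons ht hm, add_neg_cancel]
        exact Submodule.zero_mem _
      · have hm' : IsMatch n (f :: l₀) e := hm.congr fun a => (edge_mem_cons hen).symm
        have : ¬ TreeList n (f :: l₀) := fun h => ht (hm'.treeList_cons h (by
          rw [List.mem_cons, not_or]
          exact ⟨hf.1.symm, (List.nodup_cons.1 hl'.nodup).1⟩))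
        rw [hsw, tree_of_not ht, tree_of_not this, neg_zero, map_zero, add_zero]
        exact Submodule.zero_mem _
  · have h0 : unmatch n (tree n l) = 0 := unmatch_tree_of_not hl fun f hf hm =>
      hel (he.unique hm ▸ hf)
    have hme : IsMatch n (e :: l) e := he.congr fun a => edge_mem_cons hen
    rw [flow_apply, h0, map_zero, zero_add, d_tree, map_sum, ← Finset.add_sum_erase _ _ hev,
      unmatch_tree_cons (he.treeList_cons hl hel) hme, sub_add_cancel_left]
    refine Submodule.neg_mem _ (Submodule.sum_mem _ fun f hf => ?_)
    rw [Finset.mem_erase] at hf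
    by_cases hfn : lstLeaf f = n
    · refine unmatch_mem ?_
      rw [List.countP_cons_of_pos (by simpa using hfn)]
    · by_cases ht : TreeList n (f :: l)
      · rw [unmatch_tree_of_not ht]
        · exact Submodule.zero_mem _
        · intro g hg hm
          have : IsMatch n (f :: l) e := he.congr fun a => edge_mem_cons hfn
          rw [← this.unique hm, List.mem_cons] at hg
          rcases hg with hg | hg
          · exact hf.1 hg.symm
          · exact hel hg
      · rw [tree_of_not ht, map_zero]; exact Submodule.zero_mem _

theorem flow_mem_spineFiltration {k : ℕ} {x : AInf.carrier n} (hx : x ∈ spineFiltration n k) :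
    flow n x ∈ spineFiltration n (k + 1) := by
  refine Submodule.span_induction (p := fun x _ => flow n x ∈ spineFiltration n (k + 1)) ?_
    (by simp) (fun x y _ _ hx hy => by rw [map_add]; exact Submodule.add_mem _ hx hy)
    (fun a x _ hx => by rw [map_smul]; exact Submodule.smul_mem _ _ hx) hx
  rintro _ ⟨l, hl, h, rfl⟩
  by_cases hc : IsComb n l
  · rw [flow_comb hc hl]
    exact tree_mem_spineFiltration fun _ => Or.inl hc
  · refine Submodule.span_mono ?_ (flow_tree_mem hl hc)
    rintro _ ⟨l', hl', h', rfl⟩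
    refine ⟨l', hl', h'.imp id fun h' => ?_, rfl⟩
    have := h.resolve_left hc
    omega

theorem flow_pow_mem (k : ℕ) (x : AInf.carrier n) : (flow n ^ k) x ∈ spineFiltration n k := by
  induction k with
  | zero =>
    have : (LinearMap.id : AInf.carrier n →ₗ[ℚ] _).range ≤ spineFiltration n 0 := by
      have h : (spineFiltration n 0).mkQ = 0 := AInf_hom_ext fun l hl => by
        rw [LinearMap.zero_apply, Submodule.mkQ_apply, Submodule.Quotient.mk_eq_zero]
        exact tree_mem_spineFiltration fun _ => Or.inr (Nat.zero_le _)
      rw [LinearMap.range_le_iff_comap, eq_top_iff]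
      intro x _
      have := LinearMap.congr_fun h x
      rwa [LinearMap.zero_apply, Submodule.mkQ_apply, Submodule.Quotient.mk_eq_zero] at this
    exact this ⟨x, rfl⟩
  | succ k ih =>
    rw [pow_succ', Module.End.mul_apply]
    exact flow_mem_spineFiltration ih

/-- There are fewer edges than the index of the filtration, so only the right comb is left. -/
theorem spineFiltration_le :
    spineFiltration n ((validEdges n).card + 1) ≤ AInf.deg n 0 ⊓ LinearMap.ker (AInf.d n) := by
  refine Submodule.span_le.2 ?_
  rintro _ ⟨l, hl, h, rfl⟩
  have hc : IsComb n l := by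
    refine h.resolve_right fun h => ?_
    have h1 : l.countP (fun e => lstLeaf e = n) ≤ l.length := List.countP_le_length
    have h2 : l.length ≤ (validEdges n).card := by
      rw [← List.toFinset_card_of_nodup hl.nodup]
      refine Finset.card_le_card fun e he => ?_
      exact mem_validEdges.2 (hl.2.1 e (List.mem_toFinset.1 he))
    omega
  exact ⟨hc.tree_mem hl, hc.d_tree⟩

/-- A contracting homotopy `s` of a complex onto its part of degree zero, with
`ds + sd = 1 - π`. -/
structure OpData.Contraction (O : OpData) (n : ℕ) where
  /-- the homotopy -/
  s : O.carrier n →ₗ[ℚ] O.carrier n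
  /-- the projection to degree zero -/
  proj : O.carrier n →ₗ[ℚ] O.carrier n
  s_mem : ∀ {p x}, x ∈ O.deg n p → s x ∈ O.deg n (p + 1)
  proj_mem : ∀ x, proj x ∈ O.deg n 0
  proj_eq_zero : ∀ {p x}, x ∈ O.deg n p → p ≠ 0 → proj x = 0
  d_proj : ∀ x, O.d n (proj x) = 0
  homotopy : ∀ x, O.d n (s x) + s (O.d n x) = x - proj x

theorem unmatch_deg {p : ℤ} {x : AInf.carrier n} (hx : x ∈ AInf.deg n p) :
    unmatch n x ∈ AInf.deg n (p + 1) := by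
  refine AInf_deg_induction (C := fun x => unmatch n x ∈ AInf.deg n (p + 1)) (by simp)
      (fun x y hx hy => by rw [map_add]; exact Submodule.add_mem _ hx hy)
      (fun a x hx => by rw [map_smul]; exact Submodule.smul_mem _ _ hx) ?_ hx
  rintro l hl rfl
  by_cases hex : ∃ e ∈ l, IsMatch n l e
  · obtain ⟨e, he, hm⟩ := hex
    have hp := List.perm_cons_erase he
    obtain ⟨ε, hε⟩ := exists_sign_of_perm hp hl.nodup
    have := hε n []
    simp only [List.nil_append] at this
    rw [this, map_smul, unmatch_tree_cons (hl.perm hp) (hm.congr fun a => hp.mem_iff)]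
    have h1 := tree_mem n (l.erase e)
    have h2 := hp.length_eq
    rw [List.length_cons] at h2
    rw [h2]
    push_cast
    rw [show (n : ℤ) - 2 - ((l.erase e).length + 1) + 1 = n - 2 - (l.erase e).length by ring]
    exact Submodule.smul_mem _ _ h1
  · push Not at hex
    rw [unmatch_tree_of_not hl hex]; exact Submodule.zero_mem _

theorem flow_pow_deg (k : ℕ) {p : ℤ} {x : AInf.carrier n} (hx : x ∈ AInf.deg n p) :
    (flow n ^ k) x ∈ AInf.deg n p := by
  induction k with
  | zero => exact hx
  | succ k ih =>
    rw [pow_succ', Module.End.mul_apply, flow_apply]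
    refine Submodule.sub_mem _ ih (Submodule.add_mem _ ?_ ?_)
    · have := AInf_laws.d_mem (unmatch_deg ih)
      rwa [add_sub_cancel_right] at this
    · have := unmatch_deg (AInf_laws.d_mem ih)
      rwa [sub_add_cancel] at this

theorem AInf_deg_disjoint {p q : ℤ} (h : p ≠ q) {x : AInf.carrier n} (hp : x ∈ AInf.deg n p)
    (hq : x ∈ AInf.deg n q) : x = 0 := by
  have hd : Disjoint {T : Tree n | T.degree = p} {T : Tree n | T.degree = q} := by
    rw [Set.disjoint_left]
    rintro T rfl hT
    exact h hT
  exact Submodule.disjoint_def.1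
    ((Finsupp.disjoint_supported_supported_iff (M := ℚ) (R := ℚ)).2 hd) x hp hq

/-- The complex `A∞(n)` is contractible: a power of the flow pushes every tree to the right comb,
and the homotopies of the single steps add up to a geometric series. -/
noncomputable def AInfContraction (n : ℕ) : AInf.Contraction n where
  s := unmatch n ∘ₗ ∑ k ∈ Finset.range ((validEdges n).card + 1), flow n ^ k
  proj := flow n ^ ((validEdges n).card + 1)
  s_mem hx := by
    rw [LinearMap.comp_apply, LinearMap.sum_apply]
    exact unmatch_deg (Submodule.sum_mem _ fun k _ => flow_pow_deg k hx)
  proj_mem x := (spineFiltration_le (flow_pow_mem _ x)).1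
  proj_eq_zero hx hp :=
    AInf_deg_disjoint hp (flow_pow_deg _ hx) (spineFiltration_le (flow_pow_mem _ _)).1
  d_proj x := (spineFiltration_le (flow_pow_mem _ x)).2
  homotopy x := by
    have hcomm : Commute (AInf.d n : Module.End ℚ (AInf.carrier n)) (flow n) := by
      refine LinearMap.ext fun x => ?_
      rw [Module.End.mul_apply, Module.End.mul_apply, flow_apply, flow_apply, map_sub, map_add,
        AInf_d_d, AInf_d_d, zero_add, map_zero, add_zero]
    have hcomm' := Commute.sum_right (Finset.range ((validEdges n).card + 1))
      (fun k => flow n ^ k) _ (fun k _ => hcomm.pow_right k)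
    have h1 := mul_neg_geom_sum (flow n) ((validEdges n).card + 1)
    set S := ∑ k ∈ Finset.range ((validEdges n).card + 1), flow n ^ k
    have h2 := LinearMap.congr_fun hcomm'.eq x
    rw [Module.End.mul_apply, Module.End.mul_apply] at h2
    have h3 := LinearMap.congr_fun h1 x
    rw [Module.End.mul_apply, LinearMap.sub_apply, LinearMap.sub_apply, flow_apply,
      Module.End.one_apply, Module.End.one_apply, sub_sub_cancel] at h3
    rw [LinearMap.comp_apply, LinearMap.comp_apply, ← h2]
    exact h3

end Contraction

/-! ### Homology of a tensor product of contractible complexes -/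

section TensorContraction

variable {O P : OpData} {n : ℕ}

theorem OpData.Contraction.proj_d (hO : O.Laws) (c : O.Contraction n) (x : O.carrier n) :
    c.proj (O.d n x) = 0 := by
  have h1 := c.homotopy (O.d n x)
  have h2 := congrArg (O.d n) (c.homotopy x)
  rw [hO.d_d, map_zero, add_zero] at h1
  rw [map_add, hO.d_d, zero_add, map_sub, c.d_proj, sub_zero] at h2
  rw [h2] at h1
  exact (sub_eq_self.1 h1.symm)

theorem OpData.Contraction.s_sgn (c : O.Contraction n) (x : O.carrier n) :
    c.s (O.sgn n x) = - O.sgn n (c.s x) := by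
  have : c.s ∘ₗ O.sgn n = - (O.sgn n ∘ₗ c.s) := by
    refine O.hom_ext fun p x hx => ?_
    simp only [LinearMap.comp_apply, LinearMap.neg_apply]
    rw [O.sgn_of_mem n p x hx, O.sgn_of_mem n _ _ (c.s_mem hx), map_smul,
      zpow_add_one₀ (by norm_num)]
    simp
  exact LinearMap.congr_fun this x

theorem OpData.Contraction.sgn_proj (c : O.Contraction n) (x : O.carrier n) :
    O.sgn n (c.proj x) = c.proj x := by
  rw [O.sgn_of_mem n 0 _ (c.proj_mem x), zpow_zero, one_smul]

theorem OpData.Contraction.proj_sgn (c : O.Contraction n) (x : O.carrier n) :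
    c.proj (O.sgn n x) = c.proj x := by
  have : c.proj ∘ₗ O.sgn n = c.proj := by
    refine O.hom_ext fun p x hx => ?_
    rw [LinearMap.comp_apply, O.sgn_of_mem n p x hx, map_smul]
    by_cases hp : p = 0
    · rw [hp, zpow_zero, one_smul]
    · rw [c.proj_eq_zero hx hp, smul_zero]
  exact LinearMap.congr_fun this x

/-- The tensor product of two contractible complexes has no homology outside degree zero. -/
theorem exists_d_eq_of_contraction (hO : O.Laws) (c : O.Contraction n)
    (c' : P.Contraction n) {p : ℤ} (hp : p ≠ 0) {z : (tensor O P).carrier n}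
    (hz : z ∈ (tensor O P).deg n p) (hdz : (tensor O P).d n z = 0) :
    ∃ w ∈ (tensor O P).deg n (p + 1), (tensor O P).d n w = z := by
  let S : (tensor O P).carrier n →ₗ[ℚ] (tensor O P).carrier n :=
    TensorProduct.map c.s LinearMap.id + TensorProduct.map c.proj c'.s
  let R : (tensor O P).carrier n →ₗ[ℚ] (tensor O P).carrier n :=
    TensorProduct.map c.proj c'.proj
  have hS : ∀ a b, S (tm a b) = tm (c.s a) b + tm (c.proj a) (c'.s b) := fun _ _ => rfl
  have hR : ∀ a b, R (tm a b) = tm (c.proj a) (c'.proj b) := fun _ _ => rfl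
  have key : (tensor O P).d n ∘ₗ S + S ∘ₗ (tensor O P).d n = LinearMap.id - R := by
    refine tensor_hom_ext fun a b => ?_
    have h1 := c.homotopy a
    have h2 := c'.homotopy b
    have e1 : a = c.proj a + (O.d n (c.s a) + c.s (O.d n a)) := by rw [h1]; abel
    have e2 : b = c'.proj b + (P.d n (c'.s b) + c'.s (P.d n b)) := by rw [h2]; abel
    simp only [LinearMap.add_apply, LinearMap.comp_apply, LinearMap.sub_apply, LinearMap.id_apply]
    rw [hS, hR, map_add, d_tm', d_tm', d_tm', map_add, hS, hS, c.d_proj, c.proj_d hO, c.s_sgn,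
      c.sgn_proj, c.proj_sgn]
    have e3 : tm a b = tm (c.proj a) b + (tm (O.d n (c.s a)) b + tm (c.s (O.d n a)) b) := by
      conv_lhs => rw [e1]
      simp only [map_add, LinearMap.add_apply]
    have e4 : tm (c.proj a) b = tm (c.proj a) (c'.proj b)
        + (tm (c.proj a) (P.d n (c'.s b)) + tm (c.proj a) (c'.s (P.d n b))) := by
      conv_lhs => rw [e2]
      simp only [map_add]
    rw [e3, e4]
    simp only [map_zero, LinearMap.zero_apply, map_neg, LinearMap.neg_apply]
    abel
  have hSz : S z ∈ (tensor O P).deg n (p + 1) := by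
    refine tensor_deg_induction (C := fun x => S x ∈ (tensor O P).deg n (p + 1)) (by simp)
      (fun x y hx hy => by rw [map_add]; exact Submodule.add_mem _ hx hy) ?_ hz
    intro q r a b h ha hb
    rw [hS]
    refine Submodule.add_mem _ (tm_mem (c.s_mem ha) hb (by omega)) ?_
    by_cases hq : q = 0
    · exact tm_mem (c.proj_mem a) (c'.s_mem hb) (by omega)
    · rw [c.proj_eq_zero ha hq, map_zero]; exact Submodule.zero_mem _
  have hRz : R z = 0 := by
    refine tensor_deg_induction (C := fun x => R x = 0) (by simp)
      (fun x y hx hy => by rw [map_add, hx, hy, add_zero]) ?_ hz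
    intro q r a b h ha hb
    rw [hR]
    by_cases hq : q = 0
    · rw [c'.proj_eq_zero hb (by omega), map_zero]
    · rw [c.proj_eq_zero ha hq, map_zero, LinearMap.zero_apply]
  refine ⟨S z, hSz, ?_⟩
  have := LinearMap.congr_fun key z
  simpa [hdz, hRz] using this

end TensorContraction

/-! ### Filling boundaries relative to the end points of the interval -/

section Integration

open Polynomial

/-- The primitive of a polynomial which vanishes at `0`. -/
noncomputable def primitive : ℚ[X] →ₗ[ℚ] ℚ[X] :=
  Polynomial.lsum fun k => ((1 : ℚ) / (k + 1)) • Polynomial.monomial (k + 1)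

theorem primitive_monomial (k : ℕ) (a : ℚ) :
    primitive (monomial k a) = monomial (k + 1) (1 / (k + 1) * a) := by
  simp [primitive, Polynomial.lsum_apply, Polynomial.sum_monomial_index, smul_monomial]

theorem derivative_primitive (f : ℚ[X]) : derivative (primitive f) = f := by
  induction f using Polynomial.induction_on' with
  | add p q hp hq => rw [map_add, map_add, hp, hq]
  | monomial k a =>
    rw [primitive_monomial, derivative_monomial]
    have : (k : ℚ) + 1 ≠ 0 := by positivity
    congr 1
    push_cast
    field_simp

theorem eval_zero_primitive (f : ℚ[X]) : (primitive f).eval 0 = 0 := by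
  induction f using Polynomial.induction_on' with
  | add p q hp hq => rw [map_add, eval_add, hp, hq, add_zero]
  | monomial k a => rw [primitive_monomial, eval_monomial]; simp

theorem primitive_derivative (f : ℚ[X]) : primitive (derivative f) = f - C (f.eval 0) := by
  have h : derivative (primitive (derivative f) - f) = 0 := by
    rw [derivative_sub, derivative_primitive, sub_self]
  have h2 := eq_C_of_natDegree_eq_zero (Polynomial.derivative_eq_zero.1 h)
  have h3 := congrArg (eval 0) h2
  rw [eval_sub, eval_zero_primitive, eval_C] at h3
  rw [← h3] at h2
  rw [eq_add_of_sub_eq h2]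
  simp only [zero_sub, map_neg]
  ring

/-- The integral of a one-form over the interval. -/
noncomputable def integral : ℚ[X] →ₗ[ℚ] ℚ := Polynomial.leval 1 ∘ₗ primitive

theorem integral_derivative (f : ℚ[X]) : integral (derivative f) = f.eval 1 - f.eval 0 := by
  simp [integral, primitive_derivative, Polynomial.leval]

/-- The homotopy `f + g dt ↦ ∫₀ᵗ g - t ∫₀¹ g`, with values in the functions that vanish at both end
points. -/
noncomputable def formsHomotopy : Forms →ₗ[ℚ] Forms :=
  LinearMap.inl ℚ ℚ[X] ℚ[X] ∘ₗ
    (primitive - (LinearMap.toSpanSingleton ℚ ℚ[X] X) ∘ₗ integral) ∘ₗ LinearMap.snd ℚ ℚ[X] ℚ[X]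

variable {P : OpData} {n : ℕ}

theorem evalAt_tm (s : ℚ) (a : P.carrier n) (f g : ℚ[X]) :
    evalAt P s n (tm a (form n (f, g))) = f.eval s • a := rfl

/-- Integration over the interval, `x ⊗ (f + g dt) ↦ (∫₀¹ g) x`. -/
noncomputable def integrate (P : OpData) (n : ℕ) :
    (tensor P FormsOp).carrier n →ₗ[ℚ] P.carrier n :=
  (TensorProduct.rid ℚ (P.carrier n)).toLinearMap ∘ₗ
    (integral ∘ₗ LinearMap.snd ℚ ℚ[X] ℚ[X]).lTensor (P.carrier n)

theorem integrate_tm (a : P.carrier n) (f g : ℚ[X]) :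
    integrate P n (tm a (form n (f, g))) = integral g • a := rfl

theorem forms_hom_ext {M : Type*} [AddCommGroup M] [Module ℚ M]
    {F G : (tensor P FormsOp).carrier n →ₗ[ℚ] M}
    (h : ∀ a f g, F (tm a (form n (f, g))) = G (tm a (form n (f, g)))) : F = G :=
  tensor_hom_ext fun a b => by
    obtain ⟨f, g, rfl⟩ := exists_form b
    exact h a f g

/-- The homotopy `x ⊗ ω ↦ ± x ⊗ Kω` of `P ⊗ Ω`, where `K` is `formsHomotopy`. -/
noncomputable def relHomotopy (P : OpData) (n : ℕ) :
    (tensor P FormsOp).carrier n →ₗ[ℚ] (tensor P FormsOp).carrier n :=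
  TensorProduct.map (P.sgn n) formsHomotopy

theorem relHomotopy_tm (a : P.carrier n) (f g : ℚ[X]) :
    relHomotopy P n (tm a (form n (f, g)))
      = tm (P.sgn n a) (form n (primitive g - integral g • X, 0)) := rfl

theorem evalAt_relHomotopy (y : (tensor P FormsOp).carrier n) :
    evalAt P 0 n (relHomotopy P n y) = 0 ∧ evalAt P 1 n (relHomotopy P n y) = 0 := by
  have h0 : evalAt P 0 n ∘ₗ relHomotopy P n = 0 := forms_hom_ext fun a f g => by
    rw [LinearMap.comp_apply, relHomotopy_tm, evalAt_tm]
    simp [eval_zero_primitive]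
  have h1 : evalAt P 1 n ∘ₗ relHomotopy P n = 0 := forms_hom_ext fun a f g => by
    rw [LinearMap.comp_apply, relHomotopy_tm, evalAt_tm]
    simp [integral, Polynomial.leval]
  exact ⟨LinearMap.congr_fun h0 y, LinearMap.congr_fun h1 y⟩

theorem relHomotopy_mem {p : ℤ} {y : (tensor P FormsOp).carrier n}
    (hy : y ∈ (tensor P FormsOp).deg n p) :
    relHomotopy P n y ∈ (tensor P FormsOp).deg n (p + 1) := by
  refine tensor_deg_induction (C := fun y => relHomotopy P n y ∈ (tensor P FormsOp).deg n (p + 1))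
    (by simp) (fun x y hx hy => by rw [map_add]; exact Submodule.add_mem _ hx hy) ?_ hy
  intro q r a b h ha hb
  rcases forms_cases hb with ⟨rfl, f, rfl⟩ | ⟨rfl, g, rfl⟩ | rfl
  · rw [relHomotopy_tm, map_zero, map_zero, zero_smul, sub_zero]
    exact tm_mem (P.sgn_mem ha) (form_zero_mem n (p + 1 - q)) (by omega)
  · rw [relHomotopy_tm]
    exact tm_mem (P.sgn_mem ha) (function_mem n _) (by omega)
  · rw [relHomotopy_tm, map_zero, map_zero, zero_smul, sub_zero]
    exact tm_mem (P.sgn_mem ha) (form_zero_mem n (p + 1 - q)) (by omega)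

theorem integrate_mem {p : ℤ} {y : (tensor P FormsOp).carrier n}
    (hy : y ∈ (tensor P FormsOp).deg n p) : integrate P n y ∈ P.deg n (p + 1) := by
  refine tensor_deg_induction (C := fun y => integrate P n y ∈ P.deg n (p + 1))
    (by simp) (fun x y hx hy => by rw [map_add]; exact Submodule.add_mem _ hx hy) ?_ hy
  intro q r a b h ha hb
  rcases forms_cases hb with ⟨rfl, f, rfl⟩ | ⟨rfl, g, rfl⟩ | rfl
  · rw [integrate_tm, map_zero, zero_smul]; exact Submodule.zero_mem _
  · rw [integrate_tm]
    obtain rfl : q = p + 1 := by omega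
    exact Submodule.smul_mem _ _ ha
  · rw [integrate_tm, map_zero, zero_smul]; exact Submodule.zero_mem _

/-- The homotopy `relHomotopy` contracts `P ⊗ Ω` to `P` tensored with the span of the forms `1 - t`,
`t` and `dt`. -/
theorem d_relHomotopy (hP : P.Laws) (y : (tensor P FormsOp).carrier n) :
    (tensor P FormsOp).d n (relHomotopy P n y) + relHomotopy P n ((tensor P FormsOp).d n y)
      = y - tm (evalAt P 0 n y) (form n (1 - X, 0)) - tm (evalAt P 1 n y) (form n (X, 0))
        - tm (integrate P n y) (form n (0, 1)) := by
  have key : (tensor P FormsOp).d n ∘ₗ relHomotopy P n + relHomotopy P n ∘ₗ (tensor P FormsOp).d n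
      = LinearMap.id - tm.flip (form n (1 - X, 0)) ∘ₗ evalAt P 0 n
        - tm.flip (form n (X, 0)) ∘ₗ evalAt P 1 n - tm.flip (form n (0, 1)) ∘ₗ integrate P n := by
    refine forms_hom_ext fun a f g => ?_
    simp only [LinearMap.add_apply, LinearMap.sub_apply, LinearMap.comp_apply,
      LinearMap.id_apply, LinearMap.flip_apply]
    rw [relHomotopy_tm, d_tm', d_tm', map_add, relHomotopy_tm, formsOp_d, formsOp_d,
      relHomotopy_tm, evalAt_tm, evalAt_tm, integrate_tm, P.sgn_sgn, hP.d_sgn, map_neg,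
      LinearMap.neg_apply, primitive_derivative, integral_derivative, map_sub derivative,
      derivative_primitive, derivative_smul, derivative_X]
    have e1 : ∀ (c : ℚ) (ω : Forms), tm (c • a) (form n ω) = tm a (form n (c • ω)) := by
      intro c ω
      rw [map_smul (form n), map_smul, map_smul, LinearMap.smul_apply]
    have e2 : ∀ u v w : (tensor P FormsOp).carrier n, -u + v + (u + w) = v + w := by
      intro u v w; abel
    rw [e1, e1, e1, e2, ← map_add, ← map_add, ← map_sub, ← map_sub, ← map_sub,
      ← map_sub, ← map_sub, ← map_sub]
    congr 2
    refine Prod.ext ?_ ?_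
    · simp [smul_eq_C_mul]; ring
    · simp [smul_eq_C_mul]
  exact LinearMap.congr_fun key y

/-- Stokes' theorem on the interval. -/
theorem d_integrate (y : (tensor P FormsOp).carrier n) :
    P.d n (integrate P n y) = integrate P n ((tensor P FormsOp).d n y)
      - P.sgn n (evalAt P 1 n y - evalAt P 0 n y) := by
  have key : P.d n ∘ₗ integrate P n = integrate P n ∘ₗ (tensor P FormsOp).d n
      - P.sgn n ∘ₗ (evalAt P 1 n - evalAt P 0 n) := by
    refine forms_hom_ext fun a f g => ?_
    simp only [LinearMap.sub_apply, LinearMap.comp_apply]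
    rw [d_tm', formsOp_d, map_add, integrate_tm, integrate_tm, integrate_tm, evalAt_tm, evalAt_tm,
      integral_derivative, ← sub_smul, map_smul, map_smul, add_sub_cancel_right]
  exact LinearMap.congr_fun key y

/-- A cycle of `P ⊗ Ω` which vanishes at both end points bounds a chain which vanishes at both end
points, provided that the cycles of `P` one degree higher are boundaries. -/
theorem exists_rel_filling (hP : P.Laws) {p : ℤ}
    (hac : ∀ z ∈ P.deg n (p + 1), P.d n z = 0 → ∃ w ∈ P.deg n (p + 1 + 1), P.d n w = z)
    {y : (tensor P FormsOp).carrier n} (hy : y ∈ (tensor P FormsOp).deg n p)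
    (hdy : (tensor P FormsOp).d n y = 0) (h0 : evalAt P 0 n y = 0) (h1 : evalAt P 1 n y = 0) :
    ∃ x ∈ (tensor P FormsOp).deg n (p + 1), (tensor P FormsOp).d n x = y ∧
      evalAt P 0 n x = 0 ∧ evalAt P 1 n x = 0 := by
  obtain ⟨w, hw, hdw⟩ := hac _ (integrate_mem hy) (by rw [d_integrate, hdy, h0, h1]; simp)
  refine ⟨relHomotopy P n y + tm w (form n (0, 1)), ?_, ?_, ?_, ?_⟩
  · exact Submodule.add_mem _ (relHomotopy_mem hy) (tm_mem hw (oneForm_mem n 1) (by omega))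
  · have := d_relHomotopy hP y
    rw [hdy, h0, h1, map_zero, add_zero, map_zero, LinearMap.zero_apply, LinearMap.zero_apply,
      sub_zero, sub_zero] at this
    rw [map_add, this, d_tm', hdw, formsOp_d, map_zero, ← Prod.zero_eq_mk, map_zero, map_zero,
      add_zero, sub_add_cancel]
  · rw [map_add, (evalAt_relHomotopy y).1, evalAt_tm]; simp
  · rw [map_add, (evalAt_relHomotopy y).2, evalAt_tm]; simp

end Integration

/-! ### Decomposition of trees along an edge -/

section Decomposition

variable {n m k i N : ℕ}

theorem outerEdge_injective (hk : 1 ≤ k) : Function.Injective (outerEdge k i) := by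
  intro e f h
  have h1 := congrArg fstLeaf h
  have h2 := congrArg lstLeaf h
  simp only [fstLeaf_outerEdge, lstLeaf_outerEdge] at h1 h2
  refine edge_ext ?_ ?_
  · split_ifs at h1 <;> omega
  · split_ifs at h2 <;> omega

theorem innerEdge_injective (hi : 1 ≤ i) : Function.Injective (innerEdge i) := by
  intro e f h
  have h1 := congrArg fstLeaf h
  have h2 := congrArg lstLeaf h
  simp only [fstLeaf_innerEdge, lstLeaf_innerEdge] at h1 h2
  refine edge_ext ?_ ?_ <;> omega

theorem treeList_of_finset {S : Finset Edge} (hn : 2 ≤ n) (h1 : ∀ e ∈ S, ValidEdge n e)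
    (h2 : ∀ e ∈ S, ∀ f ∈ S, e ≠ f → Indep e f) : TreeList n S.toList :=
  ⟨hn, fun e he => h1 e (Finset.mem_toList.1 he), S.nodup_toList.pairwise_of_forall_ne
    fun e he f hf hef => h2 e (Finset.mem_toList.1 he) f (Finset.mem_toList.1 hf) hef⟩

/-- Every tree is the composite of two trees along any of its edges. -/
theorem TreeList.exists_graft {l : List Edge} (hl : TreeList N l) {e : Edge} (he : e ∈ l) :
    ∃ m k i, ∃ lU lV : List Edge, 1 ≤ i ∧ i ≤ m ∧ m + k = N + 1 ∧ TreeList m lU ∧ TreeList k lV ∧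
      e = edge i (i + k - 1) ∧ l.Perm (graftList k i lU lV) := by
  classical
  have hev := hl.2.1 e he
  obtain ⟨i, hi⟩ : ∃ i, i = fstLeaf e := ⟨_, rfl⟩
  obtain ⟨k, hk⟩ : ∃ k, k = lstLeaf e + 1 - fstLeaf e := ⟨_, rfl⟩
  obtain ⟨m, hm⟩ : ∃ m, m = N + 1 - k := ⟨_, rfl⟩
  have hee : e = edge i (i + k - 1) := by
    refine edge_ext hi.symm ?_
    rw [lstLeaf_edge]
    unfold ValidEdge at hev
    omega
  unfold ValidEdge at hev
  have hi1 : 1 ≤ i := by omega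
  have him : i ≤ m := by omega
  have hN : m + k = N + 1 := by omega
  have hm2 : 2 ≤ m := by omega
  have hk2 : 2 ≤ k := by omega
  have hU : TreeList m ((validEdges m).filter (fun f => outerEdge k i f ∈ l)).toList := by
    refine treeList_of_finset hm2 (fun f hf => ?_) (fun f hf g hg hfg => ?_)
    · exact mem_validEdges.1 (Finset.mem_filter.1 hf).1
    · rw [Finset.mem_filter, mem_validEdges] at hf hg
      rw [← indep_outerEdge (k := k) (i := i) (by omega) f g hf.1.2.1.le hg.1.2.1.le]
      exact hl.indep hf.2 hg.2 fun h => hfg (outerEdge_injective (by omega) h)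
  have hV : TreeList k ((validEdges k).filter (fun f => innerEdge i f ∈ l)).toList := by
    refine treeList_of_finset hk2 (fun f hf => ?_) (fun f hf g hg hfg => ?_)
    · exact mem_validEdges.1 (Finset.mem_filter.1 hf).1
    · rw [Finset.mem_filter, mem_validEdges] at hf hg
      rw [← indep_innerEdge hi1]
      exact hl.indep hf.2 hg.2 fun h => hfg (innerEdge_injective hi1 h)
  refine ⟨m, k, i, _, _, hi1, him, hN, hU, hV, hee, ?_⟩
  rw [List.perm_ext_iff_of_nodup hl.nodup
    ((treeList_graftList hi1 him hN hm2 hk2 hU.2.1 hV.2.1).2 ⟨hU, hV⟩).nodup]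
  intro f
  simp only [graftList, List.mem_append, List.mem_map, Finset.mem_toList, Finset.mem_filter,
    mem_validEdges, List.mem_singleton]
  constructor
  · intro hf
    by_cases hfe : f = e
    · exact Or.inr (hfe.trans hee)
    · left
      rcases validEdge_graft_cases hi1 him hN (hl.2.1 f hf) (hee ▸ hl.indep hf he hfe) with
        ⟨g, hg, rfl⟩ | ⟨g, hg, rfl⟩
      · exact Or.inl ⟨g, ⟨hg, hf⟩, rfl⟩
      · exact Or.inr ⟨g, ⟨hg, hf⟩, rfl⟩
  · rintro ((⟨g, ⟨-, hg⟩, rfl⟩ | ⟨g, ⟨-, hg⟩, rfl⟩) | rfl)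
    · exact hg
    · exact hg
    · exact hee ▸ he

theorem graftList_mem_left (hi : 1 ≤ i) (him : i ≤ m) (hN : m + k = N + 1)
    {l₁ l₂ l₁' l₂' : List Edge} (h₁ : TreeList m l₁) (h₂' : TreeList k l₂')
    (h : ∀ e ∈ graftList k i l₁ l₂, e ∈ graftList k i l₁' l₂') : ∀ e ∈ l₁, e ∈ l₁' := by
  intro e he
  have h3 := h (outerEdge k i e) (by simp only [graftList, List.mem_append, List.mem_map]; grind)
  simp only [graftList, List.mem_append, List.mem_map, List.mem_singleton] at h3
  rcases h3 with ((⟨f, hf, hfe⟩ | ⟨f, hf, hfe⟩) | hfe)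
  · have := outerEdge_injective (by have := h₂'.1; omega) hfe
    exact this ▸ hf
  · have := indep_outerEdge_innerEdge hi (h₁.2.1 e he) (h₂'.2.1 f hf)
    exact absurd hfe.symm (indep_iff.1 this).1
  · have := (validEdge_outerEdge hi him hN h₂'.1 (h₁.2.1 e he)).2
    exact absurd hfe (indep_iff.1 this).1

theorem graftList_mem_right (hi : 1 ≤ i) (him : i ≤ m) (hN : m + k = N + 1)
    {l₁ l₂ l₁' l₂' : List Edge}
    (h₁' : TreeList m l₁') (h₂ : TreeList k l₂)
    (h : ∀ e ∈ graftList k i l₁ l₂, e ∈ graftList k i l₁' l₂') : ∀ e ∈ l₂, e ∈ l₂' := by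
  intro e he
  have h3 := h (innerEdge i e) (by simp only [graftList, List.mem_append, List.mem_map]; grind)
  simp only [graftList, List.mem_append, List.mem_map, List.mem_singleton] at h3
  rcases h3 with ((⟨f, hf, hfe⟩ | ⟨f, hf, hfe⟩) | hfe)
  · have := indep_outerEdge_innerEdge hi (h₁'.2.1 f hf) (h₂.2.1 e he)
    exact absurd hfe (indep_iff.1 this).1
  · have := innerEdge_injective hi hfe
    exact this ▸ hf
  · have := (validEdge_innerEdge hi him hN h₁'.1 (h₂.2.1 e he)).2
    exact absurd hfe (indep_iff.1 this).1

/-- The two factors of a composite tree are determined by the tree. -/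
theorem graftList_cancel (hi : 1 ≤ i) (him : i ≤ m) (hN : m + k = N + 1)
    {l₁ l₂ l₁' l₂' : List Edge} (h₁ : TreeList m l₁) (h₂ : TreeList k l₂)
    (h₁' : TreeList m l₁') (h₂' : TreeList k l₂')
    (h : (graftList k i l₁ l₂).Perm (graftList k i l₁' l₂')) : l₁.Perm l₁' ∧ l₂.Perm l₂' := by
  have ha : ∀ e ∈ graftList k i l₁ l₂, e ∈ graftList k i l₁' l₂' := fun e => h.mem_iff.1
  have hb : ∀ e ∈ graftList k i l₁' l₂', e ∈ graftList k i l₁ l₂ := fun e => h.mem_iff.2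
  rw [List.perm_ext_iff_of_nodup h₁.nodup h₁'.nodup, List.perm_ext_iff_of_nodup h₂.nodup h₂'.nodup]
  exact ⟨fun e => ⟨graftList_mem_left hi him hN h₁ h₂' ha e,
      graftList_mem_left hi him hN h₁' h₂ hb e⟩,
    fun e => ⟨graftList_mem_right hi him hN h₁' h₂ ha e,
      graftList_mem_right hi him hN h₁ h₂' hb e⟩⟩

theorem graftList_perm {l₁ l₂ l₁' l₂' : List Edge} (h₁ : l₁.Perm l₁') (h₂ : l₂.Perm l₂') :
    (graftList k i l₁ l₂).Perm (graftList k i l₁' l₂') :=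
  ((h₁.map _).append (h₂.map _)).append_right _

/-- A composite of two trees is, up to a sign, a tree. -/
theorem exists_comp_eq (hi : 1 ≤ i) (him : i ≤ m) (hN : m + k = N + 1) {lU lV : List Edge}
    (hU : TreeList m lU) (hV : TreeList k lV) {l : List Edge}
    (hl : l.Perm (graftList k i lU lV)) :
    ∃ δ : ℚ, δ ≠ 0 ∧ AInf.compTo m k i N (tree m lU) (tree k lV) = δ • tree N l := by
  have hg := (treeList_graftList hi him hN hU.1 hV.1 hU.2.1 hV.2.1).2 ⟨hU, hV⟩
  have h := perm_of_swap (tree N) (tree_swap N) hl.symm hg.nodup []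
  simp only [List.nil_append] at h
  have hs : ∀ j : ℕ, (-1 : ℚ) ^ j ≠ 0 := fun j => pow_ne_zero _ (by norm_num)
  refine ⟨(-1 : ℚ) ^ ((i : ℤ) * (k + 1) + m * (k - 2 - lV.length)) *
    (((-1) ^ inversions (graftList k i lU lV))⁻¹ * (-1) ^ inversions l), ?_, ?_⟩
  · exact mul_ne_zero (zpow_ne_zero _ (by norm_num)) (mul_ne_zero (inv_ne_zero (hs _)) (hs _))
  · rw [comp_tree hi him hN hU.1 hV.1 hU.2.1 hV.2.1, mul_smul, mul_smul, ← h, smul_smul _⁻¹,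
      inv_mul_cancel₀ (hs _), one_smul]

theorem tree_ne_zero {l : List Edge} (hl : TreeList n l) : tree n l ≠ 0 := by
  intro h
  have h' : oriented n l = 0 := h
  rw [oriented_of_treeList hl, Finsupp.single_eq_zero] at h'
  exact pow_ne_zero _ (by norm_num) h'

/-- `A∞` is generated by the corollas. -/
theorem TreeList.exists_tree_eq_comp {l : List Edge} (hl : TreeList N l) (hne : l ≠ []) :
    ∃ m k i, ∃ lU lV : List Edge, ∃ δ : ℚ, 1 ≤ i ∧ i ≤ m ∧ m + k = N + 1 ∧ TreeList m lU ∧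
      TreeList k lV ∧ l.length = lU.length + lV.length + 1 ∧
      tree N l = δ • AInf.compTo m k i N (tree m lU) (tree k lV) := by
  obtain ⟨e, he⟩ := List.exists_mem_of_ne_nil l hne
  obtain ⟨m, k, i, lU, lV, hi, him, hN, hU, hV, -, hp⟩ := hl.exists_graft he
  obtain ⟨δ, hδ, h⟩ := exists_comp_eq hi him hN hU hV hp
  refine ⟨m, k, i, lU, lV, δ⁻¹, hi, him, hN, hU, hV, ?_, ?_⟩
  · rw [hp.length_eq, length_graftList]
  · rw [h, smul_smul, inv_mul_cancel₀ hδ, one_smul]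

/-- Among the edges in `l` which start furthest to the right, `e` is the smallest.  This
distinguishes one edge of every tree other than a corolla. -/
def IsPivot (l : List Edge) (e : Edge) : Prop :=
  e ∈ l ∧ ∀ f ∈ l, fstLeaf f < fstLeaf e ∨ (fstLeaf f = fstLeaf e ∧ lstLeaf e ≤ lstLeaf f)

theorem exists_isPivot {l : List Edge} (h : l ≠ []) : ∃ e, IsPivot l e := by
  induction l with
  | nil => exact absurd rfl h
  | cons a l ih =>
    by_cases hl : l = []
    · subst hl
      exact ⟨a, by simp, by simp⟩
    · obtain ⟨e, he, hmax⟩ := ih hl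
      by_cases hc : fstLeaf a < fstLeaf e ∨ (fstLeaf a = fstLeaf e ∧ lstLeaf e ≤ lstLeaf a)
      · exact ⟨e, List.mem_cons_of_mem _ he, List.forall_mem_cons.2 ⟨hc, hmax⟩⟩
      · refine ⟨a, List.mem_cons_self, List.forall_mem_cons.2 ⟨Or.inr ⟨rfl, le_rfl⟩, ?_⟩⟩
        intro f hf
        have := hmax f hf
        omega

theorem IsPivot.unique {l : List Edge} {e f : Edge} (he : IsPivot l e) (hf : IsPivot l f) :
    e = f := by
  have h1 := he.2 f hf.1
  have h2 := hf.2 e he.1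
  refine edge_ext ?_ ?_ <;> omega

theorem IsPivot.perm {l l' : List Edge} {e : Edge} (he : IsPivot l e) (h : l.Perm l') :
    IsPivot l' e :=
  ⟨h.mem_iff.1 he.1, fun f hf => he.2 f (h.mem_iff.2 hf)⟩

end Decomposition

/-! ### Extension of multiplicative maps to decomposable trees -/

section Extension

variable {Q : OpData}

/-- The maps `h` respect the compositions with values in arity `n`. -/
def IsMultiplicative (h : ∀ n, AInf.carrier n →ₗ[ℚ] Q.carrier n) (n : ℕ) : Prop :=
  ∀ m k i lU lV, 1 ≤ i → i ≤ m → m + k = n + 1 → TreeList m lU → TreeList k lV →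
    h n (AInf.compTo m k i n (tree m lU) (tree k lV))
      = Q.compTo m k i n (h m (tree m lU)) (h k (tree k lV))

/-- The maps `h` preserve the degree in arity `n`. -/
def PreservesDegree (h : ∀ n, AInf.carrier n →ₗ[ℚ] Q.carrier n) (n : ℕ) : Prop :=
  ∀ l, TreeList n l → h n (tree n l) ∈ Q.deg n (n - 2 - l.length)

/-- The value on a decomposable tree is determined by its decomposition along the pivot. -/
theorem exists_value (h : ∀ n, AInf.carrier n →ₗ[ℚ] Q.carrier n) {n : ℕ} {l : List Edge}
    (hl : TreeList n l) (hne : l ≠ []) :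
    ∃ v : Q.carrier n, ∀ m k i lU lV, ∀ δ : ℚ, 1 ≤ i → i ≤ m → m + k = n + 1 → TreeList m lU →
      TreeList k lV → IsPivot l (edge i (i + k - 1)) → l.Perm (graftList k i lU lV) →
      AInf.compTo m k i n (tree m lU) (tree k lV) = δ • tree n l →
      Q.compTo m k i n (h m (tree m lU)) (h k (tree k lV)) = δ • v := by
  obtain ⟨e, he⟩ := exists_isPivot hne
  obtain ⟨m, k, i, lU, lV, hi, him, hN, hU, hV, rfl, hp⟩ := hl.exists_graft he.1
  obtain ⟨δ, hδ, hc⟩ := exists_comp_eq hi him hN hU hV hp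
  refine ⟨δ⁻¹ • Q.compTo m k i n (h m (tree m lU)) (h k (tree k lV)), ?_⟩
  intro m' k' i' lU' lV' δ' hi' him' hN' hU' hV' he' hp' hc'
  have hee := he.unique he'
  obtain rfl : i = i' := congrArg fstLeaf hee
  obtain rfl : k = k' := by
    have := congrArg lstLeaf hee
    have h1 := hV.1
    have h2 := hV'.1
    simp only [lstLeaf_edge] at this
    omega
  obtain rfl : m = m' := by omega
  obtain ⟨hpU, hpV⟩ := graftList_cancel hi him hN hU' hV' hU hV (hp'.symm.trans hp)
  obtain ⟨ε₁, hε₁⟩ := exists_sign_of_perm hpU hU'.nodup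
  obtain ⟨ε₂, hε₂⟩ := exists_sign_of_perm hpV hV'.nodup
  have h1 := hε₁ m []
  have h2 := hε₂ k []
  simp only [List.nil_append] at h1 h2
  rw [h1, h2, map_smul, map_smul, LinearMap.smul_apply, hc, smul_smul, smul_smul] at hc'
  have hδ' : ε₂ * ε₁ * δ = δ' := by
    have : (ε₂ * ε₁ * δ - δ') • tree n l = 0 := by rw [sub_smul, hc', sub_self]
    exact sub_eq_zero.1 ((smul_eq_zero.1 this).resolve_right (tree_ne_zero hl))
  rw [h1, h2, map_smul, map_smul, map_smul, map_smul, LinearMap.smul_apply, ← hδ', smul_smul,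
    smul_smul, mul_inv_cancel_right₀ hδ]

/-- The trees `(U ∘ᵢ V) ∘ W` and `U ∘ᵢ (V ∘ⱼ W)` have the same edges. -/
theorem graftList_perm_seq {m n k i j M' : ℕ} (hi : 1 ≤ i) (hj : 1 ≤ j) (hjn : j ≤ n)
    (hM' : n + k = M' + 1) {l l' l'' : List Edge} (hl : TreeList m l)
    (hl' : TreeList n l') (hl'' : TreeList k l'') :
    (graftList M' i l (graftList k j l' l'')).Perm
      (graftList k (i + j - 1) (graftList n i l l') l'') := by
  obtain ⟨h1, h2⟩ := graftList_seq hi hj hjn hl''.1 hM' hl.2.1 hl'.2.1 hl''.2.1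
  rw [h1, h2, List.append_nil]
  exact (List.perm_append_singleton _ _).append_left _

/-- The trees `(U ∘ⱼ W) ∘ᵢ V` and `(U ∘ᵢ V) ∘ W` with `i < j` have the same edges. -/
theorem graftList_perm_par {m k l i j : ℕ} (hi : 1 ≤ i) (hij : i < j)
    {lx lw lv : List Edge} (hlx : TreeList m lx) (hlw : TreeList k lw) (hlv : TreeList l lv) :
    (graftList l i (graftList k j lx lw) lv).Perm
      (graftList k (j + l - 1) (graftList l i lx lv) lw) := by
  obtain ⟨h1, h2⟩ := graftList_par hi hij hlw.1 hlv.1 hlx.2.1 hlw.2.1 hlv.2.1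
  rw [h1, h2, List.append_nil, List.append_nil]
  simp only [List.append_assoc]
  refine List.Perm.append_left _ ?_
  rw [← List.append_assoc, ← List.append_assoc (List.map (innerEdge i) lv)]
  exact List.perm_append_comm

/-- A multiplicative family of maps in arities below `n` extends to arity `n`, with value zero on
the corolla.  The value on a tree is defined by its decomposition along the pivot.  If `U ∘ᵢ V` has
its pivot in one of the factors, then this factor is decomposed along the pivot, and the sequential
or the parallel law rewrites `U ∘ᵢ V` as a composite along the pivot. -/
theorem exists_multiplicative_extension (hQ : Q.Laws)
    (h : ∀ n, AInf.carrier n →ₗ[ℚ] Q.carrier n) (n : ℕ)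
    (hmul : ∀ k < n, IsMultiplicative h k) (hdeg : ∀ k < n, PreservesDegree h k) :
    ∃ g : AInf.carrier n →ₗ[ℚ] Q.carrier n, g (tree n []) = 0 ∧
      (∀ l, TreeList n l → g (tree n l) ∈ Q.deg n (n - 2 - l.length)) ∧
      ∀ m k i lU lV, 1 ≤ i → i ≤ m → m + k = n + 1 → TreeList m lU → TreeList k lV →
        g (AInf.compTo m k i n (tree m lU) (tree k lV))
          = Q.compTo m k i n (h m (tree m lU)) (h k (tree k lV)) := by
  classical
  have hv := fun (T : Tree n) (hT : T.edges ≠ []) => exists_value h T.treeList hT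
  choose v hv using hv
  let g : AInf.carrier n →ₗ[ℚ] Q.carrier n := Finsupp.linearCombination ℚ fun T : Tree n =>
    if hT : T.edges ≠ [] then v T hT else 0
  have hg : ∀ T : Tree n, g (tree n T.edges) = if hT : T.edges ≠ [] then v T hT else 0 := by
    intro T
    have h1 : tree n T.edges = Finsupp.single T (1 : ℚ) := oriented_edges T
    rw [h1]
    refine (Finsupp.linearCombination_single ℚ _ _).trans ?_
    rw [one_smul]
  -- the decomposition along the pivot
  have hpivot : ∀ m k i lU lV, 1 ≤ i → i ≤ m → m + k = n + 1 → TreeList m lU → TreeList k lV →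
      IsPivot (graftList k i lU lV) (edge i (i + k - 1)) →
      g (AInf.compTo m k i n (tree m lU) (tree k lV))
        = Q.compTo m k i n (h m (tree m lU)) (h k (tree k lV)) := by
    intro m k i lU lV hi him hN hU hV hc
    have hgr := (treeList_graftList hi him hN hU.1 hV.1 hU.2.1 hV.2.1).2 ⟨hU, hV⟩
    obtain ⟨T, hT⟩ := exists_edges_perm hgr
    have hne : T.edges ≠ [] := List.ne_nil_of_mem (hT.mem_iff.2 hc.1)
    obtain ⟨δ, -, hδ⟩ := exists_comp_eq hi him hN hU hV hT
    rw [hv T hne m k i lU lV δ hi him hN hU hV (hc.perm hT.symm) hT hδ, hδ, map_smul, hg,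
      dif_pos hne]
  have hmain : ∀ m k i lU lV, 1 ≤ i → i ≤ m → m + k = n + 1 → TreeList m lU → TreeList k lV →
      g (AInf.compTo m k i n (tree m lU) (tree k lV))
        = Q.compTo m k i n (h m (tree m lU)) (h k (tree k lV)) := by
    intro m k i lU lV hi him hN hU hV
    have hmem : edge i (i + k - 1) ∈ graftList k i lU lV := by simp [graftList]
    obtain ⟨e, he⟩ := exists_isPivot (List.ne_nil_of_mem hmem)
    have he0 := he.2 _ hmem
    have heg := he.1
    simp only [graftList, List.mem_append, List.mem_map, List.mem_singleton] at heg
    have hm2 := hU.1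
    have hk2 := hV.1
    rcases heg with ((⟨f, hf, rfl⟩ | ⟨f, hf, rfl⟩) | rfl)
    · -- the pivot lies in `U`, to the right of the leaf `i`
      obtain ⟨m', k', j, lX, lW, hj, hjm, hN', hX, hW, rfl, hp⟩ := hU.exists_graft hf
      have hm2' := hX.1
      have hk2' := hW.1
      have hij : i < j := by
        have hfv := hU.2.1 _ hf
        simp only [ValidEdge, fstLeaf_outerEdge, lstLeaf_outerEdge, fstLeaf_edge,
          lstLeaf_edge] at hfv he0
        by_contra hji
        grind
      obtain ⟨M', hM'⟩ : ∃ M', m' + k = M' + 1 := ⟨m' + k - 1, by omega⟩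
      have hperm := (graftList_perm hp (List.Perm.refl lV)).trans
        (graftList_perm_par (k := k') (l := k) hi hij hX hW hV)
      have heq : outerEdge k i (edge j (j + k' - 1)) = edge (j + k - 1) (j + k - 1 + k' - 1) := by
        refine edge_ext ?_ ?_ <;> simp only [fstLeaf_outerEdge, lstLeaf_outerEdge, fstLeaf_edge,
          lstLeaf_edge] <;> grind
      have hpv := he.perm hperm
      rw [heq] at hpv
      have hXV := (treeList_graftList hi (by omega) hM' hX.1 hV.1 hX.2.1 hV.2.1).2 ⟨hX, hV⟩
      obtain ⟨δ, hδ0, hδ⟩ := exists_comp_eq hj hjm hN' hX hW hp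
      obtain ⟨ε, hε0, hε⟩ := exists_comp_eq hi (by omega) hM' hX hV (List.Perm.refl _)
      have hU' : tree m lU = δ⁻¹ • AInf.compTo m' k' j m (tree m' lX) (tree k' lW) := by
        rw [hδ, smul_smul, inv_mul_cancel₀ hδ0, one_smul]
      have hXV' : h M' (tree M' (graftList k i lX lV))
          = ε⁻¹ • Q.compTo m' k i M' (h m' (tree m' lX)) (h k (tree k lV)) := by
        rw [← hmul M' (by omega) m' k i lX lV hi (by omega) hM' hX hV, hε, map_smul, smul_smul,
          inv_mul_cancel₀ hε0, one_smul]
      rw [hU']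
      simp only [map_smul, LinearMap.smul_apply]
      rw [hmul m (by omega) m' k' j lX lW hj hjm hN' hX hW,
        AInf_laws.par hi hij hjm hN' hM' hN (tree_mem _ _) (tree_mem _ _) (tree_mem _ _),
        hQ.par hi hij hjm hN' hM' hN (hdeg m' (by omega) lX hX) (hdeg k' (by omega) lW hW)
          (hdeg k (by omega) lV hV), map_smul, hε, map_smul, LinearMap.smul_apply, map_smul,
        hpivot M' k' (j + k - 1) _ lW (by omega) (by omega) (by omega) hXV hW hpv, hXV', map_smul,
        LinearMap.smul_apply, smul_smul ε, mul_inv_cancel₀ hε0, one_smul]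
    · -- the pivot lies in `V`
      obtain ⟨m', k', j, lX, lW, hj, hjm, hN', hX, hW, rfl, hp⟩ := hV.exists_graft hf
      have hm2' := hX.1
      have hk2' := hW.1
      obtain ⟨M, hM⟩ : ∃ M, m + m' = M + 1 := ⟨m + m' - 1, by omega⟩
      have hperm := (graftList_perm (List.Perm.refl lU) hp).trans
        (graftList_perm_seq (k := k') hi hj hjm hN' hU hX hW)
      have heq : innerEdge i (edge j (j + k' - 1)) = edge (i + j - 1) (i + j - 1 + k' - 1) := by
        refine edge_ext ?_ ?_ <;> simp only [fstLeaf_innerEdge, lstLeaf_innerEdge, fstLeaf_edge,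
          lstLeaf_edge] <;> omega
      have hpv := he.perm hperm
      rw [heq] at hpv
      have hUX := (treeList_graftList hi him hM hU.1 hX.1 hU.2.1 hX.2.1).2 ⟨hU, hX⟩
      obtain ⟨δ, hδ0, hδ⟩ := exists_comp_eq hj hjm hN' hX hW hp
      obtain ⟨ε, hε0, hε⟩ := exists_comp_eq hi him hM hU hX (List.Perm.refl _)
      have hV' : tree k lV = δ⁻¹ • AInf.compTo m' k' j k (tree m' lX) (tree k' lW) := by
        rw [hδ, smul_smul, inv_mul_cancel₀ hδ0, one_smul]
      have hUX' : h M (tree M (graftList m' i lU lX))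
          = ε⁻¹ • Q.compTo m m' i M (h m (tree m lU)) (h m' (tree m' lX)) := by
        rw [← hmul M (by omega) m m' i lU lX hi him hM hU hX, hε, map_smul, smul_smul,
          inv_mul_cancel₀ hε0, one_smul]
      rw [hV']
      simp only [map_smul]
      rw [hmul k (by omega) m' k' j lX lW hj hjm hN' hX hW,
        ← AInf_laws.seq hi him hj hjm hM hN' (by omega) (tree_mem _ _) (tree_mem _ _)
          (tree_mem _ _),
        ← hQ.seq hi him hj hjm hM hN' (by omega) (hdeg m (by omega) lU hU)
          (hdeg m' (by omega) lX hX) (hdeg k' (by omega) lW hW), hε, map_smul,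
        LinearMap.smul_apply, map_smul,
        hpivot M k' (i + j - 1) _ lW (by omega) (by omega) (by omega) hUX hW hpv, hUX', map_smul,
        LinearMap.smul_apply, smul_smul ε, mul_inv_cancel₀ hε0, one_smul]
    · exact hpivot m k i lU lV hi him hN hU hV he
  have hcor : g (tree n []) = 0 := by
    by_cases hn : TreeList n []
    · obtain ⟨T, hT⟩ := exists_edges_perm hn
      have h1 := List.perm_nil.1 hT
      have h2 := hg T
      rw [dif_neg (not_not_intro h1)] at h2
      rwa [h1] at h2
    · rw [tree_of_not hn, map_zero]
  refine ⟨g, hcor, fun l hl => ?_, hmain⟩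
  by_cases hne : l = []
  · subst hne; rw [hcor]; exact Submodule.zero_mem _
  · obtain ⟨m, k, i, lU, lV, δ, hi, him, hN, hU, hV, hlen, hcomp⟩ := hl.exists_tree_eq_comp hne
    rw [hcomp, map_smul, hmain m k i lU lV hi him hN hU hV]
    have h1 := hU.1
    have h2 := hV.1
    have := hQ.comp_mem hi him hN (hdeg m (by omega) lU hU) (hdeg k (by omega) lV hV)
    refine Submodule.smul_mem _ _ ?_
    convert this using 2
    rw [hlen]
    push_cast
    omega

end Extension

/-! ### Evaluation at a point of the interval -/

section Evaluation

variable {P : OpData}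

theorem evalAt_d (s : ℚ) {n : ℕ} (y : (tensor P FormsOp).carrier n) :
    evalAt P s n ((tensor P FormsOp).d n y) = P.d n (evalAt P s n y) := by
  have : evalAt P s n ∘ₗ (tensor P FormsOp).d n = P.d n ∘ₗ evalAt P s n :=
    forms_hom_ext fun a f g => by
      rw [LinearMap.comp_apply, LinearMap.comp_apply, d_tm', map_add, formsOp_d, evalAt_tm,
        evalAt_tm, evalAt_tm, Polynomial.eval_zero, zero_smul, add_zero, map_smul]
  exact LinearMap.congr_fun this y

theorem evalAt_rot (s : ℚ) {n : ℕ} (y : (tensor P FormsOp).carrier n) :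
    evalAt P s n ((tensor P FormsOp).rot n y) = P.rot n (evalAt P s n y) := by
  have : evalAt P s n ∘ₗ (tensor P FormsOp).rot n = P.rot n ∘ₗ evalAt P s n :=
    forms_hom_ext fun a f g => by
      rw [LinearMap.comp_apply, LinearMap.comp_apply, rot_tm, formsOp_rot, evalAt_tm,
        evalAt_tm, map_smul]
  exact LinearMap.congr_fun this y

theorem evalAt_comp (s : ℚ) {m n i N : ℕ} (hN : m + n = N + 1) {p q : ℤ}
    {x : (tensor P FormsOp).carrier m} {y : (tensor P FormsOp).carrier n}
    (hx : x ∈ (tensor P FormsOp).deg m p) (hy : y ∈ (tensor P FormsOp).deg n q) :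
    evalAt P s N ((tensor P FormsOp).compTo m n i N x y)
      = P.compTo m n i N (evalAt P s m x) (evalAt P s n y) := by
  refine tensor_deg_induction (C := fun x => evalAt P s N ((tensor P FormsOp).compTo m n i N x y)
      = P.compTo m n i N (evalAt P s m x) (evalAt P s n y)) (by simp)
    (fun x y hx hy => by simp only [map_add, LinearMap.add_apply, hx, hy]) ?_ hx
  intro p₁ p₂ a a' _ _ ha'
  refine tensor_deg_induction (C := fun y => evalAt P s N
      ((tensor P FormsOp).compTo m n i N (tm a a') y)
      = P.compTo m n i N (evalAt P s m (tm a a')) (evalAt P s n y)) (by simp)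
    (fun x y hx hy => by simp only [map_add, hx, hy]) ?_ hy
  intro q₁ q₂ b b' _ hb _
  rw [compTo_tm ha' hb]
  obtain ⟨f', g', rfl⟩ := exists_form b'
  rcases forms_cases ha' with ⟨rfl, f, rfl⟩ | ⟨rfl, g, rfl⟩ | rfl <;>
  rw [formsOp_compTo hN, map_smul, evalAt_tm, evalAt_tm, evalAt_tm] <;>
  simp [smul_smul, mul_comm]

end Evaluation

/-! ### Averaging over the cyclic group -/

/-- The average of `x` over the cyclic group generated by an operator `ρ` with `ρ ^ N = 1`. -/
noncomputable def average {V : Type*} [AddCommGroup V] [Module ℚ V] (ρ : Module.End ℚ V) (N : ℕ)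
    (x : V) : V :=
  (N : ℚ)⁻¹ • ∑ k ∈ Finset.range N, (ρ ^ k) x

theorem apply_average {V : Type*} [AddCommGroup V] [Module ℚ V] {ρ : Module.End ℚ V} {N : ℕ}
    (h : ρ ^ N = 1) (x : V) : ρ (average ρ N x) = average ρ N x := by
  have h1 : ∑ k ∈ Finset.range N, (ρ ^ (k + 1)) x = ∑ k ∈ Finset.range N, (ρ ^ k) x := by
    have h2 := Finset.sum_range_succ (fun k => (ρ ^ k) x) N
    rw [Finset.sum_range_succ', h, pow_zero] at h2
    exact add_right_cancel h2
  rw [average, map_smul, map_sum, ← h1]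
  congr 1
  rw [h1, ← h1]
  exact Finset.sum_congr rfl fun k _ => by rw [pow_succ']; rfl

theorem map_average {V W : Type*} [AddCommGroup V] [Module ℚ V] [AddCommGroup W] [Module ℚ W]
    {ρ : Module.End ℚ V} {σ : Module.End ℚ W} {N : ℕ} (hN : N ≠ 0) {F : V →ₗ[ℚ] W} {x : V}
    (hF : ∀ x, F (ρ x) = σ (F x)) (hx : σ (F x) = F x) : F (average ρ N x) = F x := by
  have h1 : ∀ k : ℕ, F ((ρ ^ k) x) = F x := by
    intro k
    induction k with
    | zero => rfl
    | succ k ih => rw [pow_succ', Module.End.mul_apply, hF, ih, hx]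
  rw [average, map_smul, map_sum]
  simp only [h1]
  rw [Finset.sum_const, Finset.card_range, ← Nat.cast_smul_eq_nsmul ℚ, smul_smul,
    inv_mul_cancel₀ (by exact_mod_cast hN), one_smul]

/-! ### Construction of the homotopy -/

/-- Construction of a sequence by recursion, where the condition `P n` on the first `n + 1` terms
can be satisfied by a choice of the last one if it holds for the shorter segments. -/
theorem exists_seq {α : ℕ → Type*} [∀ n, Zero (α n)] (P : ∀ _ : ℕ, (∀ n, α n) → Prop)
    (hloc : ∀ n X Y, (∀ k ≤ n, X k = Y k) → P n X → P n Y)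
    (hstep : ∀ n X, (∀ k < n, P k X) → ∃ x, P n (Function.update X n x)) :
    ∃ X, ∀ n, P n X := by
  classical
  let F : ℕ → ∀ n, α n := fun j => Nat.rec (fun _ => 0) (fun k X =>
    if hex : ∃ x, P k (Function.update X k x) then Function.update X k hex.choose else X) j
  have hF : ∀ k, F (k + 1) = if hex : ∃ x, P k (Function.update (F k) k x) then
    Function.update (F k) k hex.choose else F k := fun _ => rfl
  have hne : ∀ k n, n ≠ k → F (k + 1) n = F k n := by
    intro k n h
    rw [hF]
    split_ifs with hex
    · exact Function.update_of_ne h _ _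
    · rfl
  have hst : ∀ n j, n < j → F j n = F (n + 1) n := by
    intro n j h
    induction j with
    | zero => omega
    | succ j ih =>
      by_cases hj : n = j
      · subst hj; rfl
      · rw [hne j n hj, ih (by omega)]
  have hP : ∀ n, P n (F (n + 1)) := by
    intro n
    induction n using Nat.strong_induction_on with
    | _ n ih =>
      have hex : ∃ x, P n (Function.update (F n) n x) := hstep n (F n) fun k hk =>
        hloc k _ _ (fun j hj => by rw [hst j (k + 1) (by omega), hst j n (by omega)]) (ih k hk)
      rw [hF, dif_pos hex]
      exact hex.choose_spec
  exact ⟨fun n => F (n + 1) n, fun n => hloc n _ _ (fun k hk => hst k (n + 1) (by omega)) (hP n)⟩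

theorem map_compTo {O P : OpData} (f : Hom O P) {m n i N : ℕ} (hi : 1 ≤ i) (him : i ≤ m)
    (hN : m + n = N + 1) (x : O.carrier m) (y : O.carrier n) :
    f.toFun N (O.compTo m n i N x y) = P.compTo m n i N (f.toFun m x) (f.toFun n y) := by
  obtain rfl : m + n - 1 = N := by omega
  rw [OpData.compTo_self, OpData.compTo_self]
  exact f.map_comp m n i hi him x y

/-- Linear maps which are multiplicative on trees are multiplicative. -/
theorem comp_ext {Q : OpData} {m k i N : ℕ} {g : AInf.carrier N →ₗ[ℚ] Q.carrier N}
    {g₁ : AInf.carrier m →ₗ[ℚ] Q.carrier m} {g₂ : AInf.carrier k →ₗ[ℚ] Q.carrier k}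
    (h : ∀ lU lV, TreeList m lU → TreeList k lV →
      g (AInf.compTo m k i N (tree m lU) (tree k lV))
        = Q.compTo m k i N (g₁ (tree m lU)) (g₂ (tree k lV))) (x : AInf.carrier m)
    (y : AInf.carrier k) :
    g (AInf.compTo m k i N x y) = Q.compTo m k i N (g₁ x) (g₂ y) := by
  have h1 : (AInf.compTo m k i N).compr₂ g = (Q.compTo m k i N).compl₁₂ g₁ g₂ := by
    refine AInf_hom_ext fun lU hU => AInf_hom_ext fun lV hV => ?_
    exact h lU lV hU hV
  exact LinearMap.congr_fun₂ h1 x y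

/-- Linear maps which agree on all trees but the corolla agree on boundaries. -/
theorem eq_on_d {n : ℕ} {M : Type*} [AddCommGroup M] [Module ℚ M]
    {F G : AInf.carrier n →ₗ[ℚ] M}
    (h : ∀ l, TreeList n l → l ≠ [] → F (tree n l) = G (tree n l)) (x : AInf.carrier n) :
    F (AInf.d n x) = G (AInf.d n x) := by
  have : F ∘ₗ AInf.d n = G ∘ₗ AInf.d n := by
    refine AInf_hom_ext fun l _ => ?_
    rw [LinearMap.comp_apply, LinearMap.comp_apply, d_tree, map_sum, map_sum]
    refine Finset.sum_congr rfl fun e _ => ?_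
    by_cases ht : TreeList n (e :: l)
    · exact h _ ht (by simp)
    · rw [tree_of_not ht, map_zero, map_zero]
  exact LinearMap.congr_fun this x

/-- The linear form which takes the coefficient of the corolla. -/
theorem exists_corolla_coeff (n : ℕ) : ∃ χ : AInf.carrier n →ₗ[ℚ] ℚ,
    (2 ≤ n → χ (tree n []) = 1) ∧ ∀ l, l ≠ [] → χ (tree n l) = 0 := by
  by_cases hn : 2 ≤ n
  · have hT : TreeList n [] := ⟨hn, by simp, List.Pairwise.nil⟩
    refine ⟨Finsupp.lapply (⟨[].toFinset, (treeList_iff.1 hT).2⟩ : Tree n), fun _ => ?_, ?_⟩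
    · change oriented n [] _ = 1
      rw [oriented_of_treeList hT, Finsupp.single_eq_same]
      rfl
    · intro l hl
      by_cases ht : TreeList n l
      · change oriented n l _ = 0
        rw [oriented_of_treeList ht, Finsupp.single_eq_of_ne]
        intro h
        have := congrArg Subtype.val h
        simp only [List.toFinset_nil] at this
        exact hl (List.toFinset_eq_empty_iff l |>.1 this.symm)
      · change oriented n l _ = 0
        rw [oriented_of_not_treeList ht]
        rfl
  · exact ⟨0, fun h => absurd h hn, fun _ _ => rfl⟩

theorem rot_corolla {n : ℕ} (hn : 2 ≤ n) :
    AInf.rot n (tree n []) = (-1 : ℚ) ^ n • tree n [] :=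
  rot_tree ⟨hn, by simp, List.Pairwise.nil⟩

section Step

/-- The conditions on a cyclic homotopy from `Δ₁` to `Δ₂` in arity `n`. -/
structure IsHomotopyUpTo (P : OpData) (Δ₁ Δ₂ : Hom AInf P)
    (h : ∀ n, AInf.carrier n →ₗ[ℚ] (tensor P FormsOp).carrier n) (n : ℕ) : Prop where
  mul : IsMultiplicative h n
  deg : PreservesDegree h n
  d : ∀ x, h n (AInf.d n x) = (tensor P FormsOp).d n (h n x)
  rot : ∀ x, h n (AInf.rot n x) = (tensor P FormsOp).rot n (h n x)
  eval_zero : ∀ x, evalAt P 0 n (h n x) = Δ₁.toFun n x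
  eval_one : ∀ x, evalAt P 1 n (h n x) = Δ₂.toFun n x

variable {P : OpData} {Δ₁ Δ₂ : Hom AInf P}

theorem IsHomotopyUpTo.congr {h h' : ∀ n, AInf.carrier n →ₗ[ℚ] (tensor P FormsOp).carrier n}
    {n : ℕ} (hh : ∀ k ≤ n, h k = h' k) (H : IsHomotopyUpTo P Δ₁ Δ₂ h n) :
    IsHomotopyUpTo P Δ₁ Δ₂ h' n where
  mul m k i lU lV hi him hN hU hV := by
    have h1 := hU.1
    have h2 := hV.1
    rw [← hh n le_rfl, ← hh m (by omega), ← hh k (by omega)]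
    exact H.mul m k i lU lV hi him hN hU hV
  deg l hl := by rw [← hh n le_rfl]; exact H.deg l hl
  d x := by rw [← hh n le_rfl]; exact H.d x
  rot x := by rw [← hh n le_rfl]; exact H.rot x
  eval_zero x := by rw [← hh n le_rfl]; exact H.eval_zero x
  eval_one x := by rw [← hh n le_rfl]; exact H.eval_one x

/-- The value `x` of the homotopy on the corolla `c` of arity `n`, where `y` is the value prescribed
on the boundary of `c`.  In arity two the constant path works.  In higher arity, the path which
joins `Δ₁ c` to `Δ₂ c` linearly is corrected by a chain which vanishes at the end points; the cycles
to be filled then have degree `n - 2 ≠ 0`.  Averaging over the cyclic group makes `x` equivariant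
and changes neither the boundary nor the end points, because these are equivariant already. -/
theorem exists_corolla_value (hP : P.Laws) (hc₁ : Δ₁.IsCyclic) (hc₂ : Δ₂.IsCyclic) {n : ℕ}
    (hn : 2 ≤ n) (htwo : Δ₁.toFun 2 (tree 2 []) = Δ₂.toFun 2 (tree 2 []))
    (hac : ∀ p : ℤ, p ≠ 0 → ∀ z ∈ P.deg n p, P.d n z = 0 → ∃ w ∈ P.deg n (p + 1), P.d n w = z)
    {y : (tensor P FormsOp).carrier n} (hy : y ∈ (tensor P FormsOp).deg n (n - 2 - 1))
    (hdy : (tensor P FormsOp).d n y = 0)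
    (hry : (tensor P FormsOp).rot n y = (-1 : ℚ) ^ n • y)
    (h0 : evalAt P 0 n y = Δ₁.toFun n (AInf.d n (tree n [])))
    (h1 : evalAt P 1 n y = Δ₂.toFun n (AInf.d n (tree n [])))
    (hy2 : n = 2 → y = 0) :
    ∃ x ∈ (tensor P FormsOp).deg n (n - 2), (tensor P FormsOp).d n x = y ∧
      (tensor P FormsOp).rot n x = (-1 : ℚ) ^ n • x ∧
      evalAt P 0 n x = Δ₁.toFun n (tree n []) ∧ evalAt P 1 n x = Δ₂.toFun n (tree n []) := by
  have hQ := tensor_laws hP formsOp_laws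
  have hcm : tree n [] ∈ AInf.deg n (n - 2) := by simpa using tree_mem n []
  -- a chain with the required boundary and end points
  obtain ⟨x, hx, hdx, hx0, hx1⟩ : ∃ x ∈ (tensor P FormsOp).deg n (n - 2),
      (tensor P FormsOp).d n x = y ∧ evalAt P 0 n x = Δ₁.toFun n (tree n []) ∧
        evalAt P 1 n x = Δ₂.toFun n (tree n []) := by
    by_cases h2 : n = 2
    · subst h2
      refine ⟨tm (Δ₁.toFun 2 (tree 2 [])) (form 2 (1, 0)),
        tm_mem (Δ₁.map_deg _ _ _ hcm) (function_mem 2 1) (by omega), ?_, ?_, ?_⟩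
      · rw [hy2 rfl] at h0 ⊢
        rw [d_tm', formsOp_d, ← Δ₁.map_d, ← h0, map_zero, map_zero, LinearMap.zero_apply,
          Polynomial.derivative_one, ← Prod.zero_eq_mk, map_zero, map_zero, add_zero]
      · rw [evalAt_tm, Polynomial.eval_one, one_smul]
      · rw [evalAt_tm, Polynomial.eval_one, one_smul, htwo]
    · obtain ⟨x₀, hx₀⟩ : ∃ x₀, x₀ = tm (Δ₁.toFun n (tree n [])) (form n (1 - Polynomial.X, 0))
          + tm (Δ₂.toFun n (tree n [])) (form n (Polynomial.X, 0)) := ⟨_, rfl⟩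
      have hx₀m : x₀ ∈ (tensor P FormsOp).deg n (n - 2) := by
        rw [hx₀]
        exact Submodule.add_mem _
          (tm_mem (Δ₁.map_deg _ _ _ hcm) (function_mem n _) (by omega))
          (tm_mem (Δ₂.map_deg _ _ _ hcm) (function_mem n _) (by omega))
      have e0 : evalAt P 0 n x₀ = Δ₁.toFun n (tree n []) := by
        rw [hx₀, map_add, evalAt_tm, evalAt_tm]; simp
      have e1 : evalAt P 1 n x₀ = Δ₂.toFun n (tree n []) := by
        rw [hx₀, map_add, evalAt_tm, evalAt_tm]; simp
      obtain ⟨x₁, hx₁, hdx₁, h10, h11⟩ := exists_rel_filling hP (p := (n : ℤ) - 2 - 1)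
        (hac _ (by omega)) (Submodule.sub_mem _ hy (hQ.d_mem hx₀m))
        (by rw [map_sub, hdy, hQ.d_d, sub_zero])
        (by rw [map_sub, evalAt_d, e0, h0, Δ₁.map_d, sub_self])
        (by rw [map_sub, evalAt_d, e1, h1, Δ₂.map_d, sub_self])
      rw [sub_add_cancel] at hx₁
      refine ⟨x₀ + x₁, Submodule.add_mem _ hx₀m hx₁, ?_, ?_, ?_⟩
      · rw [map_add, hdx₁, add_sub_cancel]
      · rw [map_add, h10, e0, add_zero]
      · rw [map_add, h11, e1, add_zero]
  -- its average over the cyclic group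
  obtain ⟨ρ, hρ⟩ : ∃ ρ : Module.End ℚ ((tensor P FormsOp).carrier n),
    ρ = (-1 : ℚ) ^ n • (tensor P FormsOp).rot n := ⟨_, rfl⟩
  have hsq : (-1 : ℚ) ^ n * (-1 : ℚ) ^ n = 1 := by rw [← mul_pow]; simp
  have hρN : ρ ^ (n + 1) = 1 := by
    rw [hρ, smul_pow, hQ.rot_pow, ← pow_mul, (Nat.even_mul_succ_self n).neg_one_pow, one_smul]
  have hρa : ∀ x, ρ x = (-1 : ℚ) ^ n • (tensor P FormsOp).rot n x := fun x => by rw [hρ]; rfl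
  have hcyc : ∀ Δ : Hom AInf P, Δ.IsCyclic →
      ((-1 : ℚ) ^ n • P.rot n) (Δ.toFun n (tree n [])) = Δ.toFun n (tree n []) := by
    intro Δ hΔ
    rw [LinearMap.smul_apply, ← hΔ, rot_corolla hn, map_smul, smul_smul, hsq, one_smul]
  refine ⟨average ρ (n + 1) x, ?_, ?_, ?_, ?_, ?_⟩
  · have hk : ∀ k : ℕ, (ρ ^ k) x ∈ (tensor P FormsOp).deg n (n - 2) := fun k => by
      induction k with
      | zero => exact hx
      | succ k ih =>
        rw [pow_succ', Module.End.mul_apply, hρa]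
        exact Submodule.smul_mem _ _ (hQ.rot_mem ih)
    exact Submodule.smul_mem _ _ (Submodule.sum_mem _ fun k _ => hk k)
  · refine (map_average (σ := ρ) (Nat.succ_ne_zero n) (fun x => ?_) ?_).trans hdx
    · rw [hρa, hρa, map_smul, hQ.d_rot]
    · rw [hdx, hρa, hry, smul_smul, hsq, one_smul]
  · have := apply_average hρN x
    rw [hρa] at this
    conv_rhs => rw [← this]
    rw [smul_smul, hsq, one_smul]
  · refine (map_average (σ := (-1 : ℚ) ^ n • P.rot n) (Nat.succ_ne_zero n) (fun x => ?_) ?_).trans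
      hx0
    · rw [hρa, map_smul, evalAt_rot]; rfl
    · rw [hx0, hcyc Δ₁ hc₁]
  · refine (map_average (σ := (-1 : ℚ) ^ n • P.rot n) (Nat.succ_ne_zero n) (fun x => ?_) ?_).trans
      hx1
    · rw [hρa, map_smul, evalAt_rot]; rfl
    · rw [hx1, hcyc Δ₂ hc₂]

/-- The homotopy extends from the arities below `n` to arity `n`: on decomposable trees it is
determined by multiplicativity, and its value on the corolla is provided by `exists_corolla_value`.
-/
theorem exists_homotopy_step (hP : P.Laws) (hc₁ : Δ₁.IsCyclic) (hc₂ : Δ₂.IsCyclic)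
    (htwo : Δ₁.toFun 2 (tree 2 []) = Δ₂.toFun 2 (tree 2 []))
    (hac : ∀ n, ∀ p : ℤ, p ≠ 0 → ∀ z ∈ P.deg n p, P.d n z = 0 →
      ∃ w ∈ P.deg n (p + 1), P.d n w = z) (n : ℕ)
    (h : ∀ n, AInf.carrier n →ₗ[ℚ] (tensor P FormsOp).carrier n)
    (H : ∀ k < n, IsHomotopyUpTo P Δ₁ Δ₂ h k) :
    ∃ g, IsHomotopyUpTo P Δ₁ Δ₂ (Function.update h n g) n := by
  have hQ := tensor_laws hP formsOp_laws
  obtain ⟨g₀, hg₀c, hg₀d, hg₀m⟩ := exists_multiplicative_extension hQ h n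
    (fun k hk => (H k hk).mul) (fun k hk => (H k hk).deg)
  have hmul : ∀ m k i, 1 ≤ i → i ≤ m → m + k = n + 1 → ∀ x y,
      g₀ (AInf.compTo m k i n x y) = (tensor P FormsOp).compTo m k i n (h m x) (h k y) :=
    fun m k i hi him hN x y => comp_ext (fun lU lV hU hV =>
      hg₀m m k i lU lV hi him hN hU hV) x y
  -- all conditions hold on decomposable trees
  have hdec : ∀ l, TreeList n l → l ≠ [] →
      g₀ (AInf.d n (tree n l)) = (tensor P FormsOp).d n (g₀ (tree n l)) ∧
      g₀ (AInf.rot n (tree n l)) = (tensor P FormsOp).rot n (g₀ (tree n l)) ∧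
      evalAt P 0 n (g₀ (tree n l)) = Δ₁.toFun n (tree n l) ∧
      evalAt P 1 n (g₀ (tree n l)) = Δ₂.toFun n (tree n l) := by
    intro l hl hne
    obtain ⟨m, k, i, lU, lV, δ, hi, him, hN, hU, hV, -, hcomp⟩ := hl.exists_tree_eq_comp hne
    have h1 := hU.1
    have h2 := hV.1
    have Hm := H m (by omega)
    have Hk := H k (by omega)
    have dU := Hm.deg lU hU
    have dV := Hk.deg lV hV
    rw [hcomp]
    simp only [map_smul]
    refine ⟨?_, ?_, ?_, ?_⟩
    · rw [AInf_laws.d_comp hi him hN (tree_mem m lU) (tree_mem k lV), map_add, map_smul,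
        hmul m k i hi him hN, hmul m k i hi him hN, hmul m k i hi him hN,
        hQ.d_comp hi him hN dU dV, Hm.d, Hk.d]
    · by_cases him' : i = m
      · subst him'
        rw [AInf_laws.rot_comp_last hi hN (tree_mem i lU) (tree_mem k lV), map_smul,
          hmul k i 1 le_rfl (by omega) (by omega), hmul i k i hi le_rfl hN,
          hQ.rot_comp_last hi hN dU dV, Hm.rot, Hk.rot]
      · rw [AInf_laws.rot_comp hi (by omega) hN (tree_mem m lU) (tree_mem k lV),
          hmul m k (i + 1) (by omega) (by omega) hN, hmul m k i hi him hN,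
          hQ.rot_comp hi (by omega) hN dU dV, Hm.rot]
    · rw [hmul m k i hi him hN, evalAt_comp 0 hN dU dV, Hm.eval_zero, Hk.eval_zero,
        map_compTo Δ₁ hi him hN]
    · rw [hmul m k i hi him hN, evalAt_comp 1 hN dU dV, Hm.eval_one, Hk.eval_one,
        map_compTo Δ₂ hi him hN]
  by_cases hn : 2 ≤ n
  swap
  · refine ⟨g₀, ?_, ?_, ?_, ?_, ?_, ?_⟩
    · intro m k i lU lV hi him hN hU hV
      have h1 := hU.1
      have h2 := hV.1
      omega
    · intro l hl; exact absurd hl.1 hn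
    all_goals
      intro x
      rw [AInf_subsingleton (by omega) x]
      simp
  have hrotd : ∀ x, g₀ (AInf.rot n (AInf.d n x)) = (tensor P FormsOp).rot n (g₀ (AInf.d n x)) :=
    eq_on_d (F := g₀ ∘ₗ AInf.rot n) (G := (tensor P FormsOp).rot n ∘ₗ g₀)
      fun l hl hne => (hdec l hl hne).2.1
  have hdd : ∀ x, g₀ (AInf.d n (AInf.d n x)) = (tensor P FormsOp).d n (g₀ (AInf.d n x)) :=
    eq_on_d (F := g₀ ∘ₗ AInf.d n) (G := (tensor P FormsOp).d n ∘ₗ g₀)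
      fun l hl hne => (hdec l hl hne).1
  obtain ⟨X, hXm, hXd, hXr, hX0, hX1⟩ := exists_corolla_value hP hc₁ hc₂ hn htwo (hac n)
    (y := g₀ (AInf.d n (tree n [])))
    (by
      rw [d_tree, map_sum]
      refine Submodule.sum_mem _ fun e _ => ?_
      by_cases ht : TreeList n [e]
      · simpa using hg₀d [e] ht
      · rw [tree_of_not ht, map_zero]; exact Submodule.zero_mem _)
    (by rw [← hdd, AInf_d_d, map_zero])
    (by rw [← hrotd, ← AInf_d_rot, rot_corolla hn, map_smul, map_smul])
    (eq_on_d (F := evalAt P 0 n ∘ₗ g₀) (G := Δ₁.toFun n)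
      (fun l hl hne => (hdec l hl hne).2.2.1) _)
    (eq_on_d (F := evalAt P 1 n ∘ₗ g₀) (G := Δ₂.toFun n)
      (fun l hl hne => (hdec l hl hne).2.2.2) _)
    (by
      rintro rfl
      rw [d_tree, Finset.sum_eq_zero, map_zero]
      intro e he
      rw [mem_validEdges] at he
      unfold ValidEdge at he
      omega)
  obtain ⟨χ, hχ1, hχ0⟩ := exists_corolla_coeff n
  -- change `g₀`, which vanishes on the corolla, by the value `X` there
  obtain ⟨g, hg⟩ : ∃ g : AInf.carrier n →ₗ[ℚ] (tensor P FormsOp).carrier n,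
    ∀ x, g x = g₀ x + χ x • X := ⟨g₀ + χ.smulRight X, fun _ => rfl⟩
  have hgc : g (tree n []) = X := by rw [hg, hg₀c, hχ1 hn, one_smul, zero_add]
  have hgl : ∀ l, l ≠ [] → g (tree n l) = g₀ (tree n l) := fun l hl => by
    rw [hg, hχ0 l hl, zero_smul, add_zero]
  -- boundaries involve no corollas
  have hgd : ∀ x, g (AInf.d n x) = g₀ (AInf.d n x) := eq_on_d fun l _ hne => hgl l hne
  have hT : TreeList n [] := ⟨hn, by simp, List.Pairwise.nil⟩
  refine ⟨g, ?_, ?_, ?_, ?_, ?_, ?_⟩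
  · intro m k i lU lV hi him hN hU hV
    have h1 := hU.1
    have h2 := hV.1
    rw [Function.update_self, Function.update_of_ne (by omega), Function.update_of_ne (by omega),
      ← hmul m k i hi him hN]
    obtain ⟨δ, -, hδ⟩ := exists_comp_eq hi him hN hU hV (List.Perm.refl _)
    rw [hδ, map_smul, map_smul, hgl _ (by simp [graftList])]
  · intro l hl
    rw [Function.update_self]
    by_cases hne : l = []
    · subst hne
      rw [hgc]
      simpa using hXm
    · rw [hgl l hne]; exact hg₀d l hl
  · intro x
    rw [Function.update_self]
    refine LinearMap.congr_fun (AInf_hom_ext (f := g ∘ₗ AInf.d n)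
      (g := (tensor P FormsOp).d n ∘ₗ g) fun l hl => ?_) x
    rw [LinearMap.comp_apply, LinearMap.comp_apply, hgd]
    by_cases hne : l = []
    · subst hne
      rw [hgc, hXd]
    · rw [hgl l hne]; exact (hdec l hl hne).1
  · intro x
    rw [Function.update_self]
    refine LinearMap.congr_fun (AInf_hom_ext (f := g ∘ₗ AInf.rot n)
      (g := (tensor P FormsOp).rot n ∘ₗ g) fun l hl => ?_) x
    rw [LinearMap.comp_apply, LinearMap.comp_apply]
    by_cases hne : l = []
    · subst hne
      rw [rot_corolla hn, map_smul, hgc, hXr]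
    · rw [hgl l hne, ← (hdec l hl hne).2.1, rot_tree hl, map_smul, map_smul,
        hgl _ (by simpa using hne)]
  · intro x
    rw [Function.update_self]
    refine LinearMap.congr_fun (AInf_hom_ext (f := evalAt P 0 n ∘ₗ g)
      (g := Δ₁.toFun n) fun l hl => ?_) x
    rw [LinearMap.comp_apply]
    by_cases hne : l = []
    · subst hne; rw [hgc, hX0]
    · rw [hgl l hne]; exact (hdec l hl hne).2.2.1
  · intro x
    rw [Function.update_self]
    refine LinearMap.congr_fun (AInf_hom_ext (f := evalAt P 1 n ∘ₗ g)
      (g := Δ₂.toFun n) fun l hl => ?_) x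
    rw [LinearMap.comp_apply]
    by_cases hne : l = []
    · subst hne; rw [hgc, hX1]
    · rw [hgl l hne]; exact (hdec l hl hne).2.2.2

/-- Cyclic morphisms from `A∞` to an operad without homology outside degree zero are homotopic as
soon as they agree on the corolla with two leaves. -/
theorem exists_cyclicHomotopy (hP : P.Laws) (hc₁ : Δ₁.IsCyclic) (hc₂ : Δ₂.IsCyclic)
    (htwo : Δ₁.toFun 2 (tree 2 []) = Δ₂.toFun 2 (tree 2 []))
    (hac : ∀ n, ∀ p : ℤ, p ≠ 0 → ∀ z ∈ P.deg n p, P.d n z = 0 →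
      ∃ w ∈ P.deg n (p + 1), P.d n w = z) :
    ∃ h : Hom AInf (tensor P FormsOp), IsCyclicHomotopy Δ₁ Δ₂ h := by
  obtain ⟨h, H⟩ := exists_seq (fun n h => IsHomotopyUpTo P Δ₁ Δ₂ h n)
    (fun n X Y hXY hX => hX.congr hXY)
    (fun n h H => exists_homotopy_step hP hc₁ hc₂ htwo hac n h H)
  refine ⟨⟨h, ?_, fun n => (H n).d, ?_⟩,
    ⟨fun n => (H n).eval_zero, fun n => (H n).eval_one⟩, fun n => (H n).rot⟩
  · intro n p x hx
    refine AInf_deg_induction (C := fun x => h n x ∈ (tensor P FormsOp).deg n p) (by simp)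
      (fun x y hx hy => by rw [map_add]; exact Submodule.add_mem _ hx hy)
      (fun a x hx => by rw [map_smul]; exact Submodule.smul_mem _ _ hx) ?_ hx
    rintro l hl rfl
    exact (H n).deg l hl
  · intro m n i hi him x y
    rw [← OpData.compTo_self, ← OpData.compTo_self]
    exact comp_ext (fun lU lV hU hV =>
      (H (m + n - 1)).mul m n i lU lV hi him (by omega) hU hV) x y

end Step

theorem d_two (x : AInf.carrier 2) : AInf.d 2 x = 0 := by
  refine LinearMap.congr_fun (AInf_hom_ext (f := AInf.d 2) (g := 0) fun l _ => ?_) x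
  rw [d_tree, LinearMap.zero_apply, Finset.sum_eq_zero]
  intro e he
  rw [mem_validEdges] at he
  unfold ValidEdge at he
  omega

/-- There are no boundaries in arity two, so a diagonal is determined on the corolla with two
leaves. -/
theorem IsDiagonal.apply_two {Δ : Hom AInf (tensor AInf AInf)} (hΔ : IsDiagonal Δ) :
    Δ.toFun 2 (tree 2 []) = tm (tree 2 []) (tree 2 []) := by
  obtain ⟨w, hw⟩ := hΔ 2 (corolla 2) IsProduct.base
  have h0 : (tensor AInf AInf).d 2 = 0 := tensor_hom_ext fun a b => by
    rw [d_tm', d_two, d_two, map_zero, map_zero, LinearMap.zero_apply, add_zero,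
      LinearMap.zero_apply]
  rw [h0, LinearMap.zero_apply] at hw
  exact sub_eq_zero.1 hw.symm

end CyclicOperad

theorem theorem3p5
    (Δ₁ Δ₂ : CyclicOperad.Hom CyclicOperad.AInf
      (CyclicOperad.tensor CyclicOperad.AInf CyclicOperad.AInf))
    (hΔ₁ : CyclicOperad.IsCyclicDiagonal Δ₁) (hΔ₂ : CyclicOperad.IsCyclicDiagonal Δ₂) :
    ∃ h : CyclicOperad.Hom CyclicOperad.AInf
        (CyclicOperad.tensor (CyclicOperad.tensor CyclicOperad.AInf CyclicOperad.AInf)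
          CyclicOperad.FormsOp),
      CyclicOperad.IsCyclicHomotopy Δ₁ Δ₂ h :=
  CyclicOperad.exists_cyclicHomotopy
    (CyclicOperad.tensor_laws CyclicOperad.AInf_laws CyclicOperad.AInf_laws) hΔ₁.2 hΔ₂.2
    (hΔ₁.1.apply_two.trans hΔ₂.1.apply_two.symm)
    fun n _ hp _ hz hdz => CyclicOperad.exists_d_eq_of_contraction CyclicOperad.AInf_laws
      (CyclicOperad.AInfContraction n) (CyclicOperad.AInfContraction n) hp hz hdz
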